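/- **Theorem.** A walk on $\mathbb Z$ is a pair $w=(p,s)$ of a starting point $p$ and steps $s_1,\dots,s_n\in\{\pm1\}$; its points are $p_i=p+s_1+\dots+s_i$ $(0\le i\le n)$, its length is $n$, and it is closed if $p_n=p$. The multiplicity of $q\in\mathbb Z$ in $w$ is $\delta_{q,p_0}+\delta_{q,p_n}+2\sum_{i=1}^{n-1}\delta_{q,p_i}$, and $N_{2k}(w)$ is the number of $q$ of multiplicity exactly $2k$ $(k\ge1)$. Let $N\in\mathbb N$ and let $W_{2N}$ be the set of closed walks from $0$ to $0$ with $0<\mathrm{length}(w)\le 2N$. For a formal power series $g=\sum a_nz^n$ put $(g)_{z\diamond 2N}=\sum_{n\le 2N}a_nz^n$. Let $A(z)=\sqrt{1-4z^2}$ (with $A(0)=1$) and $B(z)=\frac{2z}{1+A(z)}$, as formal power series. For arbitrary $\Lambda_k\in\mathbb C$ $(k\ge1)$ put $t_k=e^{\Lambda_k}-1$. Then, as formal power series in $z$, $$\sum_{w\in W_{2N}}\exp\Bigl(\sum_{k\ge1}\Lambda_kN_{2k}(w)\Bigr)z^{\mathrm{length}(w)}=z\frac{\partial}{\partial z}\Bigl[T_0+\sum_{k\ge1}t_kT_1^{(k)}+\sum_{k_1,k_2\ge1}t_{k_1}t_{k_2}T_2^{(k_1),(k_2)}+\sum_{k_1,k_2,k_3\ge1}t_{k_1}t_{k_2}t_{k_3}T_{\ge3}^{(k_1),(k_2),(k_3)}\Bigr],$$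 where $$T_0=\Bigl(\log\tfrac{2}{1+A}\Bigr)_{z\diamond 2N},\qquad T_1^{(k)}=\Bigl(\tfrac1k(1-A)^k\Bigr)_{z\diamond 2N},$$ $$G_{i,j}=\Bigl((-1)^{i+j}A^{i+j}\sum_{f\ge\max(i,j)}\tfrac1f\tbinom fi\tbinom fj\tfrac{B^{2f}}{1-B^{2f}}\Bigr)_{z\diamond 2N},\qquad H_{i,j}=\Bigl(A^j\sum_{f\ge j-i}\tbinom{f+i-1}{j-1}\tfrac{B^{2f}}{1-B^{2f}}\Bigr)_{z\diamond 2N},$$ $$T_2^{(k_1),(k_2)}=\Bigl(\sum_{l_1=0}^{k_1-1}\sum_{l_2=0}^{k_2-1}\tbinom{k_1-1}{l_1}\tbinom{k_2-1}{l_2}(1-A)^{l_1+l_2}G_{k_1-l_1,k_2-l_2}\Bigr)_{z\diamond 2N},$$ and, with vectors and matrices indexed by the pairs $(\varrho,t)$, $0\le\varrho,t<N$ (and $1/m!:=0$ for $m<0$), $$\Psi_{(\varrho,t)}(k)=\Bigl(\delta_{t,0}(-1)^{\varrho+1}\sum_{l=0}^{k-1}\tbinom{k-1}{l}(1-A)^lG_{\varrho+1,k-l}\Bigr)_{z\diamond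 2N},$$ $$\Phi_{(\varrho,t)}(k_1,k_2)=\Bigl(\frac{(-1)^{\varrho+1}(k_1-1)!}{\varrho!\,(k_1-2-\varrho-t)!}T_2^{(k_1-1-\varrho-t),(k_2)}\Bigr)_{z\diamond 2N},$$ $$Q_{(\varrho,t),(\tilde\varrho,\tilde t)}(k)=\Bigl(\frac1{\tilde t!\,(\tilde t+1)!\,\varrho!}\sum_{\eta=0}^{k-2-\varrho-t-\tilde t}\frac{(k-1)!\,(-1)^{\varrho+\eta}(1-A)^{k-2-\varrho-t-\tilde t-\eta}}{\eta!\,(k-2-\varrho-t-\tilde t-\eta)!}H_{\tilde t+1,\tilde\varrho+\eta+2\tilde t+2}\Bigr)_{z\diamond 2N},$$ $$T_{\ge3}^{(k_1),(k_2),(k_3)}=\Bigl\langle\Psi(k_1)\Big|\Bigl(\mathbf I-\sum_{k\ge1}t_kQ(k)\Bigr)^{-1}\Phi(k_2,k_3)\Bigr\rangle_{z\diamond 2N}.$$ Here all sums over $k$, $(k_1,k_2)$, $(k_1,k_2,k_3)$ have only finitely many nonzero terms, and $\mathbf I-\sum_kt_kQ(k)$ is invertible over $\mathbb C[[z]]$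 with inverse given by the (coefficientwise finite) geometric series $\sum_{m\ge0}\bigl(\sum_kt_kQ(k)\bigr)^m$. -/

import Mathlib

open scoped PowerSeries

namespace ClosedWalk

/-! ### Walks on `ℤ` and the multiple point range -/

/-- A walk on the one-dimensional lattice `ℤ`: a starting point and a finite sequence of steps,
each step being `+1` or `-1`. -/
@[ext]
structure Walk where
  start : ℤ
  steps : List ℤˣ

namespace Walk

/-- The length of a walk, i.e. its number of steps. -/
def length (w : Walk) : ℕ := w.steps.length

/-- The `i`-th point `p_i = p + s_1 + ⋯ + s_i` of a walk (for `0 ≤ i ≤ length`). -/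
def point (w : Walk) (i : ℕ) : ℤ := w.start + ((w.steps.take i).map (fun s => (s : ℤ))).sum

/-- A walk is closed if its ending point is its starting point. -/
def IsClosed (w : Walk) : Prop := w.point w.length = w.start

/-- The multiplicity of `q` with respect to `w`: number of incoming plus number of outgoing steps,
`δ_{q,p_0} + δ_{q,p_n} + 2 ∑_{i=1}^{n-1} δ_{q,p_i}`. -/
def mult (q : ℤ) (w : Walk) : ℕ :=
  (if q = w.start then 1 else 0) + (if q = w.point w.length then 1 else 0) +
    2 * ∑ i ∈ Finset.Ico 1 w.length, (if q = w.point i then 1 else 0)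

/-- `N_{2k}(w)`: the number of lattice points of multiplicity exactly `2k` (for `k ≥ 1`). -/
noncomputable def rangeCount (k : ℕ) (w : Walk) : ℕ := {q : ℤ | mult q w = 2 * k}.ncard

end Walk

/-- The closed walks which start and end in `0`, of positive length at most `2N`. -/
def walks (N : ℕ) : Set Walk :=
  {w | w.start = 0 ∧ w.IsClosed ∧ 0 < w.length ∧ w.length ≤ 2 * N}

theorem walks_finite (N : ℕ) : (walks N).Finite := by
  refine ((List.finite_length_le ℤˣ (2 * N)).image (fun l => (⟨0, l⟩ : Walk))).subset ?_
  rintro ⟨p, s⟩ ⟨h0, -, -, hl⟩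
  exact ⟨s, hl, by simp only [Walk.mk.injEq, and_true]; exact h0.symm⟩

/-! ### Formal power series in `z` -/

/-- The projection `(g)_{z ⋄ m}`: the part of the series `g` of degree at most `m`. -/
noncomputable def proj (m : ℕ) (g : ℂ⟦X⟧) : ℂ⟦X⟧ := (PowerSeries.trunc (m + 1) g : Polynomial ℂ)

/-- The sum `∑_{f ≥ 0} a f` of a sequence of formal power series in which every power of `z`
occurs in only finitely many terms, formed coefficient by coefficient. -/
noncomputable def formalSum (a : ℕ → ℂ⟦X⟧) : ℂ⟦X⟧ :=
  PowerSeries.mk fun n => ∑ᶠ f, PowerSeries.coeff n (a f)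

/-- `A(z) = √(1 - 4z²) = (1 - 4z²)^{1/2}`, as a (binomial) power series. -/
noncomputable def A : ℂ⟦X⟧ :=
  (PowerSeries.binomialSeries ℂ (1 / 2 : ℚ)).subst ((-4 : ℂ) • (PowerSeries.X : ℂ⟦X⟧) ^ 2)

theorem hasSubst_aux : PowerSeries.HasSubst ((-4 : ℂ) • (PowerSeries.X : ℂ⟦X⟧) ^ 2) :=
  PowerSeries.HasSubst.of_constantCoeff_zero' (by simp)

/-- `A` is the square root of `1 - 4z²` ... -/
theorem A_sq : A ^ 2 = 1 - 4 * (PowerSeries.X : ℂ⟦X⟧) ^ 2 := by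
  have h : PowerSeries.binomialSeries ℂ (1 / 2 : ℚ) * PowerSeries.binomialSeries ℂ (1 / 2 : ℚ)
      = 1 + PowerSeries.X := by
    rw [← PowerSeries.binomialSeries_add]
    have := PowerSeries.binomialSeries_nat (R := ℚ) (A := ℂ) 1
    norm_num at this ⊢
    exact this
  have h1 : PowerSeries.subst ((-4 : ℂ) • (PowerSeries.X : ℂ⟦X⟧) ^ 2) (1 : ℂ⟦X⟧) = 1 := by
    rw [← PowerSeries.coe_substAlgHom hasSubst_aux, map_one]
  rw [A, sq, ← PowerSeries.subst_mul hasSubst_aux, h, PowerSeries.subst_add hasSubst_aux, h1,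
    PowerSeries.subst_X hasSubst_aux, PowerSeries.smul_eq_C_mul]
  simp [sub_eq_add_neg, map_ofNat]

/-- ... with constant term `1`. -/
theorem constantCoeff_A : PowerSeries.constantCoeff A = 1 := by
  have h : PowerSeries.constantCoeff (PowerSeries.binomialSeries ℂ (1 / 2 : ℚ) - 1) = 0 := by simp
  have h2 := PowerSeries.constantCoeff_subst_eq_zero
    (a := (-4 : ℂ) • (PowerSeries.X : ℂ⟦X⟧) ^ 2) (by
      change PowerSeries.constantCoeff _ = 0
      simp) _ h
  rw [← PowerSeries.coe_substAlgHom hasSubst_aux, map_sub, map_one] at h2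
  rw [PowerSeries.coe_substAlgHom hasSubst_aux] at h2
  change PowerSeries.constantCoeff (A - 1) = 0 at h2
  simpa [sub_eq_zero] using h2

/-- `B(z) = 2z / (1 + A(z))`. -/
noncomputable def B : ℂ⟦X⟧ := 2 * PowerSeries.X * (1 + A)⁻¹

/-- The series `B(z)^{2f} / (1 - B(z)^{2f})` (used for `f ≥ 1`). -/
noncomputable def lambert (f : ℕ) : ℂ⟦X⟧ := B ^ (2 * f) * (1 - B ^ (2 * f))⁻¹

/-- `G_{i,j}(z)` (used for `i, j ≥ 1`). -/
noncomputable def G (N i j : ℕ) : ℂ⟦X⟧ :=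
  proj (2 * N) ((-1) ^ (i + j) * A ^ (i + j) * formalSum fun f =>
    if max i j ≤ f then ((1 / f : ℂ) * (f.choose i) * (f.choose j)) • lambert f else 0)

/-- `H_{i,j}(z)` (used for `1 ≤ i < j`). -/
noncomputable def H (N i j : ℕ) : ℂ⟦X⟧ :=
  proj (2 * N) (A ^ j * formalSum fun f =>
    if j - i ≤ f then ((f + i - 1).choose (j - 1) : ℂ) • lambert f else 0)

/-! ### The terms of the generating function -/

/-- `T_0(z) = log (2 / (1 + A(z)))`. -/
noncomputable def T0 (N : ℕ) : ℂ⟦X⟧ := proj (2 * N) (PowerSeries.logOf (2 * (1 + A)⁻¹))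

/-- `T_1(z)^{(k)}`. -/
noncomputable def T1 (N k : ℕ) : ℂ⟦X⟧ := proj (2 * N) ((1 / k : ℂ) • (1 - A) ^ k)

/-- `T_2(z)^{(k₁),(k₂)}`. -/
noncomputable def T2 (N k₁ k₂ : ℕ) : ℂ⟦X⟧ :=
  proj (2 * N) (∑ l₁ ∈ Finset.range k₁, ∑ l₂ ∈ Finset.range k₂,
    (((k₁ - 1).choose l₁ : ℂ) * ((k₂ - 1).choose l₂)) •
      ((1 - A) ^ (l₁ + l₂) * G N (k₁ - l₁) (k₂ - l₂)))

/-- The index pairs `(ϱ, t)` with `0 ≤ ϱ, t < N`. -/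
abbrev Idx (N : ℕ) : Type := Fin N × Fin N

/-- The vector `Ψ(k, z)`. -/
noncomputable def Psi (N k : ℕ) : Idx N → ℂ⟦X⟧ := fun a =>
  let ρ : ℕ := a.1
  let t : ℕ := a.2
  proj (2 * N) (if t = 0 then
    (-1) ^ (ρ + 1) * ∑ l ∈ Finset.range k,
      ((k - 1).choose l : ℂ) • ((1 - A) ^ l * G N (ρ + 1) (k - l))
    else 0)

/-- The vector `Φ(k₁, k₂, z)`; a reciprocal factorial of a negative integer is read as `0`. -/
noncomputable def Phi (N k₁ k₂ : ℕ) : Idx N → ℂ⟦X⟧ := fun a =>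
  let ρ : ℕ := a.1
  let t : ℕ := a.2
  proj (2 * N) (if ρ + t + 2 ≤ k₁ then
    ((-1 : ℂ) ^ (ρ + 1) * ((k₁ - 1).factorial : ℂ) /
      ((ρ.factorial : ℂ) * ((k₁ - 2 - ρ - t).factorial : ℂ))) • T2 N (k₁ - 1 - ρ - t) k₂
    else 0)

/-- The matrix `Q(k, z)`; the sum over `0 ≤ η ≤ k - 2 - ϱ - t - t'` is empty if the upper bound
is negative. -/
noncomputable def Q (N k : ℕ) : Matrix (Idx N) (Idx N) ℂ⟦X⟧ := fun a b =>
  let ρ : ℕ := a.1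
  let t : ℕ := a.2
  let ρ' : ℕ := b.1
  let t' : ℕ := b.2
  proj (2 * N) (if ρ + t + t' + 2 ≤ k then
    (1 / ((t'.factorial : ℂ) * ((t' + 1).factorial : ℂ) * (ρ.factorial : ℂ))) •
      ∑ η ∈ Finset.range (k - 2 - ρ - t - t' + 1),
        (((k - 1).factorial : ℂ) * (-1) ^ (ρ + η) /
          ((η.factorial : ℂ) * ((k - 2 - ρ - t - t' - η).factorial : ℂ))) •
        ((1 - A) ^ (k - 2 - ρ - t - t' - η) * H N (t' + 1) (ρ' + η + 2 * t' + 2))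
    else 0)

/-- The matrix `∑_{k ≥ 1} t_k Q(k, z)`. -/
noncomputable def Qsum (N : ℕ) (t : ℕ+ → ℂ) : Matrix (Idx N) (Idx N) ℂ⟦X⟧ :=
  ∑ᶠ k : ℕ+, t k • Q N k

/-- `T_{≥3}(z)^{(k₁),(k₂),(k₃)} = ⟨Ψ(k₁) | (I - ∑ t_k Q(k))⁻¹ ⋆ Φ(k₂, k₃)⟩`, for the
parameters `t`. -/
noncomputable def T3 (N : ℕ) (t : ℕ+ → ℂ) (k₁ k₂ k₃ : ℕ) : ℂ⟦X⟧ :=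
  proj (2 * N) (Psi N k₁ ⬝ᵥ Matrix.mulVec (1 - Qsum N t)⁻¹ (Phi N k₂ k₃))

end ClosedWalk

/-!
The proof encodes a walk by its numbers of crossings and resums over the sites which carry a
weight other than `1`.

**Profiles.** A closed walk steps equally often in both directions across each edge of `ℤ`; let
`u` be the number of crossings in one direction. A site between edges with `u` and `v` crossings
is visited `u + v` times, has multiplicity `2 (u + v)`, and so has weight `τ (u + v)`, where
`τ k = exp Λ_k = 1 + t_k`. Give an edge with `u` crossings the weight
`D_u = z ^ (2 u) / (u! (u - 1)!)`, a site in the interior of the range the weight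
`(u + v - 1)! τ (u + v)`, and a site at one end of the range the weight `e_u = (u - 1)! τ u`. Let
`V` be the matrix of the interior site weights and `F = ⟨e | r⟩`, `r = D (e + V r)`, the sum over
all sequences of crossing numbers. As `z d/dz D_u = 2 u D_u`, the derivative `z F'` marks one of
the steps, and it is the sum over the walks (`derivation_dotProduct`,
`sum_edge_mul_eq_visitWeight`). The latter rests on `visitWeight_mul_excursion_pow`: the
generating polynomial of the walks, with one variable per site recording the visits, is a
continued fraction, and the linear functional which sends a monomial to the product of the weights
of its sites can be evaluated on it one site at a time.

**Unmarked sites.** Write `τ = 1 + t` and call a site marked if the term `t` is chosen. The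
transfer operator of the unmarked sites is diagonalised explicitly. Put `y = (1 - A) / 2`, so that
`y (1 - y) = z²` and `B² = y / (1 - y)`. The powers of the Möbius function
`(1 - (1 - y) ε) / (1 - y ε)` generate eigenvectors with the eigenvalues `B ^ (2 f)`
(`sum_edgeWeight_mul_eigVec`), and they are complete (`sum_eigVec_mul_eigVec`). Hence the Green's
function between marked sites has the spectral expansion with the Lambert terms
`B ^ (2 f) / (1 - B ^ (2 f))` (`green_eq`); in the basis of divided powers of `y` its coefficients
are the `G_{i,j}` (`green_eq_sum_gCoeff`).

**Resummation.** A double Vandermonde identity (`choose_mul_choose_eq_sum`) factors the Green's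
function through the pairs `(ϱ, t)`, the inner coefficients being the `H_{i,j}`
(`green_eq_sum_edge`). Expanding `F` in the number of marked sites, the terms with zero, one and
two of them are `T_0`, `T_1` and `T_2`, and the remaining geometric series, moved to the side of
the pairs `(ϱ, t)`, is the resolvent of `∑ t_k Q(k)` (`dotProduct_eq_resolvent`).

All of this takes place in power series modulo `z ^ (2 N + 1)`. There `y` is nilpotent, so that
the sums over `f` and over the crossing numbers are finite; the inverse of `1 - y` is carried
along as an element `a` with `a * (1 - y) = 1`. Crossing numbers and visit numbers are counted
from zero: the indices `i` and `κ` stand for `i + 1` crossings and `κ + 1` visits.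
-/

namespace ClosedWalk

/-! ### The crossing series and its powers -/

section Crossing

variable {R : Type*} [CommRing R]

/-- The geometric series `1 / (1 - y ε)` in the variable `ε`. -/
noncomputable def geom (y : R) : R⟦X⟧ := PowerSeries.mk fun n => y ^ n

theorem one_sub_mul_geom (y : R) :
    (1 - PowerSeries.C y * PowerSeries.X) * geom y = 1 := by
  ext n
  cases n with
  | zero => simp [geom, sub_mul, mul_assoc]
  | succ n =>
    simp [geom, sub_mul, mul_assoc, PowerSeries.coeff_one, PowerSeries.coeff_succ_X_mul, pow_succ']

theorem isUnit_one_sub (y : R) : IsUnit (1 - PowerSeries.C y * PowerSeries.X : R⟦X⟧) :=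
  IsUnit.of_mul_eq_one _ (one_sub_mul_geom y)

theorem geom_pow_succ (y : R) (q : ℕ) :
    geom y ^ (q + 1) = PowerSeries.mk fun n => ((q + n).choose q : R) * y ^ n := by
  have h1 : geom y = PowerSeries.rescale y (PowerSeries.mk 1) := by
    ext n; simp [geom, PowerSeries.coeff_rescale]
  rw [h1, ← map_pow, PowerSeries.mk_one_pow_eq_mk_choose_add]
  ext n
  simp [PowerSeries.coeff_rescale, mul_comm]

/-- The series `(1 - (1 - y) ε) / (1 - y ε)` in the variable `ε`. Its powers are the generating
functions of the eigenvectors of the transfer operator of an unmarked site. -/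
noncomputable def crossing (y : R) : R⟦X⟧ :=
  1 + PowerSeries.C (-(1 - 2 * y)) * PowerSeries.X * geom y

theorem one_sub_mul_crossing (y : R) :
    (1 - PowerSeries.C y * PowerSeries.X) * crossing y =
      1 - PowerSeries.C (1 - y) * PowerSeries.X := by
  have h := one_sub_mul_geom y
  simp only [crossing, map_neg, map_sub, map_mul, map_one, map_ofNat]
  linear_combination (-(1 - 2 * PowerSeries.C y) * PowerSeries.X) * h

/-- The coefficient of `ε ^ u` in the `f`-th power of the crossing series. -/
noncomputable def crossCoeff (y : R) (f u : ℕ) : R := PowerSeries.coeff u (crossing y ^ f)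

theorem crossCoeff_succ (y : R) (f i : ℕ) :
    crossCoeff y f (i + 1) = ∑ p ∈ Finset.range f,
      (f.choose (p + 1) : R) * (-(1 - 2 * y)) ^ (p + 1) * (i.choose p * y ^ (i - p)) := by
  rw [crossCoeff, crossing, add_comm (1 : R⟦X⟧), add_pow, map_sum, Finset.sum_range_succ']
  simp only [one_pow, mul_one, pow_zero, Nat.choose_zero_right, Nat.cast_one,
    PowerSeries.coeff_one, Nat.succ_ne_zero, if_false, add_zero]
  refine Finset.sum_congr rfl fun p _ => ?_
  have e : (PowerSeries.C (-(1 - 2 * y)) * PowerSeries.X * geom y) ^ (p + 1) *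
      (f.choose (p + 1) : R⟦X⟧) =
      PowerSeries.C ((f.choose (p + 1) : R) * (-(1 - 2 * y)) ^ (p + 1)) *
        (PowerSeries.X ^ (p + 1) * geom y ^ (p + 1)) := by
    rw [map_mul, map_pow, map_natCast]; ring
  rw [e, geom_pow_succ, PowerSeries.coeff_C_mul, PowerSeries.coeff_X_pow_mul']
  congr 1
  split_ifs with h
  · rw [PowerSeries.coeff_mk, Nat.add_sub_add_right, Nat.add_sub_cancel' (by omega)]
  · rw [Nat.choose_eq_zero_of_lt (by omega)]; simp

/-- The transfer operator of an unmarked site multiplies the `f`-th power of the crossing series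
by `b ^ f`, where `b = y / (1 - y)`. -/
theorem pow_mul_crossCoeff {y a : R} (ha : a * (1 - y) = 1) (f i : ℕ) :
    (y * a) ^ f * crossCoeff y f (i + 1) = y ^ (i + 1) * ∑ p ∈ Finset.range f,
      (f.choose (p + 1) : R) * (-((1 - 2 * y) * a)) ^ (p + 1) * ((i + p + 1).choose p : R) := by
  have key : PowerSeries.C (y * a) * crossing y =
      1 + PowerSeries.C (-((1 - 2 * y) * a)) * geom y := by
    apply (isUnit_one_sub y).mul_left_cancel
    have h1 := one_sub_mul_crossing y
    have h2 := one_sub_mul_geom y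
    have h3 : PowerSeries.C a * (1 - PowerSeries.C y) = (1 : R⟦X⟧) := by
      rw [← map_one (PowerSeries.C (R := R)), ← map_sub, ← map_mul, ha]
    simp only [map_neg, map_sub, map_mul, map_one, map_ofNat] at h1 ⊢
    linear_combination (PowerSeries.C y * PowerSeries.C a) * h1 +
      ((1 - 2 * PowerSeries.C y) * PowerSeries.C a) * h2 +
      (1 - PowerSeries.C y * PowerSeries.X) * h3
  have h : (y * a) ^ f * crossCoeff y f (i + 1) =
      PowerSeries.coeff (i + 1) ((PowerSeries.C (y * a) * crossing y) ^ f) := by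
    rw [mul_pow (PowerSeries.C (y * a)), ← map_pow, PowerSeries.coeff_C_mul, crossCoeff]
  rw [h, key, add_comm (1 : R⟦X⟧), add_pow, map_sum, Finset.sum_range_succ']
  simp only [one_pow, mul_one, pow_zero, Nat.choose_zero_right, Nat.cast_one,
    PowerSeries.coeff_one, Nat.succ_ne_zero, if_false, add_zero]
  rw [Finset.mul_sum]
  refine Finset.sum_congr rfl fun p _ => ?_
  rw [mul_pow, ← map_pow, geom_pow_succ,
    ← map_natCast (PowerSeries.C (R := R)), mul_comm, ← mul_assoc, ← map_mul,
    PowerSeries.coeff_C_mul, PowerSeries.coeff_mk, show p + (i + 1) = i + p + 1 by ring]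
  ring

theorem crossCoeff_map {S : Type*} [CommRing S] (φ : R →+* S) (y : R) (f u : ℕ) :
    crossCoeff (φ y) f u = φ (crossCoeff y f u) := by
  have h : crossing (φ y) = PowerSeries.map φ (crossing y) := by
    have h1 : geom (φ y) = PowerSeries.map φ (geom y) := by ext; simp [geom]
    have h2 : φ (-(1 - 2 * y)) = -(1 - 2 * φ y) := by simp [map_ofNat]
    rw [crossing, crossing, map_add, map_mul, map_mul, PowerSeries.map_C, PowerSeries.map_X, h1, h2,
      map_one]
  rw [crossCoeff, crossCoeff, h, ← map_pow, PowerSeries.coeff_map]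

end Crossing

section Completeness

variable {R : Type*} [CommRing R] [Algebra ℂ R]

/-- Completeness, with the second factor summed against powers of `d`, that is
`ψ = (1 - (1 - y) d) / (1 - y d)`: the sum `∑_f (b ψ φ) ^ f / f`, where `b = y a` and `φ` is the
crossing series, is a truncated logarithm, and its derivative splits into the partial fractions
`y (1 - y) d / (1 - y (1 - y) d ε) - y / (1 - y ε)`. -/
theorem sum_crossCoeff_mul_pow {y a d ψ : R} {n : ℕ} (ha : a * (1 - y) = 1)
    (hy : y ^ (n + 1) = 0)
    (hψ : (1 - y * d) * ψ = 1 - (1 - y) * d) (i : ℕ) :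
    ((i : R) + 1) * ∑ f ∈ Finset.range (n + 1),
      (1 / f : ℂ) • ((y * a * ψ) ^ f * crossCoeff y f (i + 1)) =
      (y * (1 - y) * d) ^ (i + 1) - y ^ (i + 1) := by
  set U : R⟦X⟧ := PowerSeries.C (y * a * ψ) * crossing y with hU
  set P : R⟦X⟧ := ∑ f ∈ Finset.range (n + 1), (1 / f : ℂ) • U ^ f with hP
  have hnil : U ^ n * PowerSeries.C (y * a * ψ) = 0 := by
    rw [hU, mul_pow, mul_right_comm, ← pow_succ, ← map_pow, mul_assoc, mul_pow, hy]; simp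
  have hdP : PowerSeries.derivative R P = (∑ f ∈ Finset.range n, U ^ f) *
      PowerSeries.derivative R U := by
    rw [hP, map_sum, Finset.sum_range_succ', Finset.sum_mul]
    simp only [Nat.cast_zero, div_zero, zero_smul, map_zero, add_zero]
    refine Finset.sum_congr rfl fun f _ => ?_
    have : ((1 / ((f + 1 : ℕ) : ℂ)) • U ^ (f + 1)) =
        PowerSeries.C (algebraMap ℂ R (1 / ((f + 1 : ℕ) : ℂ))) * U ^ (f + 1) := by
      rw [← PowerSeries.smul_eq_C_mul, algebraMap_smul]
    rw [this, ← PowerSeries.smul_eq_C_mul, Derivation.map_smul, PowerSeries.derivative_pow,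
      PowerSeries.smul_eq_C_mul, Nat.add_sub_cancel, ← mul_assoc, ← mul_assoc,
      ← map_natCast (PowerSeries.C (R := R)), ← map_mul, ← map_natCast (algebraMap ℂ R), ← map_mul,
      one_div, inv_mul_cancel₀ (Nat.cast_ne_zero.mpr (Nat.succ_ne_zero f))]
    simp
  have hdU : PowerSeries.derivative R U =
      PowerSeries.C (y * a * ψ) * PowerSeries.derivative R (crossing y) := by
    rw [hU, ← PowerSeries.smul_eq_C_mul, Derivation.map_smul, PowerSeries.smul_eq_C_mul]
  have h1 : (1 - U) * PowerSeries.derivative R P = PowerSeries.derivative R U := by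
    have := mul_neg_geom_sum U n
    rw [hdP, ← mul_assoc, this, sub_mul, one_mul, hdU, ← mul_assoc, hnil, zero_mul, sub_zero]
  have hc := one_sub_mul_crossing y
  have hdc : (1 - PowerSeries.C y * PowerSeries.X) ^ 2 * PowerSeries.derivative R (crossing y) =
      - (1 - 2 * PowerSeries.C y) := by
    have h := congrArg (PowerSeries.derivative R) hc
    simp only [Derivation.leibniz, map_sub, smul_eq_mul, PowerSeries.derivative_X,
      PowerSeries.derivative_C, Derivation.map_one_eq_zero] at h
    simp only [map_sub, map_one] at hc
    simp only [map_one] at h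
    linear_combination (1 - PowerSeries.C y * PowerSeries.X) * h + PowerSeries.C y * hc
  have hA : IsUnit (1 - 2 * PowerSeries.C y : R⟦X⟧) := by
    have : IsNilpotent (2 * PowerSeries.C y : R⟦X⟧) :=
      ⟨n + 1, by rw [mul_pow, ← map_pow, hy]; simp⟩
    exact this.isUnit_one_sub
  have ha' : PowerSeries.C a * (1 - PowerSeries.C y) = (1 : R⟦X⟧) := by
    rw [← map_one (PowerSeries.C (R := R)), ← map_sub, ← map_mul, ha]
  have hψ' : (1 - PowerSeries.C y * PowerSeries.C d) * PowerSeries.C ψ =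
      (1 - (1 - PowerSeries.C y) * PowerSeries.C d : R⟦X⟧) := by
    simpa using congrArg (PowerSeries.C (R := R)) hψ
  set D1 := PowerSeries.derivative R P with hD1
  have h2 : (1 - PowerSeries.C y * PowerSeries.X) *
      (1 - PowerSeries.C (y * (1 - y) * d) * PowerSeries.X) * D1 =
      PowerSeries.C (y * (1 - y) * d) - PowerSeries.C y := by
    -- `1 - 2 y`, up to sign the numerator of the derivative of the crossing series, is a unit
    -- because `y` is nilpotent
    apply hA.mul_left_cancel
    rw [hdU] at h1
    simp only [hU] at h1
    simp only [map_sub, map_one, map_mul] at h1 hc ⊢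
    set Y := (PowerSeries.C y : R⟦X⟧)
    set A' := (PowerSeries.C a : R⟦X⟧)
    set E := (PowerSeries.C d : R⟦X⟧)
    set Z := (PowerSeries.C ψ : R⟦X⟧)
    set x := (PowerSeries.X : R⟦X⟧)
    set φ := crossing y
    set dφ := PowerSeries.derivative R φ
    have e1 : (1 - Y * E) * ((1 - Y * x) * (1 - Y * A' * Z * φ)) =
        (1 - Y * A') * (1 - Y * (1 - Y) * E * x) := by
      linear_combination (-(Y * A') * (1 - Y * E) * Z) * hc -
        (Y * A') * (1 - (1 - Y) * x) * hψ' + Y * (E + x - E * x) * ha'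
    have e2 : (1 - Y * A') * (1 - Y * (1 - Y) * E * x) * (1 - Y * x) * D1 =
        - (Y * A') * (1 - 2 * Y) * (1 - (1 - Y) * E) := by
      linear_combination (-(1 - Y * x) * D1) * e1 + (1 - Y * E) * (1 - Y * x) ^ 2 * h1 +
        (1 - Y * E) * (Y * A' * Z) * hdc - (Y * A') * (1 - 2 * Y) * hψ'
    linear_combination (1 - Y) * e2 + (Y * (1 - Y * (1 - Y) * E * x) * (1 - Y * x) * D1 -
      Y * (1 - 2 * Y) * (1 - (1 - Y) * E)) * ha'
  have h3 : D1 = PowerSeries.C (y * (1 - y) * d) * geom (y * (1 - y) * d) -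
      PowerSeries.C y * geom y := by
    apply ((isUnit_one_sub y).mul (isUnit_one_sub (y * (1 - y) * d))).mul_left_cancel
    rw [h2]
    linear_combination (PowerSeries.C y * (1 - PowerSeries.C (y * (1 - y) * d) * PowerSeries.X)) *
      one_sub_mul_geom y - (PowerSeries.C (y * (1 - y) * d) *
        (1 - PowerSeries.C y * PowerSeries.X)) * one_sub_mul_geom (y * (1 - y) * d)
  have h4 := congrArg (PowerSeries.coeff i) h3
  rw [hD1, PowerSeries.coeff_derivative, map_sub, PowerSeries.coeff_C_mul,
    PowerSeries.coeff_C_mul] at h4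
  simp only [geom, PowerSeries.coeff_mk, ← pow_succ'] at h4
  rw [← h4, mul_comm]
  congr 1
  rw [hP, map_sum]
  refine Finset.sum_congr rfl fun f _ => ?_
  rw [PowerSeries.coeff_smul, hU, mul_pow (PowerSeries.C (y * a * ψ)), ← map_pow,
    PowerSeries.coeff_C_mul, crossCoeff]

/-- Completeness of the powers of the crossing series: `sum_crossCoeff_mul_pow` over `R⟦X⟧`, with
`d` the variable. -/
theorem sum_crossCoeff_mul_crossCoeff {y a : R} {n : ℕ} (ha : a * (1 - y) = 1)
    (hy : y ^ (n + 1) = 0) (i j : ℕ) :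
    ∑ f ∈ Finset.range (n + 1), (1 / f : ℂ) •
      ((y * a) ^ f * crossCoeff y f (i + 1) * crossCoeff y f (j + 1)) =
      if i = j then (1 / ((i : ℂ) + 1)) • (y * (1 - y)) ^ (i + 1) else 0 := by
  have h := sum_crossCoeff_mul_pow (R := R⟦X⟧) (y := PowerSeries.C y) (a := PowerSeries.C a)
    (d := PowerSeries.X) (ψ := crossing y) (n := n)
    (by rw [← map_one (PowerSeries.C (R := R)), ← map_sub, ← map_mul, ha])
    (by rw [← map_pow, hy, map_zero])
    (by simpa using one_sub_mul_crossing y) i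
  have h' := congrArg (PowerSeries.coeff (j + 1)) h
  have e1 : ((i : R⟦X⟧) + 1) = PowerSeries.C ((i : R) + 1) := by simp
  rw [e1, PowerSeries.coeff_C_mul, map_sum] at h'
  have e2 : PowerSeries.coeff (j + 1) ((PowerSeries.C y * (1 - PowerSeries.C y) *
      PowerSeries.X) ^ (i + 1) - PowerSeries.C y ^ (i + 1) : R⟦X⟧) =
      if i = j then (y * (1 - y)) ^ (i + 1) else 0 := by
    rw [← map_one (PowerSeries.C (R := R)), ← map_sub, ← map_mul, mul_pow, ← map_pow, ← map_pow,
      map_sub, PowerSeries.coeff_C_mul, PowerSeries.coeff_X_pow, PowerSeries.coeff_C]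
    by_cases hij : i = j
    · simp [hij]
    · have : ¬ (j = i) := fun h => hij h.symm
      simp [hij, this]
  rw [e2] at h'
  have hne : ((i : ℂ) + 1) ≠ 0 := by exact_mod_cast Nat.succ_ne_zero i
  have hsm : ∀ x : R, ((i : R) + 1) * x = ((i : ℂ) + 1) • x := fun x => by
    rw [Algebra.smul_def]; simp
  have key : ∀ x w : R, ((i : R) + 1) * x = w → x = (1 / ((i : ℂ) + 1)) • w := by
    rintro x w rfl
    rw [hsm, smul_smul, one_div, inv_mul_cancel₀ hne, one_smul]
  have h'' := key _ _ h'
  rw [smul_ite, smul_zero] at h''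
  rw [← h'']
  refine Finset.sum_congr rfl fun f _ => ?_
  have e : (PowerSeries.C y * PowerSeries.C a * crossing y) ^ f *
      crossCoeff (PowerSeries.C y) f (i + 1) =
      PowerSeries.C ((y * a) ^ f * crossCoeff y f (i + 1)) * crossing y ^ f := by
    rw [crossCoeff_map, map_mul, map_pow, map_mul]; ring
  rw [PowerSeries.coeff_smul, e, PowerSeries.coeff_C_mul]
  rfl

end Completeness

/-! ### A double Vandermonde identity -/

theorem sum_choose_sub_mul_choose (n m s : ℕ) (hs : s ≤ n) :
    ∑ t ∈ Finset.range (n + 1), n.choose t * t.choose s * (m + 1).choose (t + 1) =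
      n.choose s * (n - s + (m + 1)).choose (n + 1) := by
  rw [Nat.add_choose_eq, Finset.mul_sum, Finset.Nat.sum_antidiagonal_eq_sum_range_succ_mk,
    Finset.sum_range_succ _ (n + 1), Nat.choose_eq_zero_of_lt (show n - s < n + 1 by omega),
    zero_mul, mul_zero, add_zero, ← Finset.sum_range_reflect]
  refine Finset.sum_congr rfl fun t ht => ?_
  have ht' : t ≤ n := by simpa [Nat.lt_succ_iff] using ht
  simp only [Nat.add_sub_cancel]
  rw [show n + 1 - t = n - t + 1 by omega, ← mul_assoc]
  congr 1
  by_cases h : s ≤ n - t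
  · rw [Nat.choose_mul h]
    congr 1
    rw [← Nat.choose_symm (show n - t - s ≤ n - s by omega)]
    congr 1
    omega
  · rw [Nat.choose_eq_zero_of_lt (show n - t < s by omega),
      Nat.choose_eq_zero_of_lt (show n - s < t by omega)]
    simp

/-- The double Vandermonde identity behind the factorisation of the Green's function: it separates
the dependence on `m` and `n` up to the sum `n + m` and the summation index. -/
theorem choose_mul_choose_eq_sum (g m n : ℕ) :
    g.choose m * (g + 1).choose (n + 1) = ∑ t ∈ Finset.range (n + 1),
      n.choose t * (m + 1).choose (t + 1) * (g + 1 + t).choose (n + m + 1) := by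
  have h1 : ∀ t ∈ Finset.range (n + 1),
      n.choose t * (m + 1).choose (t + 1) * (g + 1 + t).choose (n + m + 1) =
      ∑ s ∈ Finset.range (n + 1), (g + 1).choose (n + m + 1 - s) *
        (n.choose t * t.choose s * (m + 1).choose (t + 1)) := by
    intro t ht
    have ht' : t ≤ n := by simpa [Nat.lt_succ_iff] using ht
    rw [add_comm (g + 1) t, Nat.add_choose_eq t, Finset.Nat.sum_antidiagonal_eq_sum_range_succ_mk,
      Finset.mul_sum]
    have hsub : Finset.range (n + 1) ⊆ Finset.range (n + m + 1).succ := by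
      intro x; simp; omega
    rw [← Finset.sum_subset hsub]
    · exact Finset.sum_congr rfl fun s _ => by ring
    · intro s _ hs
      have : n < s := by simpa using hs
      rw [Nat.choose_eq_zero_of_lt (show t < s by omega)]
      simp
  rw [Finset.sum_congr rfl h1, Finset.sum_comm]
  have h2 : ∀ s ∈ Finset.range (n + 1), ∑ t ∈ Finset.range (n + 1),
      (g + 1).choose (n + m + 1 - s) * (n.choose t * t.choose s * (m + 1).choose (t + 1)) =
      (g + 1).choose (n + 1) * (if s ≤ m then n.choose s * (g - n).choose (m - s) else 0) := by
    intro s hs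
    have hs' : s ≤ n := by simpa [Nat.lt_succ_iff] using hs
    rw [← Finset.mul_sum, sum_choose_sub_mul_choose n m s hs',
      show n - s + (m + 1) = n + m + 1 - s by omega]
    split_ifs with hsm
    · have := Nat.choose_mul (n := g + 1) (k := n + m + 1 - s) (s := n + 1) (by omega)
      rw [show g + 1 - (n + 1) = g - n by omega, show n + m + 1 - s - (n + 1) = m - s by omega]
        at this
      rw [mul_left_comm, this]
      ring
    · rw [Nat.choose_eq_zero_of_lt (show n + m + 1 - s < n + 1 by omega)]
      simp
  rw [Finset.sum_congr rfl h2, ← Finset.mul_sum, mul_comm]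
  rcases lt_or_ge g n with hg | hg
  · rw [Nat.choose_eq_zero_of_lt (show g + 1 < n + 1 by omega)]; simp
  · congr 1
    rw [← Finset.sum_filter]
    conv_lhs => rw [show g = n + (g - n) by omega, Nat.add_choose_eq,
      Finset.Nat.sum_antidiagonal_eq_sum_range_succ_mk]
    symm
    apply Finset.sum_subset_zero_on_sdiff
    · intro s; simp
    · intro s hs
      simp only [Finset.mem_sdiff, Finset.mem_range, Finset.mem_filter, not_and] at hs
      rw [Nat.choose_eq_zero_of_lt (show n < s by omega), zero_mul]
    · intro s _; simp

/-! ### Divided powers and truncated geometric sums -/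

/-- The binomial series of `1 / (1 - y) ^ (q + 1)` for nilpotent `y`. -/
theorem sum_choose_mul_pow {R : Type*} [CommRing R] {y a : R} {M : ℕ} (ha : a * (1 - y) = 1)
    (hy : y ^ M = 0) (q : ℕ) :
    ∑ m ∈ Finset.range M, ((q + m).choose q : R) * y ^ m = a ^ (q + 1) := by
  have key : ∀ q M : ℕ, (1 - y) * ∑ m ∈ Finset.range M, ((q + 1 + m).choose (q + 1) : R) * y ^ m =
      ∑ m ∈ Finset.range M, ((q + m).choose q : R) * y ^ m -
        ((q + M).choose (q + 1) : R) * y ^ M := by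
    intro q M
    induction M with
    | zero => simp
    | succ M ih =>
      rw [Finset.sum_range_succ, Finset.sum_range_succ, mul_add, ih,
        show q + 1 + M = q + M + 1 by ring, show q + (M + 1) = q + M + 1 by ring,
        Nat.choose_succ_succ]
      push_cast
      ring
  induction q with
  | zero =>
    have := mul_neg_geom_sum y M
    simp only [zero_add, Nat.choose_zero_right, Nat.cast_one, one_mul, pow_one]
    linear_combination (-(∑ m ∈ Finset.range M, y ^ m)) * ha + a * this - a * hy
  | succ q ih =>
    have := key q M
    rw [ih, hy] at this
    rw [pow_succ]
    linear_combination (-(∑ m ∈ Finset.range M, ((q + 1 + m).choose (q + 1) : R) * y ^ m)) * ha +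
      a * this

section DividedPowers

open Nat

variable {R : Type*} [CommRing R] [Algebra ℂ R]

/-- The divided power `y ^ (i - p) / (i - p)!`, read as `0` for `i < p`. -/
noncomputable def divPow (y : R) (i p : ℕ) : R :=
  if p ≤ i then (((i - p)! : ℂ)⁻¹) • y ^ (i - p) else 0

theorem divPow_of_lt (y : R) {i p : ℕ} (h : i < p) : divPow y i p = 0 := by
  simp [divPow, h]

theorem divPow_add (y : R) (p m : ℕ) : divPow y (p + m) p = ((m ! : ℂ)⁻¹) • y ^ m := by
  simp [divPow]

theorem factorial_smul_divPow (y : R) (i p : ℕ) :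
    ((i ! : ℂ) / (p ! : ℂ)) • divPow y i p = (i.choose p : ℂ) • y ^ (i - p) := by
  rw [divPow]
  split_ifs with h
  · rw [smul_smul, Nat.cast_choose ℂ h]
    congr 1
    field_simp
  · rw [Nat.choose_eq_zero_of_lt (by omega)]; simp

/-- The binomial theorem for divided powers. -/
theorem sum_antidiagonal_divPow (y : R) (k p q : ℕ) :
    ∑ x ∈ Finset.HasAntidiagonal.antidiagonal k, divPow y x.1 p * divPow y x.2 q =
      divPow (2 * y) k (p + q) := by
  have hmk : ∀ (w : R) (r : ℕ), PowerSeries.mk (fun i => divPow w i r) =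
      PowerSeries.X ^ r * PowerSeries.mk (fun i => divPow w i 0) := by
    intro w r
    ext i
    rw [PowerSeries.coeff_X_pow_mul', PowerSeries.coeff_mk]
    split_ifs with h
    · simp [divPow, h]
    · simp [divPow, h]
  have h0 : PowerSeries.mk (fun i => divPow y i 0) * PowerSeries.mk (fun i => divPow y i 0) =
      PowerSeries.mk (fun i => divPow (2 * y) i 0) := by
    ext i
    rw [PowerSeries.coeff_mul, PowerSeries.coeff_mk, two_mul, divPow, if_pos (Nat.zero_le _),
      Nat.sub_zero, (Commute.all y y).add_pow', Finset.smul_sum]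
    refine Finset.sum_congr rfl fun x hx => ?_
    have hx' : x.1 + x.2 = i := by simpa using hx
    rw [PowerSeries.coeff_mk, PowerSeries.coeff_mk, divPow, divPow, if_pos (Nat.zero_le _),
      if_pos (Nat.zero_le _), Nat.sub_zero, Nat.sub_zero, smul_mul_smul_comm,
      ← Nat.cast_smul_eq_nsmul ℂ, smul_smul, ← hx', Nat.cast_add_choose]
    congr 1
    have := Nat.factorial_ne_zero (x.1 + x.2)
    field_simp
  have h := congrArg (PowerSeries.coeff k) (show
      PowerSeries.mk (fun i => divPow y i p) * PowerSeries.mk (fun i => divPow y i q) =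
      PowerSeries.mk (fun i => divPow (2 * y) i (p + q)) by
    rw [hmk y p, hmk y q, hmk _ (p + q), ← h0]; ring)
  rw [PowerSeries.coeff_mul] at h
  simpa only [PowerSeries.coeff_mk] using h

theorem sum_range_divPow (y : R) {k L : ℕ} (hk : k < L) (p : ℕ) :
    ∑ i ∈ Finset.range L, divPow y k i * divPow y i p = divPow (2 * y) k p := by
  have h := sum_antidiagonal_divPow y k 0 p
  rw [Finset.Nat.sum_antidiagonal_eq_sum_range_succ_mk, ← Finset.sum_range_reflect, zero_add] at h
  rw [← h]
  have hsub : Finset.range (k + 1) ⊆ Finset.range L := by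
    intro x; simp; omega
  rw [← Finset.sum_subset hsub]
  · refine Finset.sum_congr rfl fun i hi => ?_
    have : i ≤ k := by simpa [Nat.lt_succ_iff] using hi
    simp only [Nat.succ_eq_add_one, Nat.add_sub_cancel]
    rw [show k - (k - i) = i by omega]
    simp [divPow, this]
  · intro i _ hi
    rw [divPow_of_lt _ (by simpa using hi), zero_mul]

theorem cast_mul_eq_smul (m : ℕ) (x : R) : (m : R) * x = (m : ℂ) • x := by
  rw [Nat.cast_smul_eq_nsmul, nsmul_eq_mul]

theorem sum_factorial_mul_divPow {y a : R} {n L p : ℕ} (ha : a * (1 - y) = 1)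
    (hy : y ^ (n + 1) = 0) (hp : p + n + 1 ≤ L) (i : ℕ) :
    ∑ j ∈ Finset.range L, ((i + j + 1)! : R) * divPow y j p =
      ((i + p + 1)! : R) * a ^ (i + p + 2) := by
  obtain ⟨M, rfl⟩ := Nat.exists_eq_add_of_le (show p ≤ L by omega)
  have hM : y ^ M = 0 := pow_eq_zero_of_le (by omega) hy
  rw [Finset.sum_range_add, Finset.sum_eq_zero, zero_add, ← sum_choose_mul_pow ha hM (i + p + 1),
    Finset.mul_sum]
  · refine Finset.sum_congr rfl fun m _ => ?_
    rw [divPow_add, cast_mul_eq_smul, smul_smul, cast_mul_eq_smul ((i + p + 1)!),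
      cast_mul_eq_smul ((i + p + 1 + m).choose _), smul_smul,
      show i + (p + m) + 1 = (i + p + 1) + m by ring,
      Nat.cast_add_choose]
    congr 1
    have := Nat.factorial_ne_zero (i + p + 1)
    field_simp
  · intro j hj
    rw [divPow_of_lt _ (by simpa using hj), mul_zero]

end DividedPowers

/-! ### The free transfer matrix and its Green's function -/

section Green

open Nat

variable {R : Type*} [CommRing R] [Algebra ℂ R]

/-- The eigenvector with eigenvalue `b ^ f`, `b = y / (1 - y)`, of the transfer operator of an
unmarked site; the index `i` stands for `i + 1` crossings. -/
noncomputable def eigVec (y : R) (f i : ℕ) : R := ((i ! : ℂ)⁻¹) • crossCoeff y f (i + 1)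

theorem eigVec_eq_sum (y : R) {f n : ℕ} (hf : f ≤ n) (i : ℕ) :
    eigVec y f i = ∑ p ∈ Finset.range n,
      ((f.choose (p + 1) : ℂ) * (p ! : ℂ)⁻¹) • ((-(1 - 2 * y)) ^ (p + 1) * divPow y i p) := by
  rw [eigVec, crossCoeff_succ, Finset.smul_sum]
  have hsub : Finset.range f ⊆ Finset.range n := by intro x; simp; omega
  rw [← Finset.sum_subset hsub]
  · refine Finset.sum_congr rfl fun p _ => ?_
    rw [mul_assoc, cast_mul_eq_smul, cast_mul_eq_smul, ← factorial_smul_divPow, mul_smul_comm,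
      smul_smul, smul_smul]
    congr 1
    have := Nat.factorial_ne_zero i
    field_simp
  · intro p _ hp
    rw [Nat.choose_eq_zero_of_lt (by simpa [Nat.lt_succ_iff] using hp)]
    simp

/-- The edge weight `z ^ (2 u) / (u! (u - 1)!)` of `u = i + 1` crossings, with `z² = y (1 - y)`. -/
noncomputable def edgeWeight (y : R) (i : ℕ) : R :=
  ((i ! : ℂ)⁻¹ * ((i + 1)! : ℂ)⁻¹) • (y * (1 - y)) ^ (i + 1)

theorem edgeWeight_mul_pow {y a : R} (ha : a * (1 - y) = 1) (i : ℕ) :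
    edgeWeight y i * a ^ (i + 1) = ((i ! : ℂ)⁻¹ * ((i + 1)! : ℂ)⁻¹) • y ^ (i + 1) := by
  rw [edgeWeight, smul_mul_assoc, ← mul_pow, show y * (1 - y) * a = y by
    linear_combination y * ha]

/-- The eigenvalue equation of the transfer operator of an unmarked site. -/
theorem sum_edgeWeight_mul_eigVec {y a : R} {n L : ℕ} (ha : a * (1 - y) = 1)
    (hy : y ^ (n + 1) = 0) (hL : 2 * n + 1 ≤ L) {f : ℕ} (hf : f ≤ n) (i : ℕ) :
    ∑ j ∈ Finset.range L, edgeWeight y i * ((i + j + 1)! : R) * eigVec y f j =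
      (y * a) ^ f * eigVec y f i := by
  have h1 : ∀ j ∈ Finset.range L, edgeWeight y i * ((i + j + 1)! : R) * eigVec y f j =
      ∑ p ∈ Finset.range f, ((f.choose (p + 1) : ℂ) * (p ! : ℂ)⁻¹) •
        ((-(1 - 2 * y)) ^ (p + 1) * edgeWeight y i * (((i + j + 1)! : R) * divPow y j p)) := by
    intro j _
    rw [eigVec_eq_sum y le_rfl, Finset.mul_sum]
    refine Finset.sum_congr rfl fun p _ => ?_
    rw [mul_smul_comm]
    congr 1
    ring
  rw [Finset.sum_congr rfl h1, Finset.sum_comm]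
  have h2 : ∀ p ∈ Finset.range f, ∑ j ∈ Finset.range L, ((f.choose (p + 1) : ℂ) * (p ! : ℂ)⁻¹) •
        ((-(1 - 2 * y)) ^ (p + 1) * edgeWeight y i * (((i + j + 1)! : R) * divPow y j p)) =
      ((i ! : ℂ)⁻¹) • (y ^ (i + 1) * ((f.choose (p + 1) : R) *
        (-((1 - 2 * y) * a)) ^ (p + 1) * ((i + p + 1).choose p : R))) := by
    intro p hp
    have hp' : p < f := by simpa using hp
    rw [← Finset.smul_sum, ← Finset.mul_sum, sum_factorial_mul_divPow ha hy (by omega),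
      show (-(1 - 2 * y)) ^ (p + 1) * edgeWeight y i * (((i + p + 1)! : R) * a ^ (i + p + 2)) =
        ((i + p + 1)! : R) * ((-((1 - 2 * y) * a)) ^ (p + 1) * (edgeWeight y i * a ^ (i + 1))) by
        rw [neg_mul_eq_neg_mul, mul_pow]; ring,
      edgeWeight_mul_pow ha, mul_smul_comm, cast_mul_eq_smul (R := R),
      show y ^ (i + 1) * ((f.choose (p + 1) : R) *
        (-((1 - 2 * y) * a)) ^ (p + 1) * ((i + p + 1).choose p : R)) =
        (f.choose (p + 1) : R) * (((i + p + 1).choose p : R) * ((-((1 - 2 * y) * a)) ^ (p + 1) *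
          y ^ (i + 1))) by ring,
      cast_mul_eq_smul (R := R) (f.choose (p + 1)),
      cast_mul_eq_smul (R := R) ((i + p + 1).choose p)]
    simp only [smul_smul]
    congr 1
    have h3 := Nat.add_choose_mul_factorial_mul_factorial (i + 1) p
    rw [show i + 1 + p = i + p + 1 by ring] at h3
    rw [← h3]
    push_cast
    have := Nat.factorial_ne_zero p
    have := Nat.factorial_ne_zero (i + 1)
    field_simp
  rw [Finset.sum_congr rfl h2, ← Finset.smul_sum, ← Finset.mul_sum, ← pow_mul_crossCoeff ha, eigVec,
    mul_smul_comm]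

/-- The spectral decomposition of the edge weights; the term `f = 0` is read as `0`. -/
theorem sum_eigVec_mul_eigVec {y a : R} {n : ℕ} (ha : a * (1 - y) = 1)
    (hy : y ^ (n + 1) = 0) (i j : ℕ) :
    ∑ f ∈ Finset.range (n + 1), (1 / f : ℂ) • ((y * a) ^ f * (eigVec y f i * eigVec y f j)) =
      if i = j then edgeWeight y i else 0 := by
  have h := sum_crossCoeff_mul_crossCoeff ha hy i j
  have h1 : ∀ f ∈ Finset.range (n + 1),
      (1 / f : ℂ) • ((y * a) ^ f * (eigVec y f i * eigVec y f j)) =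
      ((i ! : ℂ)⁻¹ * (j ! : ℂ)⁻¹) • ((1 / f : ℂ) •
      ((y * a) ^ f * crossCoeff y f (i + 1) * crossCoeff y f (j + 1))) := by
    intro f _
    rw [eigVec, eigVec, smul_mul_smul_comm, mul_smul_comm, smul_comm, mul_assoc]
  rw [Finset.sum_congr rfl h1, ← Finset.smul_sum, h, smul_ite, smul_zero]
  split_ifs with hij
  · subst hij
    rw [edgeWeight, smul_smul, Nat.factorial_succ]
    congr 1
    push_cast
    have : (i : ℂ) + 1 ≠ 0 := by exact_mod_cast Nat.succ_ne_zero i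
    field_simp
  · rfl

/-- The Green's function of the transfer operator of the unmarked sites: the total weight of all
ways to connect `i + 1` crossings to `j + 1` crossings through unmarked sites. -/
noncomputable def green (y : R) (lam : ℕ → R) (n i j : ℕ) : R :=
  ∑ f ∈ Finset.range (n + 1), (1 / f : ℂ) • (lam f * (eigVec y f i * eigVec y f j))

theorem green_comm (y : R) (lam : ℕ → R) (n i j : ℕ) : green y lam n i j = green y lam n j i := by
  simp only [green, mul_comm (eigVec y _ i)]

/-- The resolvent equation of the Green's function. -/
theorem green_eq {y a : R} {lam : ℕ → R} {n L : ℕ} (ha : a * (1 - y) = 1)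
    (hy : y ^ (n + 1) = 0) (hL : 2 * n + 1 ≤ L)
    (hlam : ∀ f, 0 < f → lam f = (y * a) ^ f + (y * a) ^ f * lam f) (i j : ℕ) :
    green y lam n i j = (if i = j then edgeWeight y i else 0) +
      ∑ k ∈ Finset.range L, edgeWeight y i * ((i + k + 1)! : R) * green y lam n k j := by
  have h1 : ∑ k ∈ Finset.range L, edgeWeight y i * ((i + k + 1)! : R) * green y lam n k j =
      ∑ f ∈ Finset.range (n + 1), (1 / f : ℂ) • (lam f * ((y * a) ^ f * eigVec y f i *
        eigVec y f j)) := by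
    simp only [green, Finset.mul_sum]
    rw [Finset.sum_comm]
    refine Finset.sum_congr rfl fun f hf => ?_
    rw [← sum_edgeWeight_mul_eigVec ha hy hL (by simpa [Nat.lt_succ_iff] using hf), Finset.sum_mul,
      Finset.mul_sum, Finset.smul_sum]
    refine Finset.sum_congr rfl fun k _ => ?_
    rw [mul_smul_comm]
    congr 1
    ring
  rw [h1, ← sum_eigVec_mul_eigVec ha hy, ← Finset.sum_add_distrib, green]
  refine Finset.sum_congr rfl fun f _ => ?_
  rw [← smul_add]
  rcases Nat.eq_zero_or_pos f with rfl | hf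
  · simp
  · congr 1
    linear_combination (eigVec y f i * eigVec y f j) * hlam f hf

/-- The weight of the unmarked half line beyond `i + 1` crossings. -/
noncomputable def freeEnd (y : R) (i : ℕ) : R := (((i + 1)! : ℂ)⁻¹) • y ^ (i + 1)

/-- The unmarked half line solves the transfer equation without marked sites. -/
theorem freeEnd_eq {y a : R} {n L : ℕ} (ha : a * (1 - y) = 1)
    (hy : y ^ (n + 1) = 0) (hL : n ≤ L) (i : ℕ) :
    freeEnd y i = edgeWeight y i * (i ! : R) +
      ∑ j ∈ Finset.range L, edgeWeight y i * ((i + j + 1)! : R) * freeEnd y j := by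
  have h := sum_choose_mul_pow ha (pow_eq_zero_of_le (show n + 1 ≤ L + 1 by omega) hy) i
  have h1 : (i ! : R) * a ^ (i + 1) = (i ! : R) +
      ∑ j ∈ Finset.range L, ((i + j + 1)! : R) * freeEnd y j := by
    rw [← h, Finset.sum_range_succ', mul_add, add_comm, Finset.mul_sum]
    congr 1
    · simp
    · refine Finset.sum_congr rfl fun j _ => ?_
      rw [freeEnd, cast_mul_eq_smul, cast_mul_eq_smul ((i + j + 1)!), cast_mul_eq_smul, smul_smul,
        smul_smul, add_assoc, Nat.cast_add_choose]
      congr 1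
      have := Nat.factorial_ne_zero i
      field_simp
  have h2 := edgeWeight_mul_pow ha i
  have h3 : freeEnd y i = (i ! : R) * (edgeWeight y i * a ^ (i + 1)) := by
    rw [h2, cast_mul_eq_smul, smul_smul, freeEnd]
    congr 1
    have := Nat.factorial_ne_zero i
    field_simp
  rw [h3, mul_left_comm, h1, mul_add, Finset.mul_sum]
  simp only [mul_assoc]

end Green

/-! ### The Green's function in terms of the coefficients `G` and `H` -/

section Coefficients

open Nat

variable {R : Type*} [CommRing R] [Algebra ℂ R]

/-- The coefficient `G_{p+1,q+1}` over a ring in which the sums are finite. -/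
noncomputable def gCoeff (y : R) (lam : ℕ → R) (n p q : ℕ) : R :=
  (-(1 - 2 * y)) ^ (p + 1 + (q + 1)) * ∑ f ∈ Finset.range (n + 1),
    ((1 / f : ℂ) * (f.choose (p + 1)) * (f.choose (q + 1))) • lam f

/-- The coefficient `H_{t+1,s+2t+2}` over a ring in which the sums are finite. -/
noncomputable def hCoeff (y : R) (lam : ℕ → R) (n t s : ℕ) : R :=
  (1 - 2 * y) ^ (s + 2 * t + 2) * ∑ f ∈ Finset.range (n + 1),
    ((f + t).choose (s + 2 * t + 1) : ℂ) • lam f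

theorem gCoeff_comm (y : R) (lam : ℕ → R) (n p q : ℕ) :
    gCoeff y lam n p q = gCoeff y lam n q p := by
  simp only [gCoeff, add_comm (p + 1), mul_right_comm (1 / _ : ℂ)]

theorem gCoeff_eq_zero_left (y : R) (lam : ℕ → R) {n p : ℕ} (hp : n ≤ p) (q : ℕ) :
    gCoeff y lam n p q = 0 := by
  rw [gCoeff, Finset.sum_eq_zero, mul_zero]
  intro f hf
  rw [Nat.choose_eq_zero_of_lt (by simp at hf; omega)]
  simp

theorem gCoeff_eq_zero_right (y : R) (lam : ℕ → R) {n q : ℕ} (p : ℕ) (hq : n ≤ q) :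
    gCoeff y lam n p q = 0 := by
  rw [gCoeff_comm, gCoeff_eq_zero_left y lam hq]

theorem hCoeff_eq_zero (y : R) (lam : ℕ → R) {n t s : ℕ} (h : n ≤ s + t) :
    hCoeff y lam n t s = 0 := by
  rw [hCoeff, Finset.sum_eq_zero, mul_zero]
  intro f hf
  rw [Nat.choose_eq_zero_of_lt (by simp at hf; omega)]
  simp

theorem green_eq_sum_gCoeff (y : R) (lam : ℕ → R) (n i j : ℕ) :
    green y lam n i j = ∑ p ∈ Finset.range n, ∑ q ∈ Finset.range n,
      ((p ! : ℂ)⁻¹ * (q ! : ℂ)⁻¹) • (divPow y i p * divPow y j q * gCoeff y lam n p q) := by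
  have h1 : ∀ f ∈ Finset.range (n + 1), (1 / f : ℂ) • (lam f * (eigVec y f i * eigVec y f j)) =
      ∑ p ∈ Finset.range n, ∑ q ∈ Finset.range n, ((p ! : ℂ)⁻¹ * (q ! : ℂ)⁻¹) •
        (divPow y i p * divPow y j q * ((-(1 - 2 * y)) ^ (p + 1 + (q + 1)) *
          (((1 / f : ℂ) * (f.choose (p + 1)) * (f.choose (q + 1))) • lam f))) := by
    intro f hf
    have hf' : f ≤ n := by simpa [Nat.lt_succ_iff] using hf
    rw [eigVec_eq_sum y hf', eigVec_eq_sum y hf', Finset.sum_mul_sum, Finset.mul_sum,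
      Finset.smul_sum]
    refine Finset.sum_congr rfl fun p _ => ?_
    rw [Finset.mul_sum, Finset.smul_sum]
    refine Finset.sum_congr rfl fun q _ => ?_
    rw [smul_mul_smul_comm, mul_smul_comm, smul_smul, mul_smul_comm, mul_smul_comm, smul_smul]
    congr 1 <;> ring
  rw [green, Finset.sum_congr rfl h1, Finset.sum_comm]
  refine Finset.sum_congr rfl fun p _ => ?_
  rw [Finset.sum_comm]
  refine Finset.sum_congr rfl fun q _ => ?_
  rw [gCoeff, ← Finset.smul_sum, ← Finset.mul_sum, ← Finset.mul_sum]

/-- The coefficients `G_{p+1,q+1}` in terms of the `H_{t+1,p+q+2}`. In each term the coefficient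
is a function of `(p, t)` times one of `(q, t)`, which makes the Green's function factor. -/
theorem gCoeff_eq_sum_hCoeff (y : R) (lam : ℕ → R) (n p q : ℕ) :
    ((p ! : ℂ)⁻¹ * (q ! : ℂ)⁻¹) • gCoeff y lam n p q = ∑ t ∈ Finset.range (p + 1),
      if t ≤ q then ((-1) ^ (p - t) * (-1) ^ (q - t) * ((t ! : ℂ)⁻¹ * ((t + 1)! : ℂ)⁻¹ *
        ((p - t)! : ℂ)⁻¹ * ((q - t)! : ℂ)⁻¹)) • hCoeff y lam n t (p - t + (q - t)) else 0 := by
  have hcoef : ∀ f ∈ Finset.range (n + 1), ((p ! : ℂ)⁻¹ * (q ! : ℂ)⁻¹) *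
      ((-1) ^ (p + q) * ((1 / f : ℂ) * (f.choose (p + 1)) * (f.choose (q + 1)))) =
      ∑ t ∈ Finset.range (p + 1), if t ≤ q then
        ((-1) ^ (p - t) * (-1) ^ (q - t) * ((t ! : ℂ)⁻¹ * ((t + 1)! : ℂ)⁻¹ *
        ((p - t)! : ℂ)⁻¹ * ((q - t)! : ℂ)⁻¹)) * ((f + t).choose (p + q + 1) : ℂ) else 0 := by
    intro f _
    rcases Nat.eq_zero_or_pos f with rfl | hf
    · rw [Finset.sum_eq_zero]
      · simp
      · intro t ht
        split_ifs with h
        · rw [Nat.choose_eq_zero_of_lt (by simp at ht; omega)]; simp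
        · rfl
    · obtain ⟨g, rfl⟩ : ∃ g, f = g + 1 := ⟨f - 1, by omega⟩
      have h := congrArg (Nat.cast (R := ℂ)) (choose_mul_choose_eq_sum g q p)
      have hq : ((g + 1 : ℕ) : ℂ) * (g.choose q : ℂ) = ((g + 1).choose (q + 1) : ℂ) * (q + 1) := by
        exact_mod_cast Nat.add_one_mul_choose_eq g q
      have hg : ((g + 1 : ℕ) : ℂ) ≠ 0 := by exact_mod_cast Nat.succ_ne_zero g
      have hq0 : ((q : ℂ) + 1) ≠ 0 := by exact_mod_cast Nat.succ_ne_zero q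
      have e : ((p ! : ℂ)⁻¹ * (q ! : ℂ)⁻¹) * ((-1) ^ (p + q) * ((1 / (g + 1 : ℕ) : ℂ) *
          ((g + 1).choose (p + 1)) * ((g + 1).choose (q + 1)))) =
          ((p ! : ℂ)⁻¹ * ((q + 1)! : ℂ)⁻¹ * (-1) ^ (p + q)) *
            ((g.choose q * (g + 1).choose (p + 1) : ℕ) : ℂ) := by
        rw [Nat.factorial_succ]
        push_cast at hq hg ⊢
        field_simp
        linear_combination (-((g + 1).choose (p + 1) : ℂ) * (p ! : ℂ)⁻¹ * (q ! : ℂ)⁻¹) * hq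
      rw [e, h, Nat.cast_sum, Finset.mul_sum]
      refine Finset.sum_congr rfl fun t ht => ?_
      have ht' : t ≤ p := by simpa [Nat.lt_succ_iff] using ht
      split_ifs with htq
      · push_cast
        rw [Nat.cast_choose ℂ ht', Nat.cast_choose ℂ (show t + 1 ≤ q + 1 by omega),
          show q + 1 - (t + 1) = q - t by omega]
        have es : ((-1 : ℂ)) ^ (p + q) = (-1) ^ (p - t) * (-1) ^ (q - t) := by
          rw [← pow_add, show p + q = (p - t + (q - t)) + 2 * t by omega, pow_add _ _ (2 * t),
            pow_mul]
          simp
        rw [es]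
        have := Nat.factorial_ne_zero p
        have := Nat.factorial_ne_zero (q + 1)
        field_simp
      · rw [Nat.choose_eq_zero_of_lt (show q + 1 < t + 1 by omega)]
        simp
  have hsgn : (-(1 - 2 * y)) ^ (p + 1 + (q + 1)) =
      ((-1 : ℂ) ^ (p + q)) • (1 - 2 * y) ^ (p + q + 2) := by
    rw [neg_pow, show p + 1 + (q + 1) = p + q + 2 by ring, pow_add (-1 : R), Algebra.smul_def]
    simp
  rw [gCoeff, hsgn, smul_mul_assoc, smul_smul, ← mul_smul_comm, Finset.smul_sum]
  have h2 : ∀ f ∈ Finset.range (n + 1), ((p ! : ℂ)⁻¹ * (q ! : ℂ)⁻¹ * (-1) ^ (p + q)) •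
      (((1 / f : ℂ) * (f.choose (p + 1)) * (f.choose (q + 1))) • lam f) =
      ∑ t ∈ Finset.range (p + 1), if t ≤ q then
        (((-1) ^ (p - t) * (-1) ^ (q - t) * ((t ! : ℂ)⁻¹ * ((t + 1)! : ℂ)⁻¹ *
        ((p - t)! : ℂ)⁻¹ * ((q - t)! : ℂ)⁻¹))) • (((f + t).choose (p + q + 1) : ℂ) • lam f)
        else 0 := by
    intro f hf
    rw [smul_smul, mul_assoc, hcoef f hf, Finset.sum_smul]
    refine Finset.sum_congr rfl fun t _ => ?_
    split_ifs
    · rw [smul_smul]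
    · rw [zero_smul]
  rw [Finset.sum_congr rfl h2, Finset.sum_comm, Finset.mul_sum]
  refine Finset.sum_congr rfl fun t ht => ?_
  have ht' : t ≤ p := by simpa [Nat.lt_succ_iff] using ht
  split_ifs with htq
  · rw [hCoeff, ← Finset.smul_sum, mul_smul_comm,
      show p - t + (q - t) + 2 * t = p + q by omega]
  · simp

/-- The right factor of the Green's function, with the pair `(r, t)` as the inner index. -/
noncomputable def edgeRight (y : R) (r t j : ℕ) : R :=
  ((-1) ^ r * (r ! : ℂ)⁻¹) • divPow y j (t + r)

/-- The left factor of the Green's function, with the pair `(r, t)` as the inner index. -/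
noncomputable def edgeLeft (y : R) (lam : ℕ → R) (n i r t : ℕ) : R :=
  ∑ e ∈ Finset.range n, ((-1) ^ e * ((t ! : ℂ)⁻¹ * ((t + 1)! : ℂ)⁻¹ * (e ! : ℂ)⁻¹)) •
    (divPow y i (t + e) * hCoeff y lam n t (e + r))

theorem sum_range_add_shift {M : Type*} [AddCommMonoid M] {n : ℕ} (t : ℕ) (F : ℕ → M)
    (hF : ∀ r, n ≤ t + r → F r = 0) :
    ∑ r ∈ Finset.range n, F r = ∑ p ∈ Finset.range n, if t ≤ p then F (p - t) else 0 := by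
  rw [← Finset.sum_filter]
  refine Finset.sum_bij_ne_zero (fun r _ _ => t + r) ?_ ?_ ?_ ?_
  · intro r _ h
    have : ¬ n ≤ t + r := fun h' => h (hF r h')
    simp; omega
  · intro _ _ _ _ _ _ h; omega
  · intro p hp _
    simp only [Finset.mem_filter, Finset.mem_range] at hp
    refine ⟨p - t, by simp; omega, ?_, by omega⟩
    assumption
  · intro r _ _; simp

/-- Factorisation of the Green's function through the pairs `(r, t)`. -/
theorem green_eq_sum_edge (y : R) (lam : ℕ → R) (n i j : ℕ) :
    green y lam n i j = ∑ r ∈ Finset.range n, ∑ t ∈ Finset.range n,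
      edgeLeft y lam n i r t * edgeRight y r t j := by
  rw [Finset.sum_comm, green_eq_sum_gCoeff]
  -- the summand of both sides, in the variables `p = t + e` and `q = t + r`
  let F : ℕ → ℕ → ℕ → R := fun t p q =>
    ((-1) ^ (p - t) * (-1) ^ (q - t) * ((t ! : ℂ)⁻¹ * ((t + 1)! : ℂ)⁻¹ *
        ((p - t)! : ℂ)⁻¹ * ((q - t)! : ℂ)⁻¹)) •
      (divPow y i p * divPow y j q * hCoeff y lam n t (p - t + (q - t)))
  have hL : ∀ p ∈ Finset.range n, ∀ q ∈ Finset.range n,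
      ((p ! : ℂ)⁻¹ * (q ! : ℂ)⁻¹) • (divPow y i p * divPow y j q * gCoeff y lam n p q) =
      ∑ t ∈ Finset.range n, if t ≤ p then (if t ≤ q then F t p q else 0) else 0 := by
    intro p hp q _
    rw [← mul_smul_comm, gCoeff_eq_sum_hCoeff, Finset.mul_sum, ← Finset.sum_filter]
    have : Finset.filter (fun t => t ≤ p) (Finset.range n) = Finset.range (p + 1) := by
      ext t; simp at hp ⊢; omega
    rw [this]
    refine Finset.sum_congr rfl fun t _ => ?_
    split_ifs
    · rw [mul_smul_comm]
    · rw [mul_zero]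
  rw [Finset.sum_congr rfl fun p hp => Finset.sum_congr rfl (hL p hp)]
  have hR : ∀ t ∈ Finset.range n, ∑ r ∈ Finset.range n,
      edgeLeft y lam n i r t * edgeRight y r t j =
      ∑ p ∈ Finset.range n, ∑ q ∈ Finset.range n,
        if t ≤ p then (if t ≤ q then F t p q else 0) else 0 := by
    intro t _
    rw [sum_range_add_shift t, Finset.sum_comm]
    · refine Finset.sum_congr rfl fun q hq => ?_
      split_ifs with htq
      · rw [edgeLeft, sum_range_add_shift t, Finset.sum_mul]
        · refine Finset.sum_congr rfl fun p _ => ?_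
          split_ifs with htp
          · simp only [F]
            rw [edgeRight, smul_mul_smul_comm, show t + (q - t) = q by omega,
              show t + (p - t) = p by omega]
            congr 1 <;> ring
          · rw [zero_mul]
        · intro e he
          rw [hCoeff_eq_zero y lam (by omega), mul_zero, smul_zero]
      · simp
    · intro r hr
      have : edgeLeft y lam n i r t = 0 := by
        rw [edgeLeft]
        refine Finset.sum_eq_zero fun e _ => ?_
        rw [hCoeff_eq_zero y lam (by omega), mul_zero, smul_zero]
      rw [this, zero_mul]
  rw [Finset.sum_congr rfl hR]
  conv_rhs => rw [Finset.sum_comm]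
  refine Finset.sum_congr rfl fun p _ => ?_
  rw [Finset.sum_comm]

end Coefficients

/-! ### Resummation over the marked sites -/

section Chain

open Matrix

variable {R ι α : Type*} [CommRing R] [Fintype ι] [DecidableEq ι] [Fintype α] [DecidableEq α]

/-- A solution of the free transfer equation is obtained by applying the Green's function. -/
theorem eq_green_mulVec {D N₀ Γ : Matrix ι ι R} (hD : Dᵀ = D) (hN₀ : N₀ᵀ = N₀) (hΓs : Γᵀ = Γ)
    (hΓ : Γ = D + D * N₀ * Γ) {v w : ι → R} (h : v = D *ᵥ w + (D * N₀) *ᵥ v) : v = Γ *ᵥ w := by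
  have hΓ' : Γ = D + Γ * N₀ * D := by
    have := congrArg Matrix.transpose hΓ
    rwa [transpose_add, transpose_mul, transpose_mul, hD, hN₀, hΓs, ← Matrix.mul_assoc] at this
  have h1 : D *ᵥ w = v - (D * N₀) *ᵥ v := by rw [eq_sub_iff_add_eq]; exact h.symm
  have h2 : Γ * N₀ * (D * N₀) = Γ * N₀ - D * N₀ := by
    rw [← Matrix.mul_assoc, eq_sub_iff_add_eq, ← add_mul]
    congr 1
    rw [add_comm]; exact hΓ'.symm
  have h3 : Γ *ᵥ w = D *ᵥ w + (Γ * N₀) *ᵥ (D *ᵥ w) := by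
    conv_lhs => rw [hΓ']
    rw [add_mulVec, mulVec_mulVec]
  rw [h3, h1, mulVec_sub, mulVec_mulVec, h2, sub_mulVec]
  abel

/-- Resolvent expansion: the weighted sum `⟨e₀ + e₁ | r⟩` over all profiles, expanded in the
number of marked sites. The terms with at least three marked sites are resummed into the
resolvent of `Y N₁ X`, where `Γ = X Y` is a factorisation of the free Green's function. -/
theorem dotProduct_eq_resolvent {D N₀ N₁ Γ : Matrix ι ι R} {X : Matrix ι α R} {Y : Matrix α ι R}
    {K : Matrix α α R} {e₀ e₁ r₀ r e : ι → R} {ψ φ : α → R}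
    (hD : Dᵀ = D) (hN₀ : N₀ᵀ = N₀) (hN₁ : N₁ᵀ = N₁) (hΓs : Γᵀ = Γ) (hΓ : Γ = D + D * N₀ * Γ)
    (hr₀ : r₀ = D *ᵥ e₀ + (D * N₀) *ᵥ r₀)
    (hr : r = D *ᵥ (e₀ + e₁) + (D * (N₀ + N₁)) *ᵥ r)
    (hXY : Γ = X * Y) (he : e = e₁ + N₁ *ᵥ r₀) (hψ : ψ ᵥ* Y = -(e ᵥ* Γ))
    (hφ : φ = -((Y * N₁ * Γ) *ᵥ e)) (hK : K * (1 - Y * N₁ * X) = 1) :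
    (e₀ + e₁) ⬝ᵥ r = e₀ ⬝ᵥ r₀ + (e₁ ⬝ᵥ r₀ + r₀ ⬝ᵥ e) + e ⬝ᵥ (Γ *ᵥ e) + ψ ⬝ᵥ (K *ᵥ φ) := by
  have h0 : r₀ = Γ *ᵥ e₀ := eq_green_mulVec hD hN₀ hΓs hΓ hr₀
  have h1 : r = Γ *ᵥ (e₀ + e₁ + N₁ *ᵥ r) := by
    refine eq_green_mulVec hD hN₀ hΓs hΓ ?_
    rw [mulVec_add D (e₀ + e₁), mulVec_mulVec, add_assoc, ← add_mulVec, add_comm (D * N₁),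
      ← Matrix.mul_add]
    exact hr
  set q : ι → R := e₁ + N₁ *ᵥ r with hq
  have h2 : r = r₀ + Γ *ᵥ q := by
    rw [h0, ← mulVec_add, hq, ← add_assoc]; exact h1
  have h3 : q = e + N₁ *ᵥ (Γ *ᵥ q) := by
    rw [he, add_assoc, ← mulVec_add, ← h2]
  have hsymm : ∀ (M : Matrix ι ι R), Mᵀ = M → ∀ v w : ι → R, v ⬝ᵥ (M *ᵥ w) = (M *ᵥ v) ⬝ᵥ w := by
    intro M hM v w
    rw [dotProduct_mulVec, ← mulVec_transpose, hM]
  have h4 : e₀ ⬝ᵥ (Γ *ᵥ q) = r₀ ⬝ᵥ q := by rw [hsymm Γ hΓs, ← h0]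
  have h5 : r₀ ⬝ᵥ q = r₀ ⬝ᵥ e + (N₁ *ᵥ r₀) ⬝ᵥ (Γ *ᵥ q) := by
    conv_lhs => rw [h3]
    rw [dotProduct_add, hsymm N₁ hN₁]
  have h6 : e ⬝ᵥ (Γ *ᵥ q) = e₁ ⬝ᵥ (Γ *ᵥ q) + (N₁ *ᵥ r₀) ⬝ᵥ (Γ *ᵥ q) := by
    rw [he, add_dotProduct]
  set v : α → R := (Y * N₁ * Γ) *ᵥ q with hv
  have h7 : v = -φ + (Y * N₁ * X) *ᵥ v := by
    rw [hφ, neg_neg, hv]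
    conv_lhs => rw [h3]
    rw [mulVec_add, mulVec_mulVec, mulVec_mulVec, mulVec_mulVec]
    congr 2
    conv_lhs => rw [hXY]
    conv_rhs => rw [hXY]
    simp only [Matrix.mul_assoc]
  have h8 : v = -(K *ᵥ φ) := by
    have : (1 - Y * N₁ * X) *ᵥ v = -φ := by
      rw [sub_mulVec, one_mulVec, sub_eq_iff_eq_add]; exact h7
    rw [← mulVec_neg, ← this, mulVec_mulVec, hK, one_mulVec]
  have h9 : e ⬝ᵥ (Γ *ᵥ q) = e ⬝ᵥ (Γ *ᵥ e) + ψ ⬝ᵥ (K *ᵥ φ) := by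
    conv_lhs => rw [h3]
    rw [mulVec_add, dotProduct_add]
    congr 1
    rw [dotProduct_mulVec, ← neg_neg (e ᵥ* Γ), ← hψ, neg_dotProduct, ← dotProduct_mulVec,
      mulVec_mulVec, mulVec_mulVec, ← hv, h8, dotProduct_neg, neg_neg]
  rw [add_dotProduct, h2, dotProduct_add, dotProduct_add]
  rw [h4, h5]
  rw [h6] at h9
  linear_combination h9

end Chain

/-! ### Marked sites -/

section Marked

open Nat Matrix

variable {R : Type*} [CommRing R] [Algebra ℂ R]

theorem sum_range_hankel {M : Type*} [AddCommMonoid M] {m L : ℕ} (hm : m < L) (F : ℕ → ℕ → M) :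
    ∑ i ∈ Finset.range L, ∑ j ∈ Finset.range L, (if i + j = m then F i j else 0) =
      ∑ x ∈ Finset.HasAntidiagonal.antidiagonal m, F x.1 x.2 := by
  rw [← Finset.sum_product', ← Finset.sum_filter]
  refine Finset.sum_congr ?_ fun _ _ => rfl
  ext ⟨i, j⟩
  simp only [Finset.mem_filter, Finset.mem_product, Finset.mem_range,
    Finset.HasAntidiagonal.mem_antidiagonal]
  omega

/-- The vertex weight of a site with `κ + 1` visits, as a function of the numbers `i + 1`, `j + 1`
of crossings on its two sides. -/
noncomputable def vertex (R : Type*) [CommRing R] (L κ : ℕ) : Matrix (Fin L) (Fin L) R :=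
  fun i j => if (i : ℕ) + j + 1 = κ then (κ ! : R) else 0

/-- The vertex weight of an outermost site with `κ + 1` visits. -/
noncomputable def vertexEnd (R : Type*) [CommRing R] (L κ : ℕ) : Fin L → R :=
  fun i => if (i : ℕ) = κ then (κ ! : R) else 0

/-- The vertex weight of a site with `κ + 1` visits, beyond which all sites are unmarked. -/
noncomputable def markedEnd (y : R) (L κ : ℕ) : Fin L → R := fun i => (κ ! : ℂ) • divPow y κ i

theorem vertex_transpose {R : Type*} [CommRing R] (L κ : ℕ) :
    (vertex R L κ)ᵀ = vertex R L κ := by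
  ext i j
  simp [vertex, add_comm (i : ℕ)]

theorem vertexEnd_add_vertex_mulVec (y : R) {L κ : ℕ} (hκ : κ < L) :
    vertexEnd R L κ + vertex R L κ *ᵥ (fun i : Fin L => freeEnd y i) = markedEnd y L κ := by
  ext i
  have h1 : (vertex R L κ *ᵥ (fun i : Fin L => freeEnd y i)) i =
      if (i : ℕ) + 1 ≤ κ then (κ ! : R) * freeEnd y (κ - 1 - i) else 0 := by
    rw [mulVec, dotProduct]
    split_ifs with h
    · rw [Finset.sum_eq_single (⟨κ - 1 - i, by omega⟩ : Fin L)]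
      · rw [vertex, if_pos (by simp; omega)]
      · intro j _ hj
        rw [vertex, if_neg, zero_mul]
        intro h'
        exact hj (Fin.ext (by simp; omega))
      · simp
    · refine Finset.sum_eq_zero fun j _ => ?_
      rw [vertex, if_neg (by omega), zero_mul]
  rw [Pi.add_apply, h1, vertexEnd, markedEnd, divPow]
  rcases lt_trichotomy (i : ℕ) κ with h | h | h
  · rw [if_neg (by omega), if_pos (by omega), if_pos (by omega), freeEnd, zero_add,
      show κ - 1 - i + 1 = κ - i by omega, cast_mul_eq_smul]
  · rw [if_pos h, if_neg (by omega), if_pos (by omega), h, add_zero, Nat.sub_self, pow_zero,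
      Nat.factorial_zero, Nat.cast_one, inv_one, one_smul]
    rw [← mul_one (κ ! : R), cast_mul_eq_smul]
  · rw [if_neg (by omega), if_neg (by omega), if_neg (by omega), add_zero, smul_zero]

theorem vertexEnd_dotProduct (y : R) {L κ : ℕ} (hκ : κ < L) :
    vertexEnd R L κ ⬝ᵥ (fun i : Fin L => freeEnd y i) +
      (fun i : Fin L => freeEnd y i) ⬝ᵥ markedEnd y L κ =
      (1 / ((κ : ℂ) + 1)) • (2 * y) ^ (κ + 1) := by
  have h := sum_range_divPow y (show κ + 1 < L + 1 by omega) 0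
  rw [Finset.sum_range_succ'] at h
  have h1 : vertexEnd R L κ ⬝ᵥ (fun i : Fin L => freeEnd y i) =
      (κ ! : ℂ) • (divPow y (κ + 1) 0 * divPow y 0 0) := by
    rw [dotProduct, Finset.sum_eq_single (⟨κ, hκ⟩ : Fin L)]
    · rw [vertexEnd, if_pos rfl, cast_mul_eq_smul]
      simp [divPow, freeEnd]
    · intro j _ hj
      rw [vertexEnd, if_neg, zero_mul]
      intro h'
      exact hj (Fin.ext h')
    · simp
  have h2 : (fun i : Fin L => freeEnd y i) ⬝ᵥ markedEnd y L κ =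
      (κ ! : ℂ) • ∑ k ∈ Finset.range L, divPow y (κ + 1) (k + 1) * divPow y (k + 1) 0 := by
    rw [dotProduct, Finset.smul_sum, ← Fin.sum_univ_eq_sum_range
      (fun k => (κ ! : ℂ) • (divPow y (κ + 1) (k + 1) * divPow y (k + 1) 0))]
    refine Finset.sum_congr rfl fun i _ => ?_
    simp only [markedEnd, freeEnd]
    rw [mul_smul_comm, mul_comm]
    simp [divPow]
  rw [h1, h2, ← smul_add, add_comm, h, divPow, if_pos (Nat.zero_le _), smul_smul, Nat.sub_zero,
    Nat.factorial_succ]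
  congr 1
  push_cast
  have : (κ : ℂ) + 1 ≠ 0 := by exact_mod_cast Nat.succ_ne_zero κ
  have := Nat.factorial_ne_zero κ
  field_simp

theorem factorial_dotProduct_freeEnd (y : R) (L : ℕ) :
    (fun i : Fin L => ((i : ℕ)! : R)) ⬝ᵥ (fun i : Fin L => freeEnd y i) =
      ∑ i ∈ Finset.range L, (1 / ((i : ℂ) + 1)) • y ^ (i + 1) := by
  rw [dotProduct, Fin.sum_univ_eq_sum_range (fun i => (i ! : R) * freeEnd y i)]
  refine Finset.sum_congr rfl fun i _ => ?_
  rw [freeEnd, cast_mul_eq_smul, smul_smul, Nat.factorial_succ]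
  congr 1
  push_cast
  have : (i : ℂ) + 1 ≠ 0 := by exact_mod_cast Nat.succ_ne_zero i
  have := Nat.factorial_ne_zero i
  field_simp

/-- The Green's function as a matrix. -/
noncomputable def greenMat (y : R) (lam : ℕ → R) (n L : ℕ) : Matrix (Fin L) (Fin L) R :=
  fun i j => green y lam n i j

theorem markedEnd_vecMul_greenMat (y : R) (lam : ℕ → R) (n : ℕ) {L κ : ℕ} (hκ : κ < L) (j : Fin L) :
    (markedEnd y L κ ᵥ* greenMat y lam n L) j = ∑ p ∈ Finset.range n, ∑ q ∈ Finset.range n,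
      ((κ.choose p : ℂ) * (q ! : ℂ)⁻¹) •
        ((2 * y) ^ (κ - p) * divPow y j q * gCoeff y lam n p q) := by
  have h1 : (markedEnd y L κ ᵥ* greenMat y lam n L) j = ∑ i ∈ Finset.range L,
      ∑ p ∈ Finset.range n, ∑ q ∈ Finset.range n, ((κ ! : ℂ) * (p ! : ℂ)⁻¹ * (q ! : ℂ)⁻¹) •
        ((divPow y κ i * divPow y i p) * (divPow y j q * gCoeff y lam n p q)) := by
    rw [vecMul, dotProduct, ← Fin.sum_univ_eq_sum_range (fun i =>
      ∑ p ∈ Finset.range n, ∑ q ∈ Finset.range n, ((κ ! : ℂ) * (p ! : ℂ)⁻¹ * (q ! : ℂ)⁻¹) •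
        ((divPow y κ i * divPow y i p) * (divPow y j q * gCoeff y lam n p q)))]
    refine Finset.sum_congr rfl fun i _ => ?_
    rw [markedEnd, greenMat, green_eq_sum_gCoeff, Finset.mul_sum]
    refine Finset.sum_congr rfl fun p _ => ?_
    rw [Finset.mul_sum]
    refine Finset.sum_congr rfl fun q _ => ?_
    rw [smul_mul_smul_comm]
    congr 1 <;> ring
  rw [h1, Finset.sum_comm]
  refine Finset.sum_congr rfl fun p _ => ?_
  rw [Finset.sum_comm]
  refine Finset.sum_congr rfl fun q _ => ?_
  rw [← Finset.smul_sum, ← Finset.sum_mul, sum_range_divPow y hκ,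
    show (κ ! : ℂ) * (p ! : ℂ)⁻¹ * (q ! : ℂ)⁻¹ = (q ! : ℂ)⁻¹ * ((κ ! : ℂ) / (p ! : ℂ)) by ring,
    mul_smul, ← smul_mul_assoc ((κ ! : ℂ) / _), factorial_smul_divPow, smul_mul_assoc, smul_smul,
    mul_comm (_)⁻¹, mul_assoc]

/-- The weight of two outermost marked sites with `κ + 1` and `κ' + 1` visits and no marked sites in
between, summed over their distance. -/
noncomputable def twoMarked (y : R) (lam : ℕ → R) (n κ κ' : ℕ) : R :=
  ∑ p ∈ Finset.range n, ∑ q ∈ Finset.range n, ((κ.choose p : ℂ) * (κ'.choose q : ℂ)) •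
    ((2 * y) ^ (κ - p + (κ' - q)) * gCoeff y lam n p q)

theorem markedEnd_dotProduct_green (y : R) (lam : ℕ → R) (n : ℕ) {L κ κ' : ℕ} (hκ : κ < L)
    (hκ' : κ' < L) :
    markedEnd y L κ ⬝ᵥ (greenMat y lam n L *ᵥ markedEnd y L κ') = twoMarked y lam n κ κ' := by
  have h1 : markedEnd y L κ ⬝ᵥ (greenMat y lam n L *ᵥ markedEnd y L κ') =
      ∑ j ∈ Finset.range L, ∑ p ∈ Finset.range n, ∑ q ∈ Finset.range n,
      ((κ.choose p : ℂ) * ((κ' ! : ℂ) / (q ! : ℂ))) •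
        ((2 * y) ^ (κ - p) * (divPow y κ' j * divPow y j q) * gCoeff y lam n p q) := by
    rw [dotProduct_mulVec, dotProduct, ← Fin.sum_univ_eq_sum_range (fun j =>
      ∑ p ∈ Finset.range n, ∑ q ∈ Finset.range n,
      ((κ.choose p : ℂ) * ((κ' ! : ℂ) / (q ! : ℂ))) •
        ((2 * y) ^ (κ - p) * (divPow y κ' j * divPow y j q) * gCoeff y lam n p q))]
    refine Finset.sum_congr rfl fun j _ => ?_
    rw [markedEnd_vecMul_greenMat y lam n hκ, Finset.sum_mul]
    refine Finset.sum_congr rfl fun p _ => ?_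
    rw [Finset.sum_mul]
    refine Finset.sum_congr rfl fun q _ => ?_
    rw [markedEnd, smul_mul_smul_comm]
    congr 1 <;> ring
  rw [h1, Finset.sum_comm, twoMarked]
  refine Finset.sum_congr rfl fun p _ => ?_
  rw [Finset.sum_comm]
  refine Finset.sum_congr rfl fun q _ => ?_
  rw [← Finset.smul_sum, ← Finset.sum_mul, ← Finset.mul_sum, sum_range_divPow y hκ', mul_smul,
    ← smul_mul_assoc ((κ' ! : ℂ) / _), ← mul_smul_comm ((κ' ! : ℂ) / _), factorial_smul_divPow,
    mul_smul_comm, smul_mul_assoc, smul_smul, pow_add]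

/-- The left factor of the Green's function as a matrix. -/
noncomputable def leftMat (y : R) (lam : ℕ → R) (n L : ℕ) : Matrix (Fin L) (Fin n × Fin n) R :=
  fun i a => edgeLeft y lam n i a.1 a.2

/-- The right factor of the Green's function as a matrix. -/
noncomputable def rightMat (y : R) (n L : ℕ) : Matrix (Fin n × Fin n) (Fin L) R :=
  fun a j => edgeRight y a.1 a.2 j

theorem greenMat_eq_mul (y : R) (lam : ℕ → R) (n L : ℕ) :
    greenMat y lam n L = leftMat y lam n L * rightMat y n L := by
  ext i j
  rw [greenMat, green_eq_sum_edge, mul_apply, Fintype.sum_prod_type,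
    ← Fin.sum_univ_eq_sum_range (fun r => ∑ t ∈ Finset.range n,
      edgeLeft y lam n i r t * edgeRight y r t j)]
  refine Finset.sum_congr rfl fun r _ => ?_
  rw [← Fin.sum_univ_eq_sum_range (fun t => edgeLeft y lam n i r t * edgeRight y r t j)]
  rfl

/-- The entry of `Q(κ + 1)` over a ring in which the sums are finite. -/
noncomputable def qEntry (y : R) (lam : ℕ → R) (n κ r t r' t' : ℕ) : R :=
  if κ = 0 then 0 else ∑ e ∈ Finset.range n,
    ((κ ! : ℂ) * (-1) ^ (r + e) * ((r ! : ℂ)⁻¹ * (t' ! : ℂ)⁻¹ * ((t' + 1)! : ℂ)⁻¹ * (e ! : ℂ)⁻¹)) •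
      (divPow (2 * y) (κ - 1) (t + r + (t' + e)) * hCoeff y lam n t' (e + r'))

theorem rightMat_mul_vertex_mul_leftMat (y : R) (lam : ℕ → R) (n : ℕ) {L κ : ℕ} (hκ : κ ≤ L)
    (a b : Fin n × Fin n) :
    (rightMat y n L * vertex R L κ * leftMat y lam n L) a b =
      qEntry y lam n κ a.1 a.2 b.1 b.2 := by
  rw [Matrix.mul_assoc, mul_apply]
  simp only [mul_apply, Finset.mul_sum]
  rw [qEntry]
  split_ifs with h0
  · refine Finset.sum_eq_zero fun i _ => Finset.sum_eq_zero fun j _ => ?_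
    rw [vertex, if_neg (by omega)]; simp
  · obtain ⟨m, rfl⟩ : ∃ m, κ = m + 1 := ⟨κ - 1, by omega⟩
    have h1 : ∀ i j : Fin L, rightMat y n L a i * (vertex R L (m + 1) i j * leftMat y lam n L j b) =
        if (i : ℕ) + j = m then ((m + 1)! : ℂ) • (edgeRight y a.1 a.2 i *
          edgeLeft y lam n j b.1 b.2) else 0 := by
      intro i j
      rw [vertex, rightMat, leftMat]
      by_cases h : (i : ℕ) + j = m
      · rw [if_pos (by omega), if_pos h, cast_mul_eq_smul, mul_smul_comm]
      · rw [if_neg (by omega), if_neg h]; simp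
    simp only [h1]
    have h2 := sum_range_hankel (show m < L by omega) (fun i j => ((m + 1)! : ℂ) •
      (edgeRight y a.1 a.2 i * edgeLeft y lam n j b.1 b.2))
    rw [← Fin.sum_univ_eq_sum_range (fun i => ∑ j ∈ Finset.range L, if i + j = m then
      ((m + 1)! : ℂ) • (edgeRight y a.1 a.2 i * edgeLeft y lam n j b.1 b.2) else 0)] at h2
    simp only [← Fin.sum_univ_eq_sum_range (fun j => if _ + j = m then
      ((m + 1)! : ℂ) • (edgeRight y a.1 a.2 _ * edgeLeft y lam n j b.1 b.2) else 0)] at h2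
    rw [h2]
    simp only [edgeLeft, Finset.mul_sum, Finset.smul_sum]
    rw [Finset.sum_comm]
    refine Finset.sum_congr rfl fun e _ => ?_
    rw [Nat.add_sub_cancel, ← sum_antidiagonal_divPow, Finset.sum_mul, Finset.smul_sum]
    refine Finset.sum_congr rfl fun x _ => ?_
    rw [edgeRight, smul_mul_smul_comm, smul_smul]
    congr 1 <;> ring

/-- The entry of `Φ(κ + 1, κ' + 1)` over a ring in which the sums are finite. -/
noncomputable def phiEntry (y : R) (lam : ℕ → R) (n κ κ' r t : ℕ) : R :=
  if r + t + 1 ≤ κ then ((-1) ^ (r + 1) * (κ ! : ℂ) / ((r ! : ℂ) * ((κ - 1 - r - t)! : ℂ))) •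
    twoMarked y lam n (κ - 1 - r - t) κ' else 0

theorem rightMat_mul_vertex (y : R) {n L κ : ℕ} (hκ : κ ≤ L) (a : Fin n × Fin n) (j : Fin L) :
    (rightMat y n L * vertex R L κ) a j = if (a.1 : ℕ) + a.2 + 1 ≤ κ then
      ((-1) ^ (a.1 : ℕ) * (κ ! : ℂ) / (((a.1 : ℕ)! : ℂ) * ((κ - 1 - a.1 - a.2)! : ℂ))) •
        markedEnd y L (κ - 1 - a.1 - a.2) j else 0 := by
  rw [mul_apply]
  by_cases hj : (j : ℕ) + 1 ≤ κ
  · rw [Finset.sum_eq_single (⟨κ - 1 - j, by omega⟩ : Fin L)]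
    · rw [vertex, if_pos (by simp; omega), rightMat, edgeRight, mul_comm, cast_mul_eq_smul,
        markedEnd, divPow, divPow]
      simp only
      by_cases h : (a.1 : ℕ) + a.2 + j + 1 ≤ κ
      · rw [if_pos (by omega), if_pos (by omega), if_pos (by omega), smul_smul, smul_smul, smul_smul,
          smul_smul, show κ - 1 - a.1 - a.2 - j = κ - 1 - j - (a.2 + a.1) by omega]
        congr 1
        have := Nat.factorial_ne_zero (κ - 1 - a.1 - a.2)
        field_simp
      · rw [if_neg (by omega)]
        split_ifs <;> first | omega | simp
    · intro i _ hi
      rw [vertex, if_neg, mul_zero]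
      intro h'
      exact hi (Fin.ext (by simp; omega))
    · simp
  · rw [Finset.sum_eq_zero]
    · split_ifs with h
      · rw [markedEnd, divPow_of_lt _ (by omega)]; simp
      · rfl
    · intro i _
      rw [vertex, if_neg (by omega), mul_zero]

theorem rightMat_mul_vertex_mul_green (y : R) (lam : ℕ → R) (n : ℕ) {L κ κ' : ℕ} (hκ : κ ≤ L)
    (hκ' : κ' < L) (a : Fin n × Fin n) :
    ((rightMat y n L * vertex R L κ * greenMat y lam n L) *ᵥ markedEnd y L κ') a =
      -phiEntry y lam n κ κ' a.1 a.2 := by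
  rw [← mulVec_mulVec, mulVec, phiEntry]
  split_ifs with h
  · rw [← markedEnd_dotProduct_green y lam n (show κ - 1 - a.1 - a.2 < L by omega) hκ', ← neg_smul,
      ← smul_dotProduct]
    congr 1
    ext j
    rw [rightMat_mul_vertex y hκ, if_pos h, Pi.smul_apply, pow_succ]
    congr 1
    ring
  · rw [neg_zero]
    refine Finset.sum_eq_zero fun j _ => ?_
    simp only [rightMat_mul_vertex y hκ, if_neg h, zero_mul]

/-- The entry of `Ψ(κ + 1)` over a ring in which the sums are finite. -/
noncomputable def psiEntry (y : R) (lam : ℕ → R) (n κ r t : ℕ) : R :=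
  if t = 0 then (-1) ^ (r + 1) * ∑ p ∈ Finset.range n,
    (κ.choose p : ℂ) • ((2 * y) ^ (κ - p) * gCoeff y lam n r p) else 0

theorem psi_vecMul_rightMat (y : R) (lam : ℕ → R) (n : ℕ) {L κ : ℕ} (hκ : κ < L) :
    (fun a : Fin n × Fin n => psiEntry y lam n κ a.1 a.2) ᵥ* rightMat y n L =
      -(markedEnd y L κ ᵥ* greenMat y lam n L) := by
  ext j
  rw [Pi.neg_apply, markedEnd_vecMul_greenMat y lam n hκ, Finset.sum_comm,
    ← Fin.sum_univ_eq_sum_range (fun q => ∑ p ∈ Finset.range n, ((κ.choose p : ℂ) * (q ! : ℂ)⁻¹) •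
        ((2 * y) ^ (κ - p) * divPow y j q * gCoeff y lam n p q)), ← Finset.sum_neg_distrib]
  change ∑ a : Fin n × Fin n, psiEntry y lam n κ a.1 a.2 * edgeRight y a.1 a.2 j = _
  rw [Fintype.sum_prod_type]
  refine Finset.sum_congr rfl fun r _ => ?_
  rw [Finset.sum_eq_single (⟨0, r.pos⟩ : Fin n)]
  · simp only [psiEntry, if_pos, edgeRight, zero_add]
    rw [Finset.mul_sum, Finset.sum_mul, ← Finset.sum_neg_distrib]
    refine Finset.sum_congr rfl fun p _ => ?_
    rw [gCoeff_comm y lam n p]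
    simp only [mul_smul_comm, smul_mul_assoc, smul_smul]
    rcases Nat.even_or_odd (r : ℕ) with h | h
    · simp only [pow_succ, h.neg_one_pow]
      rw [← smul_neg]
      congr 1 <;> ring
    · simp only [pow_succ, h.neg_one_pow]
      rw [← neg_smul]
      congr 1 <;> ring
  · intro t _ ht
    rw [psiEntry, if_neg, zero_mul]
    intro h
    exact ht (Fin.ext h)
  · simp

end Marked

/-! ### Walks weighted by their visits -/

section Visits

/-- The sum of a list of steps. -/
def stepSum (l : List ℤˣ) : ℤ := (l.map (fun s : ℤˣ => (s : ℤ))).sum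

/-- The number of visits to each site of the walk with start `p` and steps `l`, its end point not
being counted. -/
noncomputable def visits : ℤ → List ℤˣ → (ℤ →₀ ℕ)
  | _, [] => 0
  | p, s :: l => Finsupp.single p 1 + visits (p + s) l

/-- The step lists of length `n`. -/
def stepLists : ℕ → Finset (List ℤˣ)
  | 0 => {[]}
  | n + 1 => (stepLists n).image (List.cons 1) ∪ (stepLists n).image (List.cons (-1))

theorem mem_stepLists {n : ℕ} {l : List ℤˣ} : l ∈ stepLists n ↔ l.length = n := by
  induction n generalizing l with
  | zero => simp [stepLists]
  | succ n ih =>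
    simp only [stepLists, Finset.mem_union, Finset.mem_image, ih]
    constructor
    · rintro (⟨l', h, rfl⟩ | ⟨l', h, rfl⟩) <;> simp [h]
    · intro h
      match l, h with
      | s :: l', h =>
        have h' : l'.length = n := by simpa using h
        rcases Int.units_eq_one_or s with rfl | rfl
        · exact Or.inl ⟨l', h', rfl⟩
        · exact Or.inr ⟨l', h', rfl⟩

theorem sum_stepLists_succ {M : Type*} [AddCommMonoid M] (n : ℕ) (F : List ℤˣ → M) :
    ∑ l ∈ stepLists (n + 1), F l =
      ∑ l ∈ stepLists n, F (1 :: l) + ∑ l ∈ stepLists n, F (-1 :: l) := by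
  rw [stepLists, Finset.sum_union, Finset.sum_image, Finset.sum_image]
  · intro _ _ _ _ h; simpa using h
  · intro _ _ _ _ h; simpa using h
  · rw [Finset.disjoint_left]
    intro l h1 h2
    simp only [Finset.mem_image] at h1 h2
    obtain ⟨l1, -, rfl⟩ := h1
    obtain ⟨l2, -, h⟩ := h2
    have : (-1 : ℤˣ) = 1 := (List.cons.inj h).1
    exact absurd this (by decide)

variable {R : Type*} [CommRing R]

/-- The sum over the walks of length `n` from `p` to `0` of the monomials recording the visits. -/
noncomputable def walkPoly (R : Type*) [CommRing R] : ℕ → ℤ → MvPolynomial ℤ R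
  | 0, p => if p = 0 then 1 else 0
  | n + 1, p => MvPolynomial.X p * (walkPoly R n (p + 1) + walkPoly R n (p - 1))

theorem walkPoly_eq_sum (n : ℕ) (p : ℤ) : walkPoly R n p = ∑ l ∈ stepLists n,
    if p + stepSum l = 0 then MvPolynomial.monomial (visits p l) 1 else 0 := by
  induction n generalizing p with
  | zero => simp [walkPoly, stepLists, stepSum, visits]
  | succ n ih =>
    rw [walkPoly, sum_stepLists_succ, ih, ih, mul_add, Finset.mul_sum, Finset.mul_sum]
    congr 1
    · refine Finset.sum_congr rfl fun l _ => ?_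
      rw [show p + stepSum (1 :: l) = p + 1 + stepSum l by simp [stepSum]; ring, mul_ite, mul_zero,
        visits, MvPolynomial.X, MvPolynomial.monomial_mul, one_mul, Units.val_one]
    · refine Finset.sum_congr rfl fun l _ => ?_
      rw [show p + stepSum (-1 :: l) = p - 1 + stepSum l by simp [stepSum]; ring, mul_ite, mul_zero,
        visits, MvPolynomial.X, MvPolynomial.monomial_mul, one_mul, Units.val_neg, Units.val_one,
        ← sub_eq_add_neg]

theorem walkPoly_eq_zero {n : ℕ} {p : ℤ} (h : (n : ℤ) < |p|) : walkPoly R n p = 0 := by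
  induction n generalizing p with
  | zero =>
    rw [walkPoly, if_neg]
    rintro rfl
    simp at h
  | succ n ih =>
    push_cast at h
    rw [walkPoly, ih, ih, add_zero, mul_zero]
    · rcases abs_cases p with ⟨h1, h2⟩ | ⟨h1, h2⟩ <;> rcases abs_cases (p - 1) with ⟨h3, h4⟩ | ⟨h3, h4⟩ <;>
        omega
    · rcases abs_cases p with ⟨h1, h2⟩ | ⟨h1, h2⟩ <;> rcases abs_cases (p + 1) with ⟨h3, h4⟩ | ⟨h3, h4⟩ <;>
        omega

/-- The linear functional which weights a site with `k` visits by `τ k`. -/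
noncomputable def visitWeight (τ : ℕ → R) : MvPolynomial ℤ R →ₗ[R] R :=
  (MvPolynomial.basisMonomials ℤ R).constr R fun m => m.prod fun _ k => τ k

theorem visitWeight_monomial (τ : ℕ → R) (m : ℤ →₀ ℕ) (c : R) :
    visitWeight τ (MvPolynomial.monomial m c) = c * m.prod fun _ k => τ k := by
  have h : MvPolynomial.monomial m c = c • (MvPolynomial.basisMonomials ℤ R) m := by
    rw [MvPolynomial.coe_basisMonomials, MvPolynomial.smul_monomial, smul_eq_mul, mul_one]
  rw [h, map_smul, visitWeight, Module.Basis.constr_basis, smul_eq_mul]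

theorem visitWeight_one (τ : ℕ → R) : visitWeight τ 1 = 1 := by
  have := visitWeight_monomial τ 0 1
  simpa using this

theorem visitWeight_mul_X_pow {τ : ℕ → R} (hτ : τ 0 = 1) {s : Set ℤ} {i : ℤ} (hi : i ∉ s)
    {g : MvPolynomial ℤ R} (hg : g ∈ MvPolynomial.supported R s) (k : ℕ) :
    visitWeight τ (g * MvPolynomial.X i ^ k) = τ k * visitWeight τ g := by
  have hvars : ∀ m ∈ g.support, i ∉ m.support := by
    intro m hm him
    exact hi (MvPolynomial.mem_supported.mp hg
      (MvPolynomial.mem_vars_iff_mem_support i |>.mpr ⟨m, hm, him⟩))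
  rw [g.as_sum, Finset.sum_mul, map_sum, map_sum, Finset.mul_sum]
  refine Finset.sum_congr rfl fun m hm => ?_
  rw [MvPolynomial.X_pow_eq_monomial, MvPolynomial.monomial_mul, mul_one, visitWeight_monomial,
    visitWeight_monomial, Finsupp.prod_add_index_of_disjoint, Finsupp.prod_single_index hτ]
  · ring
  · rw [Finset.disjoint_left]
    intro x hx hx'
    have : x = i := by simpa using Finsupp.support_single_subset hx'
    exact hvars m hm (this ▸ hx)

end Visits

/-! ### Excursions as a continued fraction -/

section Excursions

variable {R : Type*} [CommRing R]

open MvPolynomial in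
/-- The generating function of the walks from `site j` to its predecessor which stay in the first
`M` of the sites `site j, site (j + 1), …` until their last step: a continued fraction of depth
`M`, whose reciprocals are written as geometric sums with `K` terms. -/
noncomputable def excursion (z : R) (K : ℕ) (site : ℕ → ℤ) : ℕ → ℕ → MvPolynomial ℤ R
  | 0, _ => 0
  | M + 1, j => C z * X (site j) *
      ∑ k ∈ Finset.range K, (X (site j) * (C z * excursion z K site M (j + 1))) ^ k

open MvPolynomial

theorem C_mul_excursion_dvd (z : R) (K : ℕ) (site : ℕ → ℤ) (M j : ℕ) :
    C (z ^ 2) ∣ C z * excursion z K site M j := by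
  cases M with
  | zero => simp [excursion]
  | succ M =>
    rw [excursion, map_pow, sq, mul_assoc (C z) (X _), ← mul_assoc (C z) (C z)]
    exact dvd_mul_right _ _

theorem X_mem_supported_of_mem {s : Set ℤ} {i : ℤ} (hi : i ∈ s) :
    (X i : MvPolynomial ℤ R) ∈ supported R s :=
  Algebra.subset_adjoin ⟨i, hi, rfl⟩

theorem pow_eq_zero_of_C_sq_dvd {z : R} {K : ℕ} (hz : z ^ (2 * K) = 0) {g : MvPolynomial ℤ R}
    (hg : C (z ^ 2) ∣ g) : g ^ K = 0 := by
  obtain ⟨c, rfl⟩ := hg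
  rw [mul_pow, ← map_pow, ← pow_mul, hz, map_zero, zero_mul]

theorem geom_sum_mul_one_sub {S : Type*} [CommRing S] {x : S} {K : ℕ} (hx : x ^ K = 0) :
    (∑ k ∈ Finset.range K, x ^ k) * (1 - x) = 1 := by
  have := mul_neg_geom_sum x K
  rw [mul_comm, this, hx, sub_zero]

theorem excursion_mem_supported (z : R) (K : ℕ) (site : ℕ → ℤ) (M j : ℕ) :
    excursion z K site M j ∈ supported R {q | ∃ k, j ≤ k ∧ q = site k} := by
  induction M generalizing j with
  | zero => exact zero_mem _
  | succ M ih =>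
    have hX : (X (site j) : MvPolynomial ℤ R) ∈ supported R {q | ∃ k, j ≤ k ∧ q = site k} :=
      X_mem_supported_of_mem ⟨j, le_rfl, rfl⟩
    have hC : (C z : MvPolynomial ℤ R) ∈ supported R {q | ∃ k, j ≤ k ∧ q = site k} :=
      Subalgebra.algebraMap_mem _ z
    have hE : excursion z K site M (j + 1) ∈ supported R {q | ∃ k, j ≤ k ∧ q = site k} := by
      refine supported_mono ?_ (ih (j + 1))
      rintro q ⟨k, hk, rfl⟩
      exact ⟨k, by omega, rfl⟩
    rw [excursion]
    exact mul_mem (mul_mem hC hX) (sum_mem fun k _ => pow_mem (mul_mem hX (mul_mem hC hE)) k)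

/-- The weight of the half line beyond an edge with `u` crossings, up to distance `M`: the binomial
coefficient counts the ways to distribute `v` excursions over `u` visits from the near side. -/
noncomputable def halfLine (z : R) (τ : ℕ → R) (K : ℕ) : ℕ → ℕ → R
  | 0, u => if u = 0 then 1 else 0
  | M + 1, u => if u = 0 then 1 else z ^ (2 * u) * ∑ v ∈ Finset.range K,
      ((u - 1 + v).choose (u - 1) : R) * τ (u + v) * halfLine z τ K M v

theorem halfLine_zero_right (z : R) (τ : ℕ → R) (K M : ℕ) : halfLine z τ K M 0 = 1 := by
  cases M <;> simp [halfLine]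

theorem dvd_halfLine (z : R) (τ : ℕ → R) (K M u : ℕ) : z ^ (2 * u) ∣ halfLine z τ K M u := by
  rcases Nat.eq_zero_or_pos u with rfl | hu
  · simp
  · cases M with
    | zero => simp [halfLine, hu.ne']
    | succ M =>
      rw [halfLine, if_neg hu.ne']
      exact dvd_mul_right _ _

/-- The functional `visitWeight` turns the powers of the continued fraction into the weights of
the half line, one site at a time. -/
theorem visitWeight_mul_excursion_pow {z : R} {τ : ℕ → R} (hτ : τ 0 = 1) {K : ℕ}
    (hz : z ^ (2 * K) = 0) {site : ℕ → ℤ} (hsite : Function.Injective site) (M j u : ℕ)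
    {s : Set ℤ} (hs : ∀ k, j ≤ k → site k ∉ s) {g : MvPolynomial ℤ R} (hg : g ∈ supported R s) :
    visitWeight τ (g * (C z * excursion z K site M j) ^ u) =
      visitWeight τ g * halfLine z τ K M u := by
  induction M generalizing j u s g with
  | zero =>
    rcases Nat.eq_zero_or_pos u with rfl | hu
    · simp [halfLine]
    · simp [halfLine, excursion, hu.ne']
  | succ M ih =>
    rcases Nat.eq_zero_or_pos u with rfl | hu
    · simp [halfLine]
    · set x : MvPolynomial ℤ R := X (site j) with hx
      set Y' := C z * excursion z K site M (j + 1) with hY'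
      have hnil : (x * Y') ^ K = 0 := by
        rw [mul_pow, pow_eq_zero_of_C_sq_dvd hz (C_mul_excursion_dvd z K site M (j + 1)), mul_zero]
      have hpow := sum_choose_mul_pow (geom_sum_mul_one_sub hnil) hnil (u - 1)
      rw [Nat.sub_add_cancel hu] at hpow
      have e1 : (C z * excursion z K site (M + 1) j) ^ u = C (z ^ (2 * u)) * (x ^ u *
          ∑ v ∈ Finset.range K, ((u - 1 + v).choose (u - 1) : MvPolynomial ℤ R) * (x * Y') ^ v) := by
        rw [hpow, excursion, ← hx, ← hY', pow_mul, map_pow, map_pow]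
        ring
      have e2 : g * (C z * excursion z K site (M + 1) j) ^ u = ∑ v ∈ Finset.range K,
          (z ^ (2 * u) * ((u - 1 + v).choose (u - 1) : R)) • ((g * x ^ (u + v)) * Y' ^ v) := by
        rw [e1, Finset.mul_sum, Finset.mul_sum, Finset.mul_sum]
        refine Finset.sum_congr rfl fun v _ => ?_
        rw [smul_eq_C_mul, map_mul, map_natCast, mul_pow, pow_add]
        ring
      rw [e2, map_sum, halfLine, if_neg hu.ne', Finset.mul_sum, Finset.mul_sum]
      refine Finset.sum_congr rfl fun v _ => ?_
      have hg' : g * x ^ (u + v) ∈ supported R (insert (site j) s) :=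
        mul_mem (supported_mono (Set.subset_insert _ _) hg) (pow_mem
          (X_mem_supported_of_mem (Set.mem_insert _ _)) _)
      have hs' : ∀ k, j + 1 ≤ k → site k ∉ insert (site j) s := by
        intro k hk h
        rcases h with h | h
        · have := hsite h; omega
        · exact hs k (by omega) h
      rw [map_smul, ih (j + 1) v hs' hg', visitWeight_mul_X_pow hτ (hs j le_rfl) hg, smul_eq_mul]
      ring

end Excursions

/-! ### The generating function of the weighted closed walks -/

section ClosedWalks

variable {R : Type*} [CommRing R]

open MvPolynomial

/-- The generating function of the walks of length less than `n` from `p` to `0`. -/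
noncomputable def walkGF (z : R) (n : ℕ) (p : ℤ) : MvPolynomial ℤ R :=
  ∑ m ∈ Finset.range n, C z ^ m * walkPoly R m p

theorem walkGF_eq {z : R} {n : ℕ} (hz : z ^ n = 0) (hn : 0 < n) (p : ℤ) :
    walkGF z n p = (if p = 0 then 1 else 0) +
      C z * X p * (walkGF z n (p + 1) + walkGF z n (p - 1)) := by
  obtain ⟨n, rfl⟩ : ∃ n', n = n' + 1 := ⟨n - 1, by omega⟩
  have h1 : ∀ q, C z * walkGF z (n + 1) q =
      ∑ m ∈ Finset.range n, C z ^ (m + 1) * walkPoly R m q := by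
    intro q
    have : (C z : MvPolynomial ℤ R) * (C z ^ n * walkPoly R n q) = 0 := by
      rw [← mul_assoc, ← pow_succ', ← map_pow, hz, map_zero, zero_mul]
    rw [walkGF, Finset.sum_range_succ, mul_add, this, add_zero, Finset.mul_sum]
    exact Finset.sum_congr rfl fun m _ => by ring
  have h2 : C z * X p * (walkGF z (n + 1) (p + 1) + walkGF z (n + 1) (p - 1)) =
      X p * (C z * walkGF z (n + 1) (p + 1) + C z * walkGF z (n + 1) (p - 1)) := by ring
  rw [h2, h1, h1, walkGF, Finset.sum_range_succ', add_comm, ← Finset.sum_add_distrib,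
    Finset.mul_sum, pow_zero, one_mul, walkPoly]
  congr 1
  refine Finset.sum_congr rfl fun m _ => ?_
  rw [walkPoly]
  ring

theorem walkGF_eq_zero {z : R} {n : ℕ} {p : ℤ} (hp : (n : ℤ) ≤ |p|) : walkGF z n p = 0 := by
  refine Finset.sum_eq_zero fun m hm => ?_
  rw [walkPoly_eq_zero, mul_zero]
  have : m < n := by simpa using hm
  omega

/-- First passage decomposition: walks from a site to `0` pass through the neighbour of that site
which is closer to `0`. -/
theorem walkGF_succ {z : R} {n K : ℕ} (hz : z ^ n = 0) (hn : 0 < n) (hK : z ^ (2 * K) = 0) {ε : ℤ}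
    (hε : ε = 1 ∨ ε = -1) (M j : ℕ) (hM : n ≤ M + j + 1) :
    walkGF z n (ε * (j + 1)) =
      excursion z K (fun k => ε * (k + 1)) M j * walkGF z n (ε * j) := by
  induction M generalizing j with
  | zero =>
    rw [walkGF_eq_zero, excursion, zero_mul]
    rcases hε with rfl | rfl
    · rw [one_mul, abs_of_nonneg (by omega)]; omega
    · rw [neg_one_mul, abs_neg, abs_of_nonneg (by omega)]; omega
  | succ M ih =>
    have h1 := walkGF_eq hz hn (ε * (j + 1))
    have h2 := ih (j + 1) (by omega)
    have h0 : ε * ((j : ℤ) + 1) ≠ 0 := by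
      rcases hε with rfl | rfl <;> omega
    rw [if_neg h0, zero_add] at h1
    have h3 : walkGF z n (ε * (j + 1) + 1) + walkGF z n (ε * (j + 1) - 1) =
        walkGF z n (ε * ((j + 1 : ℕ) + 1)) + walkGF z n (ε * j) := by
      rcases hε with rfl | rfl
      · congr 2; ring
      · rw [add_comm]
        congr 2; ring
    rw [h3, h2] at h1
    push_cast at h1
    set x : MvPolynomial ℤ R := X (ε * (j + 1)) with hx
    set E := excursion z K (fun k => ε * (k + 1)) M (j + 1) with hE
    have hnil : (x * (C z * E)) ^ K = 0 := by
      rw [mul_pow, pow_eq_zero_of_C_sq_dvd hK (C_mul_excursion_dvd z K _ M (j + 1)), mul_zero]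
    have hg := geom_sum_mul_one_sub hnil
    rw [excursion, ← hE, ← hx]
    set S := ∑ k ∈ Finset.range K, (x * (C z * E)) ^ k
    linear_combination (-walkGF z n (ε * (j + 1))) * hg + S * h1

/-- The generating function of the closed walks from `0`, split at `0` into two half lines. -/
theorem visitWeight_walkGF {z : R} {n K : ℕ} (hz : z ^ n = 0) (hn : 0 < n) (hK : z ^ (2 * K) = 0)
    {τ : ℕ → R} (hτ : τ 0 = 1) :
    visitWeight τ (walkGF z n 0) = ∑ k ∈ Finset.range K,
      ∑ x ∈ Finset.HasAntidiagonal.antidiagonal k, (k.choose x.1 : R) * τ k *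
        (halfLine z τ K n x.1 * halfLine z τ K n x.2) := by
  have hr := walkGF_succ hz hn hK (Or.inl rfl) n 0 (by omega)
  have hl := walkGF_succ hz hn hK (Or.inr rfl) n 0 (by omega)
  simp only [Nat.cast_zero, zero_add, mul_one, mul_zero] at hr hl
  set sr : ℕ → ℤ := fun k => 1 * ((k : ℤ) + 1) with hsr
  set sl : ℕ → ℤ := fun k => -1 * ((k : ℤ) + 1) with hsl
  set Yr := C z * excursion z K sr n 0 with hYr
  set Yl := C z * excursion z K sl n 0 with hYl
  have h0 := walkGF_eq hz hn 0
  rw [if_pos rfl, zero_add, zero_sub, hr, hl] at h0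
  have hnil : (X 0 * (Yr + Yl)) ^ K = 0 := by
    rw [mul_pow, pow_eq_zero_of_C_sq_dvd hK (dvd_add (C_mul_excursion_dvd z K _ n 0)
      (C_mul_excursion_dvd z K _ n 0)), mul_zero]
  have hg := geom_sum_mul_one_sub hnil
  have h1 : walkGF z n 0 = ∑ k ∈ Finset.range K, (X 0 * (Yr + Yl)) ^ k := by
    set S := ∑ k ∈ Finset.range K, (X 0 * (Yr + Yl)) ^ k
    linear_combination (-walkGF z n 0) * hg + S * h0
  rw [h1, map_sum]
  refine Finset.sum_congr rfl fun k _ => ?_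
  rw [mul_pow, (Commute.all Yr Yl).add_pow', Finset.mul_sum, map_sum]
  refine Finset.sum_congr rfl fun x _ => ?_
  have hX : (X 0 ^ k : MvPolynomial ℤ R) ∈ supported R {0} :=
    pow_mem (X_mem_supported_of_mem (Set.mem_singleton _)) _
  have hYs : Yr ∈ supported R {q | ∃ k, 0 ≤ k ∧ q = sr k} :=
    mul_mem (Subalgebra.algebraMap_mem _ z) (excursion_mem_supported z K sr n 0)
  have hg1 : X 0 ^ k * Yr ^ x.1 ∈ supported R ({0} ∪ {q | ∃ k, 0 ≤ k ∧ q = sr k}) :=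
    mul_mem (supported_mono Set.subset_union_left hX)
      (pow_mem (supported_mono Set.subset_union_right hYs) _)
  have e : X 0 ^ k * (k.choose x.1 • (Yr ^ x.1 * Yl ^ x.2)) =
      (k.choose x.1 : R) • ((X 0 ^ k * Yr ^ x.1) * Yl ^ x.2) := by
    rw [nsmul_eq_mul, smul_eq_C_mul, map_natCast]; ring
  have h1 : visitWeight τ (X 0 ^ k) = τ k := by
    have := visitWeight_mul_X_pow hτ (Set.notMem_empty (0 : ℤ)) (one_mem (supported R ∅)) k
    rwa [one_mul, visitWeight_one, mul_one] at this
  rw [e, map_smul, visitWeight_mul_excursion_pow hτ hK (site := sl) _ n 0 x.2 _ hg1,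
    visitWeight_mul_excursion_pow hτ hK (site := sr) _ n 0 x.1 _ hX, h1, smul_eq_mul]
  · ring
  · intro a b h; simpa [hsr] using h
  · intro m _ h
    simp only [hsr, Set.mem_singleton_iff] at h
    omega
  · intro a b h; simpa [hsl] using h
  · rintro m _ (h | ⟨m', _, h⟩)
    · simp only [hsl, Set.mem_singleton_iff] at h
      omega
    · simp only [hsl, hsr] at h
      omega

/-- The same generating function as a sum over pairs of crossing numbers. -/
theorem visitWeight_walkGF_eq_sum_range {z : R} {n L : ℕ} (hz : z ^ n = 0) (hn : 0 < n)
    (hL : z ^ (2 * (L + 1)) = 0) {τ : ℕ → R} (hτ : τ 0 = 1) :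
    visitWeight τ (walkGF z n 0) = 1 +
      (∑ i ∈ Finset.range L, 2 * (τ (i + 1) * halfLine z τ (L + 1) n (i + 1)) +
        ∑ i ∈ Finset.range L, ∑ j ∈ Finset.range L, ((i + j + 2).choose (i + 1) : R) *
          τ (i + j + 2) * (halfLine z τ (L + 1) n (i + 1) * halfLine z τ (L + 1) n (j + 1))) := by
  set F : ℕ → ℕ → R := fun u v => ((u + v).choose u : R) * τ (u + v) *
    (halfLine z τ (L + 1) n u * halfLine z τ (L + 1) n v) with hF
  have h0 : ∀ u v, L + 1 ≤ u + v → F u v = 0 := by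
    intro u v huv
    obtain ⟨c, hc⟩ := dvd_halfLine z τ (L + 1) n u
    obtain ⟨d, hd⟩ := dvd_halfLine z τ (L + 1) n v
    have : z ^ (2 * u) * z ^ (2 * v) = 0 := by
      rw [← pow_add]; exact pow_eq_zero_of_le (by omega) hL
    simp only [hF]
    rw [hc, hd,
      show z ^ (2 * u) * c * (z ^ (2 * v) * d) = z ^ (2 * u) * z ^ (2 * v) * (c * d) by ring,
      this, zero_mul, mul_zero]
  have h1 : visitWeight τ (walkGF z n 0) = ∑ u ∈ Finset.range (L + 1), ∑ v ∈ Finset.range (L + 1),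
      F u v := by
    rw [visitWeight_walkGF hz hn hL hτ]
    have e : ∀ k ∈ Finset.range (L + 1), ∑ x ∈ Finset.HasAntidiagonal.antidiagonal k,
        (k.choose x.1 : R) * τ k * (halfLine z τ (L + 1) n x.1 * halfLine z τ (L + 1) n x.2) =
        ∑ u ∈ Finset.range (L + 1), ∑ v ∈ Finset.range (L + 1), if u + v = k then F u v else 0 := by
      intro k hk
      rw [sum_range_hankel (by simpa using hk)]
      refine Finset.sum_congr rfl fun x hx => ?_
      have : x.1 + x.2 = k := by simpa using hx
      simp only [hF, this]
    rw [Finset.sum_congr rfl e, Finset.sum_comm]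
    refine Finset.sum_congr rfl fun u _ => ?_
    rw [Finset.sum_comm]
    refine Finset.sum_congr rfl fun v _ => ?_
    rw [Finset.sum_ite_eq]
    split_ifs with h
    · rfl
    · exact (h0 u v (by simpa using h)).symm
  rw [h1, Finset.sum_range_succ', Finset.sum_range_succ' _ L]
  have e00 : F 0 0 = 1 := by simp [hF, hτ, halfLine_zero_right]
  have e0 : ∀ i, F 0 (i + 1) = τ (i + 1) * halfLine z τ (L + 1) n (i + 1) := by
    intro i; simp [hF, halfLine_zero_right]
  have e1 : ∀ i, F (i + 1) 0 = τ (i + 1) * halfLine z τ (L + 1) n (i + 1) := by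
    intro i; simp [hF, halfLine_zero_right]
  have e2 : ∀ i j, F (i + 1) (j + 1) = ((i + j + 2).choose (i + 1) : R) *
          τ (i + j + 2) * (halfLine z τ (L + 1) n (i + 1) * halfLine z τ (L + 1) n (j + 1)) := by
    intro i j
    simp only [hF, show i + 1 + (j + 1) = i + j + 2 by ring]
  simp only [Finset.sum_range_succ' _ L, Finset.sum_add_distrib, e00, e0, e1, e2, two_mul]
  ring

end ClosedWalks

/-! ### Matrices of power series without constant term -/

section SeriesMatrix

variable {ι : Type*} [Fintype ι] [DecidableEq ι]

theorem isUnit_one_sub_of_constantCoeff {M : Matrix ι ι ℂ⟦X⟧}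
    (hM : ∀ a b, PowerSeries.constantCoeff (M a b) = 0) : IsUnit (1 - M) := by
  rw [Matrix.isUnit_iff_isUnit_det, PowerSeries.isUnit_iff_constantCoeff, RingHom.map_det]
  have : (PowerSeries.constantCoeff (R := ℂ)).mapMatrix (1 - M) = 1 := by
    rw [map_sub, map_one, sub_eq_self]
    ext a b
    simpa using hM a b
  rw [this, Matrix.det_one]
  exact isUnit_one

theorem X_pow_dvd_pow_apply {M : Matrix ι ι ℂ⟦X⟧}
    (hM : ∀ a b, PowerSeries.constantCoeff (M a b) = 0) (m : ℕ) (a b : ι) :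
    PowerSeries.X ^ m ∣ (M ^ m) a b := by
  induction m generalizing a b with
  | zero => simp
  | succ m ih =>
    rw [pow_succ, pow_succ, Matrix.mul_apply]
    exact Finset.dvd_sum fun c _ => mul_dvd_mul (ih a c) (PowerSeries.X_dvd_iff.mpr (hM c b))

theorem inv_one_sub_apply {M : Matrix ι ι ℂ⟦X⟧}
    (hM : ∀ a b, PowerSeries.constantCoeff (M a b) = 0) (a b : ι) :
    (1 - M)⁻¹ a b = formalSum fun m => (M ^ m) a b := by
  have hu : IsUnit (1 - M).det :=
    (Matrix.isUnit_iff_isUnit_det _).mp (isUnit_one_sub_of_constantCoeff hM)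
  ext n
  rw [formalSum, PowerSeries.coeff_mk]
  have h1 : (1 - M)⁻¹ = ∑ m ∈ Finset.range (n + 1), M ^ m + (1 - M)⁻¹ * M ^ (n + 1) := by
    have h := mul_neg_geom_sum M (n + 1)
    have h2 : (1 - M)⁻¹ * ((1 - M) * ∑ m ∈ Finset.range (n + 1), M ^ m) =
        (1 - M)⁻¹ * (1 - M ^ (n + 1)) := by rw [h]
    rw [← Matrix.mul_assoc, Matrix.nonsing_inv_mul _ hu, one_mul, mul_sub, mul_one] at h2
    rw [h2, sub_add_cancel]
  have h3 : PowerSeries.coeff n (((1 - M)⁻¹ * M ^ (n + 1)) a b) = 0 := by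
    have : PowerSeries.X ^ (n + 1) ∣ ((1 - M)⁻¹ * M ^ (n + 1)) a b := by
      rw [Matrix.mul_apply]
      exact Finset.dvd_sum fun c _ => (X_pow_dvd_pow_apply hM (n + 1) c b).mul_left _
    exact PowerSeries.X_pow_dvd_iff.mp this n (Nat.lt_succ_self n)
  rw [h1, Matrix.add_apply, map_add, h3, add_zero, Matrix.sum_apply, map_sum]
  symm
  apply finsum_eq_sum_of_support_subset
  intro m hm
  rw [Function.mem_support] at hm
  by_contra h
  exact hm (PowerSeries.X_pow_dvd_iff.mp (X_pow_dvd_pow_apply hM m a b) n (by simpa using h))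

end SeriesMatrix

/-! ### Marking an edge with a derivation -/

section Derivative

open Matrix

variable {P ι : Type*} [CommRing P] [Algebra ℂ P] [Fintype ι]

/-- If the edge weights `D i` are eigenvectors of the derivation `θ` and the vertex weights are
constants, then `θ` of the sum over all profiles marks one of the edges. -/
theorem derivation_dotProduct (θ : Derivation ℂ P P) {D e r s u : ι → P} {V : Matrix ι ι P}
    (hV : Vᵀ = V) (hθe : ∀ i, θ (e i) = 0) (hθV : ∀ i j, θ (V i j) = 0)
    (hθD : ∀ i, θ (D i) = u i * D i) (hr : ∀ i, r i = D i * s i) (hs : s = e + V *ᵥ r) :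
    θ (e ⬝ᵥ r) = ∑ i, u i * (s i * r i) := by
  have h1 : ∀ i, θ (s i) = (V *ᵥ fun j => θ (r j)) i := by
    intro i
    rw [hs, Pi.add_apply, map_add, hθe, zero_add, mulVec, dotProduct, map_sum]
    refine Finset.sum_congr rfl fun j _ => ?_
    rw [Derivation.leibniz, hθV, smul_zero, add_zero, smul_eq_mul]
  have h2 : ∀ i, θ (r i) = u i * r i + D i * (V *ᵥ fun j => θ (r j)) i := by
    intro i
    have := congrArg θ (hr i)
    rw [Derivation.leibniz, hθD, h1, smul_eq_mul, smul_eq_mul] at this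
    rw [this, hr i]; ring
  have h3 : θ (e ⬝ᵥ r) = e ⬝ᵥ fun j => θ (r j) := by
    rw [dotProduct, map_sum]
    refine Finset.sum_congr rfl fun j _ => ?_
    rw [Derivation.leibniz, hθe, smul_zero, add_zero, smul_eq_mul]
  have h4 : (V *ᵥ r) ⬝ᵥ (fun j => θ (r j)) = r ⬝ᵥ (V *ᵥ fun j => θ (r j)) := by
    rw [dotProduct_mulVec, ← mulVec_transpose, hV]
  have h5 : s ⬝ᵥ (fun j => θ (r j)) =
      ∑ i, u i * (s i * r i) + r ⬝ᵥ (V *ᵥ fun j => θ (r j)) := by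
    rw [dotProduct, dotProduct, ← Finset.sum_add_distrib]
    refine Finset.sum_congr rfl fun i _ => ?_
    rw [h2 i, hr i]; ring
  rw [h3]
  have h6 : s ⬝ᵥ (fun j => θ (r j)) = e ⬝ᵥ (fun j => θ (r j)) + (V *ᵥ r) ⬝ᵥ fun j => θ (r j) := by
    conv_lhs => rw [hs]
    rw [add_dotProduct]
  linear_combination h5 - h6 - h4

end Derivative

/-! ### Half lines and the transfer equation -/

section HalfLine

open Nat

variable {R : Type*} [CommRing R] [Algebra ℂ R]

/-- A solution of the transfer equation on finitely many crossing numbers agrees with the weight of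
the half line up to terms of high order. -/
theorem pow_dvd_sub_halfLine {z y : R} (hzy : y * (1 - y) = z ^ 2) {τ : ℕ → R} {L : ℕ}
    {r : Fin L → R}
    (hr : ∀ i, r i = edgeWeight y i * (((i : ℕ)! : R) * τ (i + 1) +
      ∑ j : Fin L, ((i + j + 1 : ℕ)! : R) * τ (i + j + 2) * r j)) (M : ℕ) (i : Fin L) :
    z ^ (2 * M) ∣ r i - (((i + 1 : ℕ)! : ℂ)⁻¹) • halfLine z τ (L + 1) M (i + 1) := by
  induction M generalizing i with
  | zero => simp
  | succ M ih =>
    have h1 : (((i + 1 : ℕ)! : ℂ)⁻¹) • halfLine z τ (L + 1) (M + 1) (i + 1) =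
        edgeWeight y i * (((i : ℕ)! : R) * τ (i + 1) +
        ∑ j : Fin L, ((i + j + 1 : ℕ)! : R) * τ (i + j + 2) *
          ((((j + 1 : ℕ)! : ℂ)⁻¹) • halfLine z τ (L + 1) M (j + 1))) := by
      rw [halfLine, if_neg (Nat.succ_ne_zero _), Finset.sum_range_succ', edgeWeight, hzy, ← pow_mul,
        Fin.sum_univ_eq_sum_range (fun j => ((i + j + 1 : ℕ)! : R) * τ (i + j + 2) *
          ((((j + 1 : ℕ)! : ℂ)⁻¹) • halfLine z τ (L + 1) M (j + 1))), smul_mul_assoc,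
        ← mul_smul_comm, ← mul_smul_comm, smul_add, smul_add, Finset.smul_sum,
        Finset.smul_sum]
      refine congrArg _ ((add_comm _ _).trans (congrArg₂ (· + ·) ?_ ?_))
      · rw [halfLine_zero_right, Nat.add_sub_cancel, add_zero, Nat.choose_self, Nat.cast_one, one_mul,
          mul_one, cast_mul_eq_smul, smul_smul, add_zero]
        congr 1
        have := Nat.factorial_ne_zero (i : ℕ)
        field_simp
      · refine Finset.sum_congr rfl fun j _ => ?_
        rw [Nat.add_sub_cancel, mul_smul_comm, smul_smul, mul_assoc, mul_assoc,
          cast_mul_eq_smul, cast_mul_eq_smul (R := R),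
          show (i : ℕ) + 1 + (j + 1) = i + j + 2 by ring,
          show (i : ℕ) + (j + 1) = i + j + 1 by ring]
        simp only [smul_mul_assoc, smul_smul]
        congr 1
        have h := Nat.add_choose_mul_factorial_mul_factorial (j + 1) i
        rw [show j + 1 + (i : ℕ) = i + j + 1 by ring] at h
        rw [← h]
        push_cast
        have := Nat.factorial_ne_zero (i : ℕ)
        have := Nat.factorial_ne_zero (j + 1)
        field_simp
    rw [h1, hr i, ← mul_sub, add_sub_add_left_eq_sub, ← Finset.sum_sub_distrib,
      show 2 * (M + 1) = 2 + 2 * M by ring, pow_add]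
    refine mul_dvd_mul ?_ (Finset.dvd_sum fun j _ => ?_)
    · rw [edgeWeight, hzy, ← mul_one ((z ^ 2) ^ ((i : ℕ) + 1)), ← mul_smul_comm]
      exact (dvd_pow_self _ (Nat.succ_ne_zero _)).mul_right _
    · rw [← mul_sub]
      exact (ih j).mul_left _

/-- Summing over all profiles with a marked step is the same as summing over all closed walks from
`0` of positive length. -/
theorem sum_edge_mul_eq_visitWeight {z y : R} (hzy : y * (1 - y) = z ^ 2) {n : ℕ} (hz : z ^ n = 0)
    (hn : 0 < n) {τ : ℕ → R} (hτ : τ 0 = 1) {L : ℕ} (hL : z ^ (2 * (L + 1)) = 0) {r s : Fin L → R}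
    (hr : ∀ i, r i = edgeWeight y i * s i)
    (hs : ∀ i : Fin L, s i = ((i : ℕ)! : R) * τ (i + 1) +
      ∑ j : Fin L, ((i + j + 1 : ℕ)! : R) * τ (i + j + 2) * r j) :
    ∑ i : Fin L, (2 * ((i : ℕ) + 1) : R) * (s i * r i) = visitWeight τ (walkGF z n 0) - 1 := by
  have hr' : ∀ i : Fin L, r i = (((i + 1 : ℕ)! : ℂ)⁻¹) • halfLine z τ (L + 1) n (i + 1) := by
    intro i
    have h := pow_dvd_sub_halfLine hzy (τ := τ) (r := r) (fun i => by rw [hr i, hs i]) n i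
    rw [mul_comm 2 n, pow_mul, hz, zero_pow two_ne_zero, zero_dvd_iff] at h
    exact sub_eq_zero.mp h
  rw [visitWeight_walkGF_eq_sum_range hz hn hL hτ, add_sub_cancel_left]
  have h1 : ∀ i : Fin L, (2 * ((i : ℕ) + 1) : R) * (s i * r i) =
      2 * (τ (i + 1) * halfLine z τ (L + 1) n (i + 1)) +
      ∑ j : Fin L, (2 * ((i : ℕ) + 1) : R) * (((i + j + 1 : ℕ)! : R) * τ (i + j + 2) *
        (r i * r j)) := by
    intro i
    rw [hs i, add_mul, mul_add, Finset.sum_mul, Finset.mul_sum]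
    congr 1
    · rw [hr' i, mul_smul_comm, mul_smul_comm,
        show (2 * ((i : ℕ) + 1) : R) * (((i : ℕ)! : R) * τ (i + 1) *
          halfLine z τ (L + 1) n (i + 1)) = (((i + 1 : ℕ)!) : R) *
          (2 * (τ (i + 1) * halfLine z τ (L + 1) n (i + 1))) by
          rw [Nat.factorial_succ]; push_cast; ring,
        cast_mul_eq_smul, smul_smul, inv_mul_cancel₀ (by exact_mod_cast Nat.factorial_ne_zero _),
        one_smul]
    · exact Finset.sum_congr rfl fun j _ => by ring
  have h2 : ∑ i : Fin L, ∑ j : Fin L, (2 * ((i : ℕ) + 1) : R) *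
      (((i + j + 1 : ℕ)! : R) * τ (i + j + 2) * (r i * r j)) =
      ∑ i : Fin L, ∑ j : Fin L, ((i + j + 2 : ℕ)! : R) * τ (i + j + 2) * (r i * r j) := by
    set F : Fin L → Fin L → R := fun i j => (((i : ℕ) + 1) : R) *
      (((i + j + 1 : ℕ)! : R) * τ (i + j + 2) * (r i * r j)) with hF
    have e1 : ∑ i : Fin L, ∑ j : Fin L, F i j = ∑ i : Fin L, ∑ j : Fin L, F j i := Finset.sum_comm
    have e2 : ∀ i j : Fin L, (2 * ((i : ℕ) + 1) : R) *
        (((i + j + 1 : ℕ)! : R) * τ (i + j + 2) * (r i * r j)) = F i j + F i j := by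
      intro i j; simp only [hF]; ring
    have e3 : ∀ i j : Fin L, ((i + j + 2 : ℕ)! : R) * τ (i + j + 2) * (r i * r j) =
        F i j + F j i := by
      intro i j
      simp only [hF, Nat.factorial_succ (i + j + 1 : ℕ), add_comm (j : ℕ) i]
      push_cast
      ring
    simp only [e2, e3, Finset.sum_add_distrib]
    rw [← e1]
  rw [Finset.sum_congr rfl fun i _ => h1 i, Finset.sum_add_distrib, h2]
  congr 1
  · rw [Fin.sum_univ_eq_sum_range (fun i => 2 * (τ (i + 1) * halfLine z τ (L + 1) n (i + 1)))]
  · rw [← Fin.sum_univ_eq_sum_range (fun i => ∑ j ∈ Finset.range L, ((i + j + 2).choose (i + 1) : R) *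
          τ (i + j + 2) * (halfLine z τ (L + 1) n (i + 1) * halfLine z τ (L + 1) n (j + 1)))]
    refine Finset.sum_congr rfl fun i _ => ?_
    rw [← Fin.sum_univ_eq_sum_range (fun j => ((i + j + 2 : ℕ).choose (i + 1) : R) *
          τ (i + j + 2) * (halfLine z τ (L + 1) n (i + 1) * halfLine z τ (L + 1) n (j + 1)))]
    refine Finset.sum_congr rfl fun j _ => ?_
    rw [hr' i, hr' j, smul_mul_smul_comm, mul_smul_comm, mul_assoc, mul_assoc, cast_mul_eq_smul,
      cast_mul_eq_smul, smul_smul]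
    congr 1
    have h := Nat.add_choose_mul_factorial_mul_factorial (j + 1 : ℕ) (i + 1)
    rw [show (j : ℕ) + 1 + (i + 1) = i + j + 2 by ring] at h
    rw [← h]
    push_cast
    have := Nat.factorial_ne_zero ((i : ℕ) + 1)
    have := Nat.factorial_ne_zero ((j : ℕ) + 1)
    field_simp

end HalfLine

/-! ### Power series modulo `z ^ (2 N + 1)` -/

section Trunc

/-- Power series modulo terms of degree greater than `2 N`. -/
abbrev TruncRing (N : ℕ) : Type := ℂ⟦X⟧ ⧸ Ideal.span {(PowerSeries.X : ℂ⟦X⟧) ^ (2 * N + 1)}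

/-- The quotient map to the truncated power series. -/
noncomputable def toTrunc (N : ℕ) : ℂ⟦X⟧ →ₐ[ℂ] TruncRing N := Ideal.Quotient.mkₐ ℂ _

theorem toTrunc_eq_iff {N : ℕ} {f g : ℂ⟦X⟧} :
    toTrunc N f = toTrunc N g ↔ ∀ n ≤ 2 * N, PowerSeries.coeff n f = PowerSeries.coeff n g := by
  have h : toTrunc N f = toTrunc N g ↔ (PowerSeries.X : ℂ⟦X⟧) ^ (2 * N + 1) ∣ f - g :=
    Ideal.Quotient.eq.trans Ideal.mem_span_singleton
  rw [h, PowerSeries.X_pow_dvd_iff]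
  simp only [Nat.lt_succ_iff, map_sub, sub_eq_zero]

theorem toTrunc_eq_zero_of_dvd {N m : ℕ} (hm : 2 * N < m) {f : ℂ⟦X⟧}
    (h : (PowerSeries.X : ℂ⟦X⟧) ^ m ∣ f) : toTrunc N f = 0 := by
  rw [← map_zero (toTrunc N), toTrunc_eq_iff]
  intro n hn
  rw [map_zero]
  exact PowerSeries.X_pow_dvd_iff.mp h n (by omega)

theorem coeff_proj (m n : ℕ) (g : ℂ⟦X⟧) :
    PowerSeries.coeff n (proj m g) = if n ≤ m then PowerSeries.coeff n g else 0 := by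
  rw [proj, Polynomial.coeff_coe, PowerSeries.coeff_trunc]
  simp only [Nat.lt_succ_iff]

theorem toTrunc_proj (N : ℕ) (g : ℂ⟦X⟧) : toTrunc N (proj (2 * N) g) = toTrunc N g := by
  rw [toTrunc_eq_iff]
  intro n hn
  rw [coeff_proj, if_pos hn]

theorem proj_eq_zero {N : ℕ} {g : ℂ⟦X⟧} (h : toTrunc N g = 0) : proj (2 * N) g = 0 := by
  rw [← map_zero (toTrunc N), toTrunc_eq_iff] at h
  ext n
  rw [coeff_proj]
  split_ifs with hn
  · exact h n hn
  · simp

theorem toTrunc_formalSum {N : ℕ} {a : ℕ → ℂ⟦X⟧}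
    (ha : ∀ f, (PowerSeries.X : ℂ⟦X⟧) ^ (2 * f) ∣ a f) :
    toTrunc N (formalSum a) = ∑ f ∈ Finset.range (N + 1), toTrunc N (a f) := by
  rw [← map_sum, toTrunc_eq_iff]
  intro n hn
  rw [formalSum, PowerSeries.coeff_mk, map_sum]
  apply finsum_eq_sum_of_support_subset
  intro f hf
  rw [Function.mem_support] at hf
  by_contra h
  refine hf (PowerSeries.X_pow_dvd_iff.mp (ha f) n ?_)
  have : N < f := by simpa using h
  omega

end Trunc

/-! ### The series `A`, `B`, `G` and `H` -/

section Series

/-- The generating function `(1 - A) / 2` of the excursions to one side. -/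
noncomputable def halfExc : ℂ⟦X⟧ := (1 / 2 : ℂ) • (1 - A)

theorem one_sub_A : 1 - A = 2 * halfExc := by
  rw [halfExc, mul_smul_comm, ← smul_mul_assoc, show (2 : ℂ⟦X⟧) = (2 : ℂ) • 1 by
    rw [Algebra.smul_def, mul_one]; exact (map_ofNat (algebraMap ℂ ℂ⟦X⟧) 2).symm, smul_smul]
  norm_num

theorem A_eq : A = 1 - 2 * halfExc := by rw [← one_sub_A]; ring

theorem constantCoeff_halfExc : PowerSeries.constantCoeff halfExc = 0 := by
  rw [halfExc, ← PowerSeries.coeff_zero_eq_constantCoeff_apply, PowerSeries.coeff_smul, map_sub,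
    PowerSeries.coeff_zero_eq_constantCoeff_apply, PowerSeries.coeff_zero_eq_constantCoeff_apply,
    constantCoeff_A]
  simp

theorem halfExc_mul_one_sub : halfExc * (1 - halfExc) = PowerSeries.X ^ 2 := by
  have h := A_sq
  rw [A_eq] at h
  have h4 : (4 : ℂ⟦X⟧) * (halfExc * (1 - halfExc)) = 4 * PowerSeries.X ^ 2 := by
    linear_combination -h
  have h0 : (4 : ℂ⟦X⟧) ≠ 0 := by
    intro h
    have := congrArg (PowerSeries.constantCoeff (R := ℂ)) h
    rw [map_ofNat, map_zero] at this
    norm_num at this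
  exact mul_left_cancel₀ h0 h4

theorem one_sub_halfExc_mul_inv : (1 - halfExc) * (1 - halfExc)⁻¹ = 1 :=
  PowerSeries.mul_inv_cancel _ (by rw [map_sub, map_one, constantCoeff_halfExc]; simp)

theorem X_sq_dvd_halfExc : (PowerSeries.X : ℂ⟦X⟧) ^ 2 ∣ halfExc := by
  refine ⟨(1 - halfExc)⁻¹, ?_⟩
  rw [← halfExc_mul_one_sub, mul_assoc, one_sub_halfExc_mul_inv, mul_one]

theorem B_eq : B = PowerSeries.X * (1 - halfExc)⁻¹ := by
  have h1 : (1 + A) * (1 + A)⁻¹ = 1 :=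
    PowerSeries.mul_inv_cancel _ (by
      rw [map_add, map_one, constantCoeff_A]; norm_num)
  have h2 : 1 + A = 2 * (1 - halfExc) := by rw [A_eq]; ring
  rw [B]
  rw [h2] at h1 ⊢
  linear_combination (PowerSeries.X * (1 - halfExc)⁻¹) * h1 -
    (2 * PowerSeries.X * (2 * (1 - halfExc))⁻¹) * one_sub_halfExc_mul_inv

theorem B_sq : B ^ 2 = halfExc * (1 - halfExc)⁻¹ := by
  rw [B_eq, mul_pow, ← halfExc_mul_one_sub]
  linear_combination (halfExc * (1 - halfExc)⁻¹) * one_sub_halfExc_mul_inv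

theorem X_pow_dvd_lambert (f : ℕ) : (PowerSeries.X : ℂ⟦X⟧) ^ (2 * f) ∣ lambert f := by
  rw [lambert, B_eq, mul_pow, mul_assoc]
  exact dvd_mul_right _ _

theorem lambert_eq {f : ℕ} (hf : 0 < f) : lambert f = (B ^ 2) ^ f + (B ^ 2) ^ f * lambert f := by
  have h : (1 - B ^ (2 * f)) * (1 - B ^ (2 * f))⁻¹ = 1 :=
    PowerSeries.mul_inv_cancel _ (by
      rw [map_sub, map_one, map_pow, B_eq, map_mul, PowerSeries.constantCoeff_X, zero_mul,
        zero_pow (by omega)]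
      simp)
  rw [← pow_mul, lambert]
  linear_combination (B ^ (2 * f)) * h

variable (N : ℕ)

/-- The excursion series modulo `z ^ (2 N + 1)`. -/
noncomputable def yT : TruncRing N := toTrunc N halfExc

/-- The inverse of `1 - yT`. -/
noncomputable def aT : TruncRing N := toTrunc N (1 - halfExc)⁻¹

/-- The Lambert series modulo `z ^ (2 N + 1)`. -/
noncomputable def lamT (f : ℕ) : TruncRing N := toTrunc N (lambert f)

/-- The variable `z` modulo `z ^ (2 N + 1)`. -/
noncomputable def zT : TruncRing N := toTrunc N PowerSeries.X

theorem aT_mul : aT N * (1 - yT N) = 1 := by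
  rw [aT, yT, ← map_one (toTrunc N), ← map_sub, ← map_mul,
    mul_comm (1 - halfExc)⁻¹, one_sub_halfExc_mul_inv]

theorem yT_pow : yT N ^ (N + 1) = 0 := by
  rw [yT, ← map_pow]
  refine toTrunc_eq_zero_of_dvd (m := 2 * (N + 1)) (by omega) ?_
  rw [pow_mul]
  exact pow_dvd_pow_of_dvd X_sq_dvd_halfExc _

theorem zT_pow : zT N ^ (2 * N + 1) = 0 := by
  rw [zT, ← map_pow]
  exact toTrunc_eq_zero_of_dvd (m := 2 * N + 1) (by omega) dvd_rfl

theorem yT_mul_one_sub : yT N * (1 - yT N) = zT N ^ 2 := by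
  rw [yT, zT, ← map_one (toTrunc N), ← map_sub, ← map_mul, ← map_pow, halfExc_mul_one_sub]

theorem toTrunc_A : toTrunc N A = 1 - 2 * yT N := by
  rw [A_eq, map_sub, map_one, map_mul, map_ofNat, yT]

theorem toTrunc_one_sub_A : toTrunc N (1 - A) = 2 * yT N := by
  rw [one_sub_A, map_mul, map_ofNat, yT]

theorem lamT_eq (f : ℕ) (hf : 0 < f) :
    lamT N f = (yT N * aT N) ^ f + (yT N * aT N) ^ f * lamT N f := by
  have : yT N * aT N = toTrunc N (B ^ 2) := by rw [yT, aT, ← map_mul, B_sq]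
  rw [this, lamT, ← map_pow, ← map_mul, ← map_add, ← lambert_eq hf]

theorem toTrunc_G (p q : ℕ) : toTrunc N (G N (p + 1) (q + 1)) = gCoeff (yT N) (lamT N) N p q := by
  rw [G, toTrunc_proj, map_mul, toTrunc_formalSum]
  · rw [map_mul, map_pow, map_pow, toTrunc_A, map_neg, map_one, gCoeff,
      neg_pow (1 - 2 * yT N), show p + 1 + (q + 1) = p + q + 2 by ring]
    congr 1
    refine Finset.sum_congr rfl fun f _ => ?_
    split_ifs with h
    · rw [map_smul, lamT]
    · have : f < p + 1 ∨ f < q + 1 := by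
        rcases lt_max_iff.mp (not_le.mp h) with h | h
        · exact Or.inl h
        · exact Or.inr h
      rcases this with h | h <;> simp [Nat.choose_eq_zero_of_lt h]
  · intro f
    split_ifs
    · exact (X_pow_dvd_lambert f).trans ⟨_, (Algebra.smul_def _ _).trans (mul_comm _ _)⟩
    · exact dvd_zero _

theorem toTrunc_H (t s : ℕ) :
    toTrunc N (H N (t + 1) (s + 2 * t + 2)) = hCoeff (yT N) (lamT N) N t s := by
  rw [H, toTrunc_proj, map_mul, toTrunc_formalSum]
  · rw [map_pow, toTrunc_A, hCoeff]
    congr 1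
    refine Finset.sum_congr rfl fun f _ => ?_
    split_ifs with h
    · rw [map_smul, lamT]
      rfl
    · rw [Nat.choose_eq_zero_of_lt (by omega)]; simp
  · intro f
    split_ifs
    · exact (X_pow_dvd_lambert f).trans ⟨_, (Algebra.smul_def _ _).trans (mul_comm _ _)⟩
    · exact dvd_zero _

theorem constantCoeff_H {i j : ℕ} (hij : i < j) : PowerSeries.constantCoeff (H N i j) = 0 := by
  rw [H, ← PowerSeries.coeff_zero_eq_constantCoeff_apply, coeff_proj, if_pos (Nat.zero_le _),
    PowerSeries.coeff_zero_eq_constantCoeff_apply, map_mul]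
  have : PowerSeries.constantCoeff (formalSum fun f =>
      if j - i ≤ f then ((f + i - 1).choose (j - 1) : ℂ) • lambert f else 0) = 0 := by
    rw [← PowerSeries.coeff_zero_eq_constantCoeff_apply, formalSum, PowerSeries.coeff_mk]
    apply finsum_eq_zero_of_forall_eq_zero
    intro f
    split_ifs with h
    · rw [PowerSeries.coeff_smul, PowerSeries.X_pow_dvd_iff.mp (X_pow_dvd_lambert f) 0 (by omega),
        smul_zero]
    · simp
  rw [this, mul_zero]

end Series

/-! ### The terms of the generating function modulo `z ^ (2 N + 1)` -/

section Terms

variable (N : ℕ)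

theorem sum_range_reflect_of_eq_zero {M : Type*} [AddCommMonoid M] {κ n : ℕ} (F : ℕ → M)
    (hn : ∀ p, n ≤ p → F p = 0) (hκ : ∀ p, κ < p → F p = 0) :
    ∑ l ∈ Finset.range (κ + 1), F (κ - l) = ∑ p ∈ Finset.range n, F p := by
  have h1 : ∑ l ∈ Finset.range (κ + 1), F (κ - l) = ∑ p ∈ Finset.range (κ + 1), F p := by
    rw [← Finset.sum_range_reflect F (κ + 1)]
    exact Finset.sum_congr rfl fun l _ => by rw [Nat.add_sub_cancel]
  rw [h1]
  rcases le_total (κ + 1) n with h | h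
  · exact Finset.sum_subset (by intro x; simp; omega) fun p _ hp => hκ p (by simp at hp; omega)
  · exact (Finset.sum_subset (by intro x; simp; omega) fun p _ hp => hn p (by simpa using hp)).symm

theorem toTrunc_T1 (κ : ℕ) :
    toTrunc N (T1 N (κ + 1)) = (1 / ((κ : ℂ) + 1)) • (2 * yT N) ^ (κ + 1) := by
  rw [T1, toTrunc_proj, map_smul, map_pow, toTrunc_one_sub_A]
  push_cast
  rfl

theorem toTrunc_T2 (κ κ' : ℕ) :
    toTrunc N (T2 N (κ + 1) (κ' + 1)) = twoMarked (yT N) (lamT N) N κ κ' := by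
  have h1 : toTrunc N (T2 N (κ + 1) (κ' + 1)) = ∑ l₁ ∈ Finset.range (κ + 1),
      ∑ l₂ ∈ Finset.range (κ' + 1), ((κ.choose (κ - l₁) : ℂ) * (κ'.choose (κ' - l₂) : ℂ)) •
        ((2 * yT N) ^ (κ - (κ - l₁) + (κ' - (κ' - l₂))) *
          gCoeff (yT N) (lamT N) N (κ - l₁) (κ' - l₂)) := by
    rw [T2, toTrunc_proj, map_sum]
    refine Finset.sum_congr rfl fun l₁ h₁ => ?_
    rw [map_sum]
    refine Finset.sum_congr rfl fun l₂ h₂ => ?_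
    have h₁' : l₁ ≤ κ := by simpa [Nat.lt_succ_iff] using h₁
    have h₂' : l₂ ≤ κ' := by simpa [Nat.lt_succ_iff] using h₂
    rw [map_smul, map_mul, map_pow, toTrunc_one_sub_A, Nat.choose_symm h₁', Nat.choose_symm h₂',
      Nat.sub_sub_self h₁', Nat.sub_sub_self h₂', show κ + 1 - l₁ = κ - l₁ + 1 by omega,
      show κ' + 1 - l₂ = κ' - l₂ + 1 by omega, toTrunc_G]
    rfl
  rw [h1, twoMarked, ← sum_range_reflect_of_eq_zero (κ := κ) (n := N) (fun p =>
    ∑ q ∈ Finset.range N, ((κ.choose p : ℂ) * (κ'.choose q : ℂ)) •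
    ((2 * yT N) ^ (κ - p + (κ' - q)) * gCoeff (yT N) (lamT N) N p q))]
  · refine Finset.sum_congr rfl fun l _ => ?_
    rw [← sum_range_reflect_of_eq_zero (κ := κ') (n := N) (fun q =>
      ((κ.choose (κ - l) : ℂ) * (κ'.choose q : ℂ)) •
      ((2 * yT N) ^ (κ - (κ - l) + (κ' - q)) * gCoeff (yT N) (lamT N) N (κ - l) q))]
    · intro q hq; rw [gCoeff_eq_zero_right _ _ _ hq, mul_zero, smul_zero]
    · intro q hq; rw [Nat.choose_eq_zero_of_lt hq]; simp
  · intro p hp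
    refine Finset.sum_eq_zero fun q _ => ?_
    rw [gCoeff_eq_zero_left _ _ hp, mul_zero, smul_zero]
  · intro p hp
    refine Finset.sum_eq_zero fun q _ => ?_
    rw [Nat.choose_eq_zero_of_lt hp]; simp

theorem toTrunc_Psi (κ : ℕ) (a : Idx N) :
    toTrunc N (Psi N (κ + 1) a) = psiEntry (yT N) (lamT N) N κ a.1 a.2 := by
  simp only [Psi]
  rw [toTrunc_proj, psiEntry]
  split_ifs with h
  · rw [map_mul, map_pow, map_neg, map_one, map_sum]
    congr 1
    rw [← sum_range_reflect_of_eq_zero (κ := κ) (n := N) (fun p => (κ.choose p : ℂ) •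
      ((2 * yT N) ^ (κ - p) * gCoeff (yT N) (lamT N) N a.1 p))]
    · refine Finset.sum_congr rfl fun l hl => ?_
      have hl' : l ≤ κ := by simpa [Nat.lt_succ_iff] using hl
      rw [map_smul, map_mul, map_pow, toTrunc_one_sub_A, Nat.choose_symm hl', Nat.sub_sub_self hl',
        show κ + 1 - l = κ - l + 1 by omega, toTrunc_G]
      rfl
    · intro p hp; rw [gCoeff_eq_zero_right _ _ _ hp, mul_zero, smul_zero]
    · intro p hp; rw [Nat.choose_eq_zero_of_lt hp]; simp
  · exact map_zero _

theorem toTrunc_Phi (κ κ' : ℕ) (a : Idx N) :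
    toTrunc N (Phi N (κ + 1) (κ' + 1) a) = phiEntry (yT N) (lamT N) N κ κ' a.1 a.2 := by
  simp only [Phi]
  rw [toTrunc_proj, phiEntry]
  by_cases h : (a.1 : ℕ) + a.2 + 1 ≤ κ
  · rw [if_pos h, if_pos (by omega), map_smul,
      show κ + 1 - 1 - (a.1 : ℕ) - a.2 = (κ - 1 - a.1 - a.2) + 1 by omega, toTrunc_T2,
      show κ + 1 - 2 - (a.1 : ℕ) - a.2 = κ - 1 - a.1 - a.2 by omega, Nat.add_sub_cancel]
  · rw [if_neg h, if_neg (by omega), map_zero]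

theorem toTrunc_Q (κ : ℕ) (a b : Idx N) :
    toTrunc N (Q N (κ + 1) a b) = qEntry (yT N) (lamT N) N κ a.1 a.2 b.1 b.2 := by
  simp only [Q]
  rw [toTrunc_proj, qEntry]
  by_cases h : (a.1 : ℕ) + a.2 + b.2 + 1 ≤ κ
  · have hF : ∀ m n : ℕ, ∀ F : ℕ → TruncRing N, (∀ e, m ≤ e → F e = 0) → (∀ e, n ≤ e → F e = 0) →
        ∑ e ∈ Finset.range m, F e = ∑ e ∈ Finset.range n, F e := by
      intro m n F hm hn
      rcases le_total m n with hmn | hmn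
      · exact Finset.sum_subset (by intro x; simp; omega) fun e _ he => hm e (by simpa using he)
      · exact (Finset.sum_subset (by intro x; simp; omega)
          fun e _ he => hn e (by simpa using he)).symm
    rw [if_pos (by omega), if_neg (by omega), map_smul, map_sum, Finset.smul_sum]
    refine Eq.trans ?_ (hF (κ + 1 - 2 - a.1 - a.2 - b.2 + 1) N _ ?_ ?_)
    · refine Finset.sum_congr rfl fun e he => ?_
      have he' : e ≤ κ - 1 - a.1 - a.2 - b.2 := by simp at he; omega
      rw [map_smul, map_mul, map_pow, toTrunc_one_sub_A,
        show (b.1 : ℕ) + e + 2 * b.2 + 2 = e + b.1 + 2 * b.2 + 2 by ring, toTrunc_H, divPow,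
        if_pos (by omega), smul_mul_assoc, smul_smul, smul_smul,
        show κ - 1 - ((a.2 : ℕ) + a.1 + (b.2 + e)) = κ + 1 - 2 - a.1 - a.2 - b.2 - e by omega,
        Nat.add_sub_cancel]
      congr 1
      field_simp
    · intro e he
      rw [divPow_of_lt _ (by omega), zero_mul, smul_zero]
    · intro e he
      rw [hCoeff_eq_zero _ _ (by omega), mul_zero, smul_zero]
  · rw [if_neg (by omega), map_zero]
    split_ifs with h0
    · rfl
    · symm
      refine Finset.sum_eq_zero fun e _ => ?_
      rw [divPow_of_lt _ (by omega), zero_mul, smul_zero]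

/-! ### Vanishing for large numbers of visits -/

theorem two_mul_yT_pow_eq_zero {m : ℕ} (hm : N < m) : (2 * yT N) ^ m = 0 := by
  rw [mul_pow, pow_eq_zero_of_le hm (yT_pow N), mul_zero]

theorem twoMarked_eq_zero {κ κ' : ℕ} (h : 2 * N ≤ κ ∨ 2 * N ≤ κ') :
    twoMarked (yT N) (lamT N) N κ κ' = 0 := by
  refine Finset.sum_eq_zero fun p hp => Finset.sum_eq_zero fun q hq => ?_
  simp only [Finset.mem_range] at hp hq
  rw [two_mul_yT_pow_eq_zero N (by omega), zero_mul, smul_zero]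

theorem T1_eq_zero {κ : ℕ} (h : N ≤ κ) : T1 N (κ + 1) = 0 := by
  rw [T1]
  apply proj_eq_zero
  rw [map_smul, map_pow, toTrunc_one_sub_A, two_mul_yT_pow_eq_zero N (by omega), smul_zero]

theorem T2_eq_zero {κ κ' : ℕ} (h : 2 * N ≤ κ ∨ 2 * N ≤ κ') : T2 N (κ + 1) (κ' + 1) = 0 := by
  have := toTrunc_T2 N κ κ'
  rw [T2, toTrunc_proj, twoMarked_eq_zero N h] at this
  rw [T2]
  exact proj_eq_zero this

theorem Psi_eq_zero {κ : ℕ} (h : 2 * N ≤ κ) : Psi N (κ + 1) = 0 := by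
  funext a
  have := toTrunc_Psi N κ a
  simp only [Psi] at this ⊢
  rw [toTrunc_proj] at this
  refine proj_eq_zero (this.trans ?_)
  rw [psiEntry]
  split_ifs
  · rw [Finset.sum_eq_zero, mul_zero]
    intro p hp
    simp only [Finset.mem_range] at hp
    rw [two_mul_yT_pow_eq_zero N (by omega), zero_mul, smul_zero]
  · rfl

theorem Phi_eq_zero {κ κ' : ℕ} (h : 4 * N ≤ κ ∨ 2 * N ≤ κ') : Phi N (κ + 1) (κ' + 1) = 0 := by
  funext a
  have := toTrunc_Phi N κ κ' a
  simp only [Phi] at this ⊢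
  rw [toTrunc_proj] at this
  refine proj_eq_zero (this.trans ?_)
  rw [phiEntry]
  split_ifs
  · rw [twoMarked_eq_zero N (by omega), smul_zero]
  · rfl

theorem Q_eq_zero {κ : ℕ} (h : 4 * N ≤ κ) : Q N (κ + 1) = 0 := by
  funext a b
  have := toTrunc_Q N κ a b
  simp only [Q] at this ⊢
  rw [toTrunc_proj] at this
  refine proj_eq_zero (this.trans ?_)
  rw [qEntry]
  split_ifs
  · rfl
  · refine Finset.sum_eq_zero fun e _ => ?_
    by_cases he : N ≤ e + b.1 + b.2
    · rw [hCoeff_eq_zero _ _ he, mul_zero, smul_zero]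
    · rw [divPow]
      split_ifs
      · rw [two_mul_yT_pow_eq_zero N (by omega), smul_zero, zero_mul, smul_zero]
      · rw [zero_mul, smul_zero]

theorem constantCoeff_Q (k : ℕ) (a b : Idx N) : PowerSeries.constantCoeff (Q N k a b) = 0 := by
  simp only [Q]
  rw [← PowerSeries.coeff_zero_eq_constantCoeff_apply, coeff_proj, if_pos (Nat.zero_le _)]
  split_ifs
  · rw [PowerSeries.coeff_smul, map_sum, Finset.sum_eq_zero, smul_zero]
    intro e _
    rw [PowerSeries.coeff_smul, PowerSeries.coeff_zero_eq_constantCoeff_apply, map_mul,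
      constantCoeff_H N (by omega), mul_zero, smul_zero]
  · simp

/-- The logarithm `log (1 / (1 - y))` is the truncated sum of the `y ^ i / i`. -/
theorem toTrunc_T0 {L : ℕ} (hL : N ≤ L) : toTrunc N (T0 N) =
    ∑ i ∈ Finset.range L, (1 / ((i : ℂ) + 1)) • yT N ^ (i + 1) := by
  set y := halfExc with hy
  have hinv : (2 : ℂ⟦X⟧) * (1 + A)⁻¹ = (1 - y)⁻¹ := by
    have h1 : (1 + A) * (1 + A)⁻¹ = 1 :=
      PowerSeries.mul_inv_cancel _ (by rw [map_add, map_one, constantCoeff_A]; norm_num)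
    have h2 : 1 + A = 2 * (1 - y) := by rw [A_eq]; ring
    have h3 := one_sub_halfExc_mul_inv
    rw [h2] at h1 ⊢
    linear_combination (1 - y)⁻¹ * h1 - (2 * (2 * (1 - y))⁻¹) * h3
  have hcc : PowerSeries.constantCoeff ((1 - y)⁻¹) = 1 := by
    rw [PowerSeries.constantCoeff_inv, map_sub, map_one, constantCoeff_halfExc]; simp
  set g := (1 - y)⁻¹ with hg
  set S : ℂ⟦X⟧ := ∑ i ∈ Finset.range L, (1 / ((i : ℂ) + 1)) • y ^ (i + 1) with hS
  have hsub : PowerSeries.HasSubst (g - 1) :=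
    PowerSeries.HasSubst.of_constantCoeff_zero' (by rw [map_sub, hcc, map_one, sub_self])
  have hgy : (1 - y) * g = 1 := one_sub_halfExc_mul_inv
  have hdg : PowerSeries.derivative ℂ g = g ^ 2 * PowerSeries.derivative ℂ y := by
    have h := congrArg (PowerSeries.derivative ℂ) hgy
    rw [Derivation.leibniz, map_sub, Derivation.map_one_eq_zero, smul_eq_mul, smul_eq_mul] at h
    linear_combination g * h - (PowerSeries.derivative ℂ g) * hgy
  have hdlog : PowerSeries.derivative ℂ (PowerSeries.logOf g) = g * PowerSeries.derivative ℂ y := by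
    rw [PowerSeries.logOf_eq, PowerSeries.derivative_subst hsub, map_sub,
      Derivation.map_one_eq_zero, sub_zero, hdg]
    have h1 : PowerSeries.derivative ℂ (PowerSeries.log ℂ) * (1 + PowerSeries.X) = 1 := by
      rw [PowerSeries.deriv_log]
      ext n
      cases n with
      | zero => simp [mul_add]
      | succ n =>
        rw [mul_add, map_add, mul_one, PowerSeries.coeff_mk, PowerSeries.coeff_succ_mul_X,
          PowerSeries.coeff_mk, PowerSeries.coeff_one, if_neg (Nat.succ_ne_zero n), pow_succ]
        simp
    have h2 : (PowerSeries.derivative ℂ (PowerSeries.log ℂ)).subst (g - 1) * g = 1 := by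
      have h := congrArg (PowerSeries.subst (g - 1)) h1
      have h3 : PowerSeries.subst (g - 1) (1 : ℂ⟦X⟧) = 1 := by
        rw [← PowerSeries.coe_substAlgHom hsub, map_one]
      rw [PowerSeries.subst_mul hsub, PowerSeries.subst_add hsub, h3,
        PowerSeries.subst_X hsub, add_sub_cancel] at h
      exact h
    linear_combination (g * PowerSeries.derivative ℂ y) * h2
  have hdS : PowerSeries.derivative ℂ S = g * (1 - y ^ L) * PowerSeries.derivative ℂ y := by
    have h1 : PowerSeries.derivative ℂ S =
        (∑ i ∈ Finset.range L, y ^ i) * PowerSeries.derivative ℂ y := by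
      rw [hS, map_sum, Finset.sum_mul]
      refine Finset.sum_congr rfl fun i _ => ?_
      have hi : (i : ℂ) + 1 ≠ 0 := by exact_mod_cast Nat.succ_ne_zero i
      rw [Derivation.map_smul, PowerSeries.derivative_pow, Nat.add_sub_cancel, mul_assoc,
        cast_mul_eq_smul, smul_smul]
      push_cast
      rw [one_div, inv_mul_cancel₀ hi, one_smul]
    have h2 := mul_neg_geom_sum y L
    rw [h1]
    linear_combination (-(∑ i ∈ Finset.range L, y ^ i) * PowerSeries.derivative ℂ y) * hgy +
      g * PowerSeries.derivative ℂ y * h2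
  -- both sides have constant term `0`, so it suffices to compare the derivatives
  have hmain : toTrunc N (PowerSeries.logOf g) = toTrunc N S := by
    rw [toTrunc_eq_iff]
    intro n hn
    cases n with
    | zero =>
      rw [PowerSeries.coeff_zero_eq_constantCoeff_apply, PowerSeries.constantCoeff_logOf hcc,
        PowerSeries.coeff_zero_eq_constantCoeff_apply, hS, map_sum, Finset.sum_eq_zero]
      intro i _
      rw [← PowerSeries.coeff_zero_eq_constantCoeff_apply, PowerSeries.coeff_smul,
        PowerSeries.coeff_zero_eq_constantCoeff_apply, map_pow, constantCoeff_halfExc]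
      simp
    | succ n =>
      have h1 : (PowerSeries.X : ℂ⟦X⟧) ^ (2 * L) ∣ PowerSeries.derivative ℂ (PowerSeries.logOf g) -
          PowerSeries.derivative ℂ S := by
        rw [hdlog, hdS, show g * PowerSeries.derivative ℂ y -
          g * (1 - y ^ L) * PowerSeries.derivative ℂ y =
            y ^ L * (g * PowerSeries.derivative ℂ y) by ring,
          pow_mul]
        exact (pow_dvd_pow_of_dvd X_sq_dvd_halfExc L).mul_right _
      have h2 := PowerSeries.X_pow_dvd_iff.mp h1 n (by omega)
      rw [map_sub, PowerSeries.coeff_derivative, PowerSeries.coeff_derivative, ← sub_mul] at h2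
      have h3 : (n : ℂ) + 1 ≠ 0 := by exact_mod_cast Nat.succ_ne_zero n
      exact sub_eq_zero.mp ((mul_eq_zero.mp h2).resolve_right h3)
  rw [T0, toTrunc_proj, hinv, hmain, hS, map_sum]
  refine Finset.sum_congr rfl fun i _ => ?_
  rw [map_smul, map_pow, yT]

end Terms

/-! ### The expansion in the marked sites -/

section Expansion

open Nat Matrix

variable {R : Type*} [CommRing R] [Algebra ℂ R]

/-- The weight of a site as a function of its number of visits: `1` if it is not visited, and
`1 + t κ` if it is visited `κ + 1` times. -/
noncomputable def siteWeight (R : Type*) [CommRing R] [Algebra ℂ R] (t : ℕ → ℂ) : ℕ → R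
  | 0 => 1
  | κ + 1 => 1 + algebraMap ℂ R (t κ)

theorem sum_smul_vertexEnd {t : ℕ → ℂ} {L : ℕ} (i : Fin L) :
    (∑ κ ∈ Finset.range L, t κ • vertexEnd R L κ) i = algebraMap ℂ R (t i) * ((i : ℕ)! : R) := by
  rw [Finset.sum_apply, Finset.sum_eq_single (i : ℕ)]
  · rw [Pi.smul_apply, vertexEnd, if_pos rfl, Algebra.smul_def]
  · intro κ _ hκ
    rw [Pi.smul_apply, vertexEnd, if_neg (Ne.symm hκ), smul_zero]
  · intro h
    exact absurd (Finset.mem_range.mpr i.2) h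

theorem sum_smul_vertex {t : ℕ → ℂ} {L : ℕ} (ht : ∀ κ, L ≤ κ → t κ = 0) (i j : Fin L) :
    (∑ κ ∈ Finset.range L, t κ • vertex R L κ) i j =
      algebraMap ℂ R (t (i + j + 1)) * ((i + j + 1 : ℕ)! : R) := by
  rw [Matrix.sum_apply, Finset.sum_eq_single ((i : ℕ) + j + 1)]
  · rw [Matrix.smul_apply, vertex, if_pos rfl, Algebra.smul_def]
  · intro κ _ hκ
    rw [Matrix.smul_apply, vertex, if_neg (Ne.symm hκ), smul_zero]
  · intro h
    rw [ht _ (by simpa using h), zero_smul, Matrix.zero_apply]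

/-- The weighted sum over all profiles, expanded in the number of marked sites: none, one, two, and
at least three. -/
theorem sum_siteWeight_mul_eq {y a : R} {lam : ℕ → R} {n L : ℕ} (ha : a * (1 - y) = 1)
    (hy : y ^ (n + 1) = 0) (hL : 2 * n + 1 ≤ L)
    (hlam : ∀ f, 0 < f → lam f = (y * a) ^ f + (y * a) ^ f * lam f)
    {t : ℕ → ℂ} (ht : ∀ κ, L ≤ κ → t κ = 0) {r : Fin L → R}
    (hr : ∀ i, r i = edgeWeight y i * (((i : ℕ)! : R) * siteWeight R t (i + 1) +
      ∑ j : Fin L, ((i + j + 1 : ℕ)! : R) * siteWeight R t (i + j + 2) * r j))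
    {K : Matrix (Fin n × Fin n) (Fin n × Fin n) R}
    (hK : K * (1 - Matrix.of fun a b => ∑ κ ∈ Finset.range L,
      t κ • qEntry y lam n κ a.1 a.2 b.1 b.2) = 1) :
    ∑ i : Fin L, ((i : ℕ)! : R) * siteWeight R t (i + 1) * r i =
      ∑ i ∈ Finset.range L, (1 / ((i : ℂ) + 1)) • y ^ (i + 1) +
      ∑ κ ∈ Finset.range L, t κ • (1 / ((κ : ℂ) + 1)) • (2 * y) ^ (κ + 1) +
      ∑ κ ∈ Finset.range L, ∑ κ' ∈ Finset.range L, (t κ * t κ') • twoMarked y lam n κ κ' +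
      ∑ κ ∈ Finset.range L, ∑ κ' ∈ Finset.range L, ∑ κ'' ∈ Finset.range L, (t κ * t κ' * t κ'') •
        ((fun a : Fin n × Fin n => psiEntry y lam n κ a.1 a.2) ⬝ᵥ
          (K *ᵥ fun a => phiEntry y lam n κ' κ'' a.1 a.2)) := by
  set D : Matrix (Fin L) (Fin L) R := Matrix.diagonal fun i => edgeWeight y i with hD
  set N₀ : Matrix (Fin L) (Fin L) R := Matrix.of fun i j => ((i + j + 1 : ℕ)! : R) with hN₀
  set N₁ : Matrix (Fin L) (Fin L) R := ∑ κ ∈ Finset.range L, t κ • vertex R L κ with hN₁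
  set e₀ : Fin L → R := fun i => ((i : ℕ)! : R) with he₀
  set e₁ : Fin L → R := ∑ κ ∈ Finset.range L, t κ • vertexEnd R L κ with he₁
  set r₀ : Fin L → R := fun i => freeEnd y i with hr₀
  set e : Fin L → R := ∑ κ ∈ Finset.range L, t κ • markedEnd y L κ with he
  set ps : Fin n × Fin n → R := ∑ κ ∈ Finset.range L, t κ •
    (fun a : Fin n × Fin n => psiEntry y lam n κ a.1 a.2) with hpsi
  set ph : Fin n × Fin n → R := ∑ κ ∈ Finset.range L, ∑ κ' ∈ Finset.range L, (t κ * t κ') •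
    (fun a : Fin n × Fin n => phiEntry y lam n κ κ' a.1 a.2) with hphi
  have hee : ∀ i, (e₀ + e₁) i = ((i : ℕ)! : R) * siteWeight R t (i + 1) := by
    intro i
    rw [Pi.add_apply, he₁, sum_smul_vertexEnd, siteWeight]
    ring
  have hNN : ∀ i j, (N₀ + N₁) i j = ((i + j + 1 : ℕ)! : R) * siteWeight R t (i + j + 2) := by
    intro i j
    rw [Matrix.add_apply, hN₁, sum_smul_vertex ht, siteWeight, hN₀, Matrix.of_apply]
    ring
  have hY : ps ᵥ* rightMat y n L = -(e ᵥ* greenMat y lam n L) := by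
    rw [hpsi, he, sum_vecMul, sum_vecMul, ← Finset.sum_neg_distrib]
    refine Finset.sum_congr rfl fun κ hκ => ?_
    rw [smul_vecMul, smul_vecMul, psi_vecMul_rightMat y lam n (Finset.mem_range.mp hκ), smul_neg]
  have hG : ph = -((rightMat y n L * N₁ * greenMat y lam n L) *ᵥ e) := by
    have h1 : rightMat y n L * N₁ * greenMat y lam n L =
        ∑ κ ∈ Finset.range L, t κ • (rightMat y n L * vertex R L κ * greenMat y lam n L) := by
      rw [hN₁, Matrix.mul_sum, Matrix.sum_mul]
      simp only [Matrix.mul_smul, Matrix.smul_mul]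
    rw [h1, sum_mulVec, hphi, ← Finset.sum_neg_distrib]
    refine Finset.sum_congr rfl fun κ hκ => ?_
    rw [he, mulVec_sum, ← Finset.sum_neg_distrib]
    refine Finset.sum_congr rfl fun κ' hκ' => ?_
    rw [smul_mulVec, mulVec_smul, smul_smul, ← smul_neg]
    congr 1
    funext b
    rw [Pi.neg_apply, rightMat_mul_vertex_mul_green y lam n (Finset.mem_range.mp hκ).le
      (Finset.mem_range.mp hκ'), neg_neg]
  have h := dotProduct_eq_resolvent (D := D) (N₀ := N₀) (N₁ := N₁) (Γ := greenMat y lam n L)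
    (X := leftMat y lam n L) (Y := rightMat y n L) (K := K) (e₀ := e₀) (e₁ := e₁) (r₀ := r₀) (r := r)
    (e := e) (by simp [hD]) (by ext i j; simp [hN₀, add_comm (i : ℕ)])
    (by rw [hN₁, transpose_sum]; simp only [transpose_smul, vertex_transpose])
    (by ext i j; exact green_comm y lam n j i) ?_ ?_ ?_ (greenMat_eq_mul y lam n L) ?_ hY hG ?_
  · rw [dotProduct] at h
    simp only [hee] at h
    rw [h]
    congr 1
    · congr 1
      · congr 1
        · exact factorial_dotProduct_freeEnd y L
        · rw [he₁, he, sum_dotProduct, dotProduct_sum, ← Finset.sum_add_distrib]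
          refine Finset.sum_congr rfl fun κ hκ => ?_
          rw [smul_dotProduct, dotProduct_smul, ← smul_add,
            vertexEnd_dotProduct y (Finset.mem_range.mp hκ)]
      · rw [he, sum_dotProduct]
        refine Finset.sum_congr rfl fun κ hκ => ?_
        rw [mulVec_sum, dotProduct_sum]
        refine Finset.sum_congr rfl fun κ' hκ' => ?_
        rw [smul_dotProduct, mulVec_smul, dotProduct_smul, smul_smul,
          markedEnd_dotProduct_green y lam n (Finset.mem_range.mp hκ) (Finset.mem_range.mp hκ')]
    · rw [hpsi, hphi, sum_dotProduct]
      refine Finset.sum_congr rfl fun κ _ => ?_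
      rw [mulVec_sum, dotProduct_sum]
      refine Finset.sum_congr rfl fun κ' _ => ?_
      rw [mulVec_sum, dotProduct_sum]
      refine Finset.sum_congr rfl fun κ'' _ => ?_
      rw [smul_dotProduct, mulVec_smul, dotProduct_smul, smul_smul, mul_assoc]
  · ext i j
    rw [Matrix.add_apply, Matrix.mul_apply, hD, Matrix.diagonal_apply]
    simp only [Matrix.diagonal_mul, hN₀, Matrix.of_apply, greenMat]
    rw [green_eq ha hy hL hlam, Fin.sum_univ_eq_sum_range
      (fun k => edgeWeight y i * ((i + k + 1 : ℕ)! : R) * green y lam n k j)]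
    simp only [Fin.ext_iff]
  · ext i
    rw [Pi.add_apply, hD, Matrix.mulVec_diagonal, mulVec, dotProduct]
    simp only [Matrix.diagonal_mul, hN₀, Matrix.of_apply, hr₀, he₀]
    rw [freeEnd_eq ha hy (by omega : n ≤ L), Fin.sum_univ_eq_sum_range
      (fun k => edgeWeight y i * ((i + k + 1 : ℕ)! : R) * freeEnd y k)]
  · ext i
    rw [Pi.add_apply, hD, Matrix.mulVec_diagonal, mulVec, dotProduct]
    simp only [Matrix.diagonal_mul, hNN, hee]
    rw [hr i, mul_add, Finset.mul_sum]
    simp only [mul_assoc]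
  · rw [he, he₁, hN₁, sum_mulVec, ← Finset.sum_add_distrib]
    refine Finset.sum_congr rfl fun κ hκ => ?_
    rw [smul_mulVec, ← smul_add, vertexEnd_add_vertex_mulVec y (Finset.mem_range.mp hκ)]
  · rw [← hK]
    congr 2
    ext b c
    rw [hN₁, Matrix.mul_sum, Matrix.sum_mul, Matrix.sum_apply, Matrix.of_apply]
    refine Finset.sum_congr rfl fun κ hκ => ?_
    rw [Matrix.mul_smul, Matrix.smul_mul, Matrix.smul_apply,
      rightMat_mul_vertex_mul_leftMat y lam n (Finset.mem_range.mp hκ).le]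

end Expansion

/-! ### The partition function of the profiles -/

section Profile

open Nat Matrix

theorem constantCoeff_edgeWeight_halfExc (i : ℕ) :
    PowerSeries.constantCoeff (edgeWeight halfExc i) = 0 := by
  rw [edgeWeight, halfExc_mul_one_sub, ← PowerSeries.coeff_zero_eq_constantCoeff_apply,
    PowerSeries.coeff_smul, PowerSeries.coeff_zero_eq_constantCoeff_apply, map_pow, map_pow,
    PowerSeries.constantCoeff_X, zero_pow two_ne_zero, zero_pow (Nat.succ_ne_zero i), smul_zero]

/-- The transfer equation has a solution in power series, as the edge weights have constant term
`0`. -/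
theorem exists_transfer_solution (t : ℕ → ℂ) (L : ℕ) : ∃ r s : Fin L → ℂ⟦X⟧,
    (∀ i, r i = edgeWeight halfExc i * s i) ∧
    ∀ i : Fin L, s i = ((i : ℕ)! : ℂ⟦X⟧) * siteWeight ℂ⟦X⟧ t (i + 1) +
      ∑ j : Fin L, ((i + j + 1 : ℕ)! : ℂ⟦X⟧) * siteWeight ℂ⟦X⟧ t (i + j + 2) * r j := by
  set V : Matrix (Fin L) (Fin L) ℂ⟦X⟧ := Matrix.of fun i j =>
    ((i + j + 1 : ℕ)! : ℂ⟦X⟧) * siteWeight ℂ⟦X⟧ t (i + j + 2) with hV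
  set e : Fin L → ℂ⟦X⟧ := fun i => ((i : ℕ)! : ℂ⟦X⟧) * siteWeight ℂ⟦X⟧ t (i + 1) with he
  set D : Matrix (Fin L) (Fin L) ℂ⟦X⟧ := Matrix.diagonal fun i => edgeWeight halfExc i with hD
  have hu : IsUnit (1 - D * V) := by
    refine isUnit_one_sub_of_constantCoeff fun i j => ?_
    rw [hD, Matrix.diagonal_mul, map_mul, constantCoeff_edgeWeight_halfExc, zero_mul]
  set r : Fin L → ℂ⟦X⟧ := (1 - D * V)⁻¹ *ᵥ (D *ᵥ e) with hr
  refine ⟨r, e + V *ᵥ r, fun i => ?_, fun i => rfl⟩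
  have h : (1 - D * V) *ᵥ r = D *ᵥ e := by
    rw [hr, mulVec_mulVec, Matrix.mul_nonsing_inv _ ((Matrix.isUnit_iff_isUnit_det _).mp hu),
      one_mulVec]
  rw [sub_mulVec, one_mulVec, sub_eq_iff_eq_add, ← mulVec_mulVec, ← mulVec_add] at h
  conv_lhs => rw [h]
  rw [hD, Matrix.mulVec_diagonal]

end Profile

/-! ### The generating function of the closed walks -/

section WalkSum

theorem visits_apply (p q : ℤ) (l : List ℤˣ) : visits p l q =
    ∑ i ∈ Finset.range l.length, if q = p + stepSum (l.take i) then 1 else 0 := by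
  induction l generalizing p with
  | nil => simp [visits]
  | cons s l ih =>
    rw [visits, Finsupp.add_apply, ih, List.length_cons, Finset.sum_range_succ', add_comm,
      Finsupp.single_apply]
    congr 1
    · refine Finset.sum_congr rfl fun i _ => ?_
      rw [List.take_succ_cons, show p + stepSum (s :: l.take i) = p + s + stepSum (l.take i) by
        simp [stepSum, add_assoc]]
    · simp [stepSum, eq_comm]

theorem visits_apply_le (p q : ℤ) (l : List ℤˣ) : visits p l q ≤ l.length := by
  rw [visits_apply]
  refine (Finset.sum_le_card_nsmul _ _ 1 fun i _ => ?_).trans (by simp)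
  split_ifs <;> simp

-- The coercion of the steps in `Walk.point` acts on the list of steps, as a `flatMap`.
theorem point_eq (l : List ℤˣ) (i : ℕ) : Walk.point ⟨0, l⟩ i = stepSum (l.take i) := by
  have h : ∀ l : List ℤˣ, l.flatMap (fun s : ℤˣ => [(s : ℤ)]) = l.map fun s : ℤˣ => (s : ℤ) := by
    intro l
    induction l with
    | nil => rfl
    | cons s l ih => rw [List.flatMap_cons, ih]; rfl
  simp [Walk.point, stepSum, h, List.map_take, Function.comp_def]

theorem isClosed_iff (l : List ℤˣ) : Walk.IsClosed ⟨0, l⟩ ↔ stepSum l = 0 := by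
  rw [Walk.IsClosed, point_eq, Walk.length, List.take_length]

/-- The multiplicity of a site in a closed walk is twice its number of visits. -/
theorem mult_eq_two_mul_visits {l : List ℤˣ} (h0 : 0 < l.length) (hl : stepSum l = 0) (q : ℤ) :
    Walk.mult q ⟨0, l⟩ = 2 * visits 0 l q := by
  have h : Walk.point ⟨0, l⟩ (Walk.length ⟨0, l⟩) = 0 := by
    rw [point_eq, Walk.length, List.take_length, hl]
  rw [Walk.mult, h, visits_apply, Finset.range_eq_Ico, Finset.sum_eq_sum_Ico_succ_bot h0]
  simp only [point_eq, Walk.length, List.take_zero, zero_add]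
  rw [show stepSum [] = 0 from rfl]
  ring

theorem rangeCount_eq_card {l : List ℤˣ} (h0 : 0 < l.length) (hl : stepSum l = 0) (k : ℕ+) :
    Walk.rangeCount k ⟨0, l⟩ =
      ((visits 0 l).support.filter fun q => (visits 0 l q - 1).succPNat = k).card := by
  rw [Walk.rangeCount, ← Set.ncard_coe_finset]
  congr 1
  ext q
  have hk := k.pos
  simp only [mult_eq_two_mul_visits h0 hl, Set.mem_ofPred_eq, Finset.coe_filter,
    Finsupp.mem_support_iff, ← PNat.coe_inj, Nat.succPNat_coe]
  omega

theorem rangeCount_support_subset {l : List ℤˣ} (h0 : 0 < l.length) (hl : stepSum l = 0) :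
    {k : ℕ+ | Walk.rangeCount k ⟨0, l⟩ ≠ 0} ⊆
      ((visits 0 l).support.image fun q => (visits 0 l q - 1).succPNat : Finset ℕ+) := by
  intro k hk
  rw [Set.mem_ofPred_eq, rangeCount_eq_card h0 hl] at hk
  obtain ⟨q, hq⟩ := Finset.card_ne_zero.mp hk
  rw [Finset.mem_filter] at hq
  exact Finset.mem_coe.mpr (Finset.mem_image.mpr ⟨q, hq⟩)

theorem finite_rangeCount_ne_zero {N : ℕ} {w : Walk} (hw : w ∈ walks N) :
    {k : ℕ+ | w.rangeCount k ≠ 0}.Finite := by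
  obtain ⟨p, l⟩ := w
  obtain ⟨rfl, hc, h0, -⟩ : p = 0 ∧ _ := hw
  exact (Finset.finite_toSet _).subset (rangeCount_support_subset h0 ((isClosed_iff l).mp hc))

/-- The exponential weight of a closed walk is the product of the weights of its sites. -/
theorem exp_finsum_rangeCount {Λ : ℕ+ → ℂ} {t : ℕ → ℂ} {L : ℕ}
    (ht : ∀ κ < L, t κ = Complex.exp (Λ κ.succPNat) - 1)
    {l : List ℤˣ} (h0 : 0 < l.length) (hL : l.length ≤ L) (hl : stepSum l = 0) :
    Complex.exp (∑ᶠ k : ℕ+, Λ k * (Walk.rangeCount k ⟨0, l⟩ : ℂ)) =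
      (visits 0 l).prod fun _ k => siteWeight ℂ t k := by
  have h1 : ∑ᶠ k : ℕ+, Λ k * (Walk.rangeCount k ⟨0, l⟩ : ℂ) =
      ∑ q ∈ (visits 0 l).support, Λ (visits 0 l q - 1).succPNat := by
    rw [Finset.sum_comp Λ fun q => (visits 0 l q - 1).succPNat]
    rw [finsum_eq_sum_of_support_subset]
    · refine Finset.sum_congr rfl fun k _ => ?_
      rw [rangeCount_eq_card h0 hl, nsmul_eq_mul, mul_comm]
    · refine fun k hk => rangeCount_support_subset h0 hl fun h => hk ?_
      simp only [h, Nat.cast_zero, mul_zero]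
  rw [h1, Complex.exp_sum, Finsupp.prod]
  refine Finset.prod_congr rfl fun q hq => ?_
  have hq' := Finsupp.mem_support_iff.mp hq
  have hle := (visits_apply_le 0 q l).trans hL
  obtain ⟨κ, hκ⟩ := Nat.exists_eq_succ_of_ne_zero hq'
  rw [hκ, Nat.succ_eq_add_one, siteWeight, Nat.add_sub_cancel, ht κ (by omega)]
  simp

theorem finsum_walks {M : Type*} [AddCommMonoid M] (N : ℕ) (F : Walk → M) :
    ∑ᶠ w ∈ walks N, F w = ∑ n ∈ Finset.range (2 * N), ∑ l ∈ stepLists (n + 1),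
      if stepSum l = 0 then F ⟨0, l⟩ else 0 := by
  classical
  set S : Finset Walk := (Finset.range (2 * N)).biUnion fun n =>
    ((stepLists (n + 1)).filter fun l => stepSum l = 0).image fun l => ⟨0, l⟩ with hS
  have hw : walks N = (S : Set Walk) := by
    ext ⟨p, l⟩
    simp only [hS, walks, Set.mem_ofPred_eq, Finset.coe_biUnion, Set.mem_iUnion, Finset.mem_coe,
      Finset.mem_image, Finset.mem_filter, mem_stepLists, Finset.mem_range, Walk.mk.injEq]
    constructor
    · rintro ⟨rfl, hc, h0, hl⟩
      have h0' : 0 < l.length := h0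
      have hl' : l.length ≤ 2 * N := hl
      exact ⟨l.length - 1, by omega, l, ⟨by omega, (isClosed_iff l).mp hc⟩, rfl, rfl⟩
    · rintro ⟨n, hn, l', ⟨h1, h2⟩, rfl, rfl⟩
      exact ⟨rfl, (isClosed_iff l').mpr h2, by simp only [Walk.length]; omega,
        by simp only [Walk.length]; omega⟩
  rw [hw, finsum_mem_coe_finset, hS, Finset.sum_biUnion]
  · refine Finset.sum_congr rfl fun n _ => ?_
    rw [Finset.sum_image (fun l _ l' _ h => (Walk.mk.inj h).2), Finset.sum_filter]
  · intro n _ m _ hnm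
    rw [Function.onFun, Finset.disjoint_left]
    intro w h1 h2
    simp only [Finset.mem_image, Finset.mem_filter, mem_stepLists] at h1 h2
    obtain ⟨l, ⟨h1, -⟩, rfl⟩ := h1
    obtain ⟨l', ⟨h2, -⟩, h⟩ := h2
    rw [(Walk.mk.inj h).2] at h2
    omega

theorem siteWeight_map {R S : Type*} [CommRing R] [CommRing S] [Algebra ℂ R] [Algebra ℂ S]
    (g : R →ₐ[ℂ] S) (t : ℕ → ℂ) (k : ℕ) : g (siteWeight R t k) = siteWeight S t k := by
  cases k with
  | zero => exact map_one g
  | succ k => rw [siteWeight, siteWeight, map_add, map_one, AlgHom.commutes]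

theorem smul_eq_mul_algebraMap {R : Type*} [CommRing R] [Algebra ℂ R] (c : ℂ) (x : R) :
    c • x = x * algebraMap ℂ R c := by
  rw [Algebra.smul_def, mul_comm]

/-- The generating function of the theorem is the functional `visitWeight` on `walkGF`, without the
walk of length `0`. -/
theorem toTrunc_finsum_walks (N : ℕ) {Λ : ℕ+ → ℂ} {t : ℕ → ℂ} {L : ℕ}
    (ht : ∀ κ < L, t κ = Complex.exp (Λ κ.succPNat) - 1) (hL : 2 * N ≤ L) :
    toTrunc N (∑ᶠ w ∈ walks N, Complex.exp (∑ᶠ k : ℕ+, Λ k * (w.rangeCount k : ℂ)) •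
      (PowerSeries.X : ℂ⟦X⟧) ^ w.length) =
    visitWeight (siteWeight (TruncRing N) t) (walkGF (zT N) (2 * N + 1) 0) - 1 := by
  rw [finsum_walks, walkGF, map_sum, Finset.sum_range_succ', map_add, map_sum]
  have h0 : visitWeight (siteWeight (TruncRing N) t)
      (MvPolynomial.C (zT N) ^ 0 * walkPoly (TruncRing N) 0 0) = 1 := by
    rw [pow_zero, one_mul, walkPoly, if_pos rfl, visitWeight_one]
  rw [h0, add_sub_cancel_right]
  refine Finset.sum_congr rfl fun n hn => ?_
  rw [Finset.mem_range] at hn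
  rw [walkPoly_eq_sum, Finset.mul_sum, map_sum, map_sum]
  refine Finset.sum_congr rfl fun l hl => ?_
  rw [mem_stepLists] at hl
  rw [zero_add]
  split_ifs with h
  · rw [map_smul, map_pow, ← map_pow MvPolynomial.C, MvPolynomial.C_mul_monomial, mul_one,
      visitWeight_monomial, exp_finsum_rangeCount ht (by omega) (by omega) h, Walk.length, hl]
    refine (smul_eq_mul_algebraMap (R := TruncRing N) _ _).trans ?_
    congr 1
    rw [Finsupp.prod, Finsupp.prod, map_prod]
    exact Finset.prod_congr rfl fun q _ => siteWeight_map (Algebra.ofId ℂ (TruncRing N)) t _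
  · rw [map_zero, mul_zero, map_zero]

/-- Terms of degree greater than `2 N` do not occur. -/
theorem coeff_finsum_walks (N : ℕ) (c : Walk → ℂ) {n : ℕ} (hn : 2 * N < n) :
    PowerSeries.coeff n (∑ᶠ w ∈ walks N, c w • (PowerSeries.X : ℂ⟦X⟧) ^ w.length) = 0 := by
  rw [finsum_walks, map_sum]
  refine Finset.sum_eq_zero fun m hm => ?_
  rw [map_sum]
  refine Finset.sum_eq_zero fun l hl => ?_
  rw [mem_stepLists] at hl
  rw [Finset.mem_range] at hm
  split_ifs
  · rw [PowerSeries.coeff_smul, PowerSeries.coeff_X_pow, Walk.length, if_neg (by simp only; omega),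
      smul_zero]
  · exact map_zero _

end WalkSum

/-! ### Truncation of the profile sum -/

section ProfileSum

open Nat

theorem toTrunc_edgeWeight (N i : ℕ) :
    toTrunc N (edgeWeight halfExc i) = edgeWeight (yT N) i := by
  rw [edgeWeight, edgeWeight, map_smul, map_pow, map_mul, map_sub, map_one, yT]

/-- The sum over all profiles: a series whose image under `z d/dz` counts the weighted closed walks.
Modulo `z ^ (2 N + 1)` it is given by the expansion in the marked sites. -/
theorem exists_profileSum (N : ℕ) {t : ℕ → ℂ} {L : ℕ} (hL : 2 * N + 1 ≤ L)
    (ht : ∀ κ, L ≤ κ → t κ = 0) {K : Matrix (Idx N) (Idx N) (TruncRing N)}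
    (hK : K * (1 - Matrix.of fun a b => ∑ κ ∈ Finset.range L,
      t κ • qEntry (yT N) (lamT N) N κ a.1 a.2 b.1 b.2) = 1) :
    ∃ F : ℂ⟦X⟧, toTrunc N (PowerSeries.X * PowerSeries.derivative ℂ F) =
        visitWeight (siteWeight (TruncRing N) t) (walkGF (zT N) (2 * N + 1) 0) - 1 ∧
      toTrunc N F = ∑ i ∈ Finset.range L, (1 / ((i : ℂ) + 1)) • yT N ^ (i + 1) +
      ∑ κ ∈ Finset.range L, t κ • (1 / ((κ : ℂ) + 1)) • (2 * yT N) ^ (κ + 1) +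
      ∑ κ ∈ Finset.range L, ∑ κ' ∈ Finset.range L,
        (t κ * t κ') • twoMarked (yT N) (lamT N) N κ κ' +
      ∑ κ ∈ Finset.range L, ∑ κ' ∈ Finset.range L, ∑ κ'' ∈ Finset.range L, (t κ * t κ' * t κ'') •
        ((fun a : Idx N => psiEntry (yT N) (lamT N) N κ a.1 a.2) ⬝ᵥ
          (K.mulVec fun a => phiEntry (yT N) (lamT N) N κ' κ'' a.1 a.2)) := by
  obtain ⟨r, s, hr, hs⟩ := exists_transfer_solution t L
  have hr' : ∀ i, toTrunc N (r i) = edgeWeight (yT N) i * toTrunc N (s i) := by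
    intro i
    rw [hr i, map_mul, toTrunc_edgeWeight]
  have hs' : ∀ i : Fin L, toTrunc N (s i) = ((i : ℕ)! : TruncRing N) *
      siteWeight (TruncRing N) t (i + 1) + ∑ j : Fin L, ((i + j + 1 : ℕ)! : TruncRing N) *
        siteWeight (TruncRing N) t (i + j + 2) * toTrunc N (r j) := by
    intro i
    rw [hs i, map_add, map_mul, map_sum, map_natCast, siteWeight_map]
    simp only [map_mul, map_natCast, siteWeight_map]
  refine ⟨∑ i : Fin L, ((i : ℕ)! : ℂ⟦X⟧) * siteWeight ℂ⟦X⟧ t (i + 1) * r i, ?_, ?_⟩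
  · set θ : Derivation ℂ ℂ⟦X⟧ ℂ⟦X⟧ := (PowerSeries.X : ℂ⟦X⟧) • PowerSeries.derivative ℂ with hθ
    have hconst : ∀ m k : ℕ, θ ((m : ℂ⟦X⟧) * siteWeight ℂ⟦X⟧ t k) = 0 := by
      intro m k
      have : (m : ℂ⟦X⟧) * siteWeight ℂ⟦X⟧ t k = algebraMap ℂ ℂ⟦X⟧ (m * siteWeight ℂ t k) := by
        rw [map_mul, map_natCast]
        congr 1
        exact (siteWeight_map (Algebra.ofId ℂ ℂ⟦X⟧) t k).symm
      rw [this, Derivation.map_algebraMap]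
    have h := derivation_dotProduct θ
      (D := fun i : Fin L => edgeWeight halfExc i)
      (e := fun i : Fin L => ((i : ℕ)! : ℂ⟦X⟧) * siteWeight ℂ⟦X⟧ t (i + 1))
      (r := r) (s := s) (u := fun i => 2 * ((i : ℕ) + 1))
      (V := Matrix.of fun i j : Fin L =>
        ((i + j + 1 : ℕ)! : ℂ⟦X⟧) * siteWeight ℂ⟦X⟧ t (i + j + 2))
      (by ext i j : 2; simp [add_comm (i : ℕ)]) (fun i => hconst _ _) (fun i j => hconst _ _)
      ?_ hr (funext hs)
    · rw [hθ, Derivation.smul_apply, smul_eq_mul] at h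
      rw [← dotProduct, h, map_sum, ← sum_edge_mul_eq_visitWeight (yT_mul_one_sub N) (zT_pow N)
        (Nat.succ_pos _) rfl (L := L) _ hr' hs']
      · refine Finset.sum_congr rfl fun i _ => ?_
        rw [map_mul, map_mul, map_mul, map_ofNat, map_add, map_natCast, map_one]
      · exact pow_eq_zero_of_le (by omega) (zT_pow N)
    · intro i
      rw [edgeWeight, halfExc_mul_one_sub, ← pow_mul, Derivation.map_smul, hθ, Derivation.smul_apply,
        PowerSeries.derivative_pow, PowerSeries.derivative_X, smul_eq_mul, mul_smul_comm]
      congr 1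
      rw [mul_one, mul_left_comm, ← _root_.pow_succ', Nat.sub_add_cancel (by omega)]
      push_cast
      rfl
  · rw [map_sum, ← sum_siteWeight_mul_eq (aT_mul N) (yT_pow N) hL (lamT_eq N) ht
      (r := fun i => toTrunc N (r i)) (fun i => by rw [hr' i, hs' i]) hK]
    refine Finset.sum_congr rfl fun i _ => ?_
    rw [map_mul, map_mul, map_natCast, siteWeight_map]

end ProfileSum

/-! ### Finiteness of the sums over the numbers of visits -/

section Finiteness

variable {M : Type*} [AddCommMonoid M]

theorem succPNat_injective : Function.Injective Nat.succPNat := fun _ _ h => Nat.succPNat_inj.mp h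

theorem exists_succPNat (k : ℕ+) : ∃ κ : ℕ, k = κ.succPNat :=
  ⟨k.natPred, (PNat.succPNat_natPred k).symm⟩

theorem finsum_pnat_eq_sum {L : ℕ} {F : ℕ+ → M} (h : ∀ κ, L ≤ κ → F κ.succPNat = 0) :
    ∑ᶠ k, F k = ∑ κ ∈ Finset.range L, F κ.succPNat := by
  rw [← Finset.sum_image (g := Nat.succPNat) (f := F) succPNat_injective.injOn]
  apply finsum_eq_sum_of_support_subset
  intro k hk
  obtain ⟨κ, rfl⟩ := exists_succPNat k
  rw [Finset.mem_coe, succPNat_injective.mem_finset_image, Finset.mem_range]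
  by_contra hL
  exact hk (h κ (not_lt.mp hL))

theorem finite_pnat {L : ℕ} {F : ℕ+ → M} (h : ∀ κ, L ≤ κ → F κ.succPNat = 0) :
    {k | F k ≠ 0}.Finite := by
  refine ((Finset.range L).image Nat.succPNat).finite_toSet.subset fun k hk => ?_
  obtain ⟨κ, rfl⟩ := exists_succPNat k
  rw [Finset.mem_coe, succPNat_injective.mem_finset_image, Finset.mem_range]
  by_contra hL
  exact hk (h κ (not_lt.mp hL))

theorem finite_pnat_prod {α : Type*} {L : ℕ} {F : ℕ+ × α → M}
    (h : ∀ κ a, L ≤ κ → F (κ.succPNat, a) = 0) (h' : ∀ k, {a | F (k, a) ≠ 0}.Finite) :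
    {p | F p ≠ 0}.Finite := by
  refine (((Finset.range L).image Nat.succPNat).finite_toSet.biUnion fun k _ =>
    (h' k).image (Prod.mk k)).subset ?_
  rintro ⟨k, a⟩ hk
  obtain ⟨κ, rfl⟩ := exists_succPNat k
  refine Set.mem_biUnion ?_ ⟨a, hk, rfl⟩
  rw [Finset.mem_coe, succPNat_injective.mem_finset_image, Finset.mem_range]
  by_contra hL
  exact hk (h κ a (not_lt.mp hL))

theorem finsum_pnat_prod_eq_sum {α : Type*} {L : ℕ} {F : ℕ+ × α → M}
    (h : ∀ κ a, L ≤ κ → F (κ.succPNat, a) = 0) (h' : ∀ k, {a | F (k, a) ≠ 0}.Finite) :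
    ∑ᶠ p, F p = ∑ κ ∈ Finset.range L, ∑ᶠ a, F (κ.succPNat, a) := by
  rw [finsum_curry F (finite_pnat_prod h h')]
  refine finsum_pnat_eq_sum (F := fun k => ∑ᶠ a, F (k, a)) fun κ hκ => ?_
  exact finsum_eq_zero_of_forall_eq_zero fun a => h κ a hκ

end Finiteness

/-! ### Assembling the terms -/

section Assembly

open Matrix

variable (N : ℕ)

theorem succPNat_coe_eq (κ : ℕ) : ((κ.succPNat : ℕ+) : ℕ) = κ + 1 := rfl

theorem Qsum_eq_sum (t : ℕ+ → ℂ) :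
    Qsum N t = ∑ κ ∈ Finset.range (4 * N + 1), t κ.succPNat • Q N (κ + 1) :=
  finsum_pnat_eq_sum (F := fun k => t k • Q N k) fun κ hκ => by
    rw [succPNat_coe_eq, Q_eq_zero N (by omega), smul_zero]

theorem constantCoeff_Qsum (t : ℕ+ → ℂ) (a b : Idx N) :
    PowerSeries.constantCoeff (Qsum N t a b) = 0 := by
  rw [Qsum_eq_sum, Matrix.sum_apply, map_sum]
  refine Finset.sum_eq_zero fun κ _ => ?_
  rw [Matrix.smul_apply, ← PowerSeries.coeff_zero_eq_constantCoeff_apply, PowerSeries.coeff_smul,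
    PowerSeries.coeff_zero_eq_constantCoeff_apply, constantCoeff_Q, smul_zero]

theorem T3_eq_zero {t : ℕ+ → ℂ} {κ κ' κ'' : ℕ} (h : 4 * N ≤ κ ∨ 4 * N ≤ κ' ∨ 4 * N ≤ κ'') :
    T3 N t (κ + 1) (κ' + 1) (κ'' + 1) = 0 := by
  rw [T3]
  apply proj_eq_zero
  rcases h with h | h
  · rw [Psi_eq_zero N (by omega), zero_dotProduct, map_zero]
  · rw [Phi_eq_zero N (by omega), mulVec_zero, dotProduct_zero, map_zero]

theorem finite_T2 : {k : ℕ+ × ℕ+ | T2 N k.1 k.2 ≠ 0}.Finite :=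
  finite_pnat_prod (L := 2 * N) (F := fun k : ℕ+ × ℕ+ => T2 N k.1 k.2)
    (fun κ k hκ => by
      obtain ⟨κ', rfl⟩ := exists_succPNat k
      exact T2_eq_zero N (Or.inl hκ))
    (fun k => finite_pnat (L := 2 * N) fun κ' hκ' => by
      obtain ⟨κ, rfl⟩ := exists_succPNat k
      exact T2_eq_zero N (Or.inr hκ'))

theorem finite_T3 (t : ℕ+ → ℂ) :
    {k : ℕ+ × ℕ+ × ℕ+ | T3 N t k.1 k.2.1 k.2.2 ≠ 0}.Finite := by
  refine finite_pnat_prod (L := 4 * N) (F := fun k : ℕ+ × ℕ+ × ℕ+ => T3 N t k.1 k.2.1 k.2.2)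
    (fun κ k hκ => ?_) (fun k => finite_pnat_prod (L := 4 * N) (fun κ' k'' hκ' => ?_)
      fun k' => finite_pnat (L := 4 * N) fun κ'' hκ'' => ?_)
  · obtain ⟨κ', hk'⟩ := exists_succPNat k.1
    obtain ⟨κ'', hk''⟩ := exists_succPNat k.2
    rw [hk', hk'']
    exact T3_eq_zero N (Or.inl hκ)
  · obtain ⟨κ, rfl⟩ := exists_succPNat k
    obtain ⟨κ'', rfl⟩ := exists_succPNat k''
    exact T3_eq_zero N (Or.inr (Or.inl hκ'))
  · obtain ⟨κ, rfl⟩ := exists_succPNat k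
    obtain ⟨κ', rfl⟩ := exists_succPNat k'
    exact T3_eq_zero N (Or.inr (Or.inr hκ''))

variable {N}

theorem finsum_T1 (t : ℕ+ → ℂ) : ∑ᶠ k : ℕ+, t k • T1 N k =
    ∑ κ ∈ Finset.range (4 * N + 1), t κ.succPNat • T1 N (κ + 1) :=
  finsum_pnat_eq_sum (F := fun k : ℕ+ => t k • T1 N k) fun κ hκ => by
    rw [succPNat_coe_eq, T1_eq_zero N (by omega), smul_zero]

theorem finsum_T2 (t : ℕ+ → ℂ) : ∑ᶠ k : ℕ+ × ℕ+, (t k.1 * t k.2) • T2 N k.1 k.2 =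
    ∑ κ ∈ Finset.range (4 * N + 1), ∑ κ' ∈ Finset.range (4 * N + 1),
      (t κ.succPNat * t κ'.succPNat) • T2 N (κ + 1) (κ' + 1) := by
  have h : ∀ (k : ℕ+) (κ' : ℕ), 4 * N + 1 ≤ κ' →
      (t k * t κ'.succPNat) • T2 N k κ'.succPNat = 0 := by
    intro k κ' hκ'
    obtain ⟨κ, rfl⟩ := exists_succPNat k
    rw [succPNat_coe_eq, succPNat_coe_eq, T2_eq_zero N (by omega), smul_zero]
  rw [finsum_pnat_prod_eq_sum (L := 4 * N + 1)
    (F := fun k : ℕ+ × ℕ+ => (t k.1 * t k.2) • T2 N k.1 k.2)]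
  · exact Finset.sum_congr rfl fun κ _ => finsum_pnat_eq_sum
      (F := fun k : ℕ+ => (t κ.succPNat * t k) • T2 N κ.succPNat k) (h _)
  · intro κ k hκ
    obtain ⟨κ', rfl⟩ := exists_succPNat k
    rw [succPNat_coe_eq, succPNat_coe_eq, T2_eq_zero N (by omega), smul_zero]
  · exact fun k => finite_pnat (h k)

theorem finsum_T3 (t s : ℕ+ → ℂ) :
    ∑ᶠ k : ℕ+ × ℕ+ × ℕ+, (t k.1 * t k.2.1 * t k.2.2) • T3 N s k.1 k.2.1 k.2.2 =
    ∑ κ ∈ Finset.range (4 * N + 1), ∑ κ' ∈ Finset.range (4 * N + 1),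
      ∑ κ'' ∈ Finset.range (4 * N + 1), (t κ.succPNat * t κ'.succPNat * t κ''.succPNat) •
        T3 N s (κ + 1) (κ' + 1) (κ'' + 1) := by
  have hz : ∀ κ κ' κ'' : ℕ, 4 * N + 1 ≤ κ ∨ 4 * N + 1 ≤ κ' ∨ 4 * N + 1 ≤ κ'' →
      (t κ.succPNat * t κ'.succPNat * t κ''.succPNat) •
        T3 N s κ.succPNat κ'.succPNat κ''.succPNat = 0 := by
    intro κ κ' κ'' h
    rw [succPNat_coe_eq, succPNat_coe_eq, succPNat_coe_eq, T3_eq_zero N (by omega), smul_zero]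
  have h3 : ∀ (k k' : ℕ+) (κ'' : ℕ), 4 * N + 1 ≤ κ'' →
      (t k * t k' * t κ''.succPNat) • T3 N s k k' κ''.succPNat = 0 := by
    intro k k' κ'' h
    obtain ⟨κ, rfl⟩ := exists_succPNat k
    obtain ⟨κ', rfl⟩ := exists_succPNat k'
    exact hz _ _ _ (Or.inr (Or.inr h))
  have h2 : ∀ (k : ℕ+) (κ' : ℕ) (k'' : ℕ+), 4 * N + 1 ≤ κ' →
      (t k * t κ'.succPNat * t k'') • T3 N s k κ'.succPNat k'' = 0 := by
    intro k κ' k'' h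
    obtain ⟨κ, rfl⟩ := exists_succPNat k
    obtain ⟨κ'', rfl⟩ := exists_succPNat k''
    exact hz _ _ _ (Or.inr (Or.inl h))
  rw [finsum_pnat_prod_eq_sum (L := 4 * N + 1)
    (F := fun k : ℕ+ × ℕ+ × ℕ+ => (t k.1 * t k.2.1 * t k.2.2) • T3 N s k.1 k.2.1 k.2.2)]
  · refine Finset.sum_congr rfl fun κ _ => ?_
    rw [finsum_pnat_prod_eq_sum (L := 4 * N + 1) (F := fun k : ℕ+ × ℕ+ =>
      (t κ.succPNat * t k.1 * t k.2) • T3 N s κ.succPNat k.1 k.2)]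
    · exact Finset.sum_congr rfl fun κ' _ => finsum_pnat_eq_sum (F := fun k : ℕ+ =>
        (t κ.succPNat * t κ'.succPNat * t k) • T3 N s κ.succPNat κ'.succPNat k) (h3 _ _)
    · exact fun κ' k'' h => h2 _ κ' k'' h
    · exact fun k' => finite_pnat (h3 _ k')
  · rintro κ ⟨k', k''⟩ h
    obtain ⟨κ', rfl⟩ := exists_succPNat k'
    obtain ⟨κ'', rfl⟩ := exists_succPNat k''
    exact hz _ _ _ (Or.inl h)
  · exact fun k => finite_pnat_prod (fun κ' k'' h => h2 k κ' k'' h) fun k' => finite_pnat (h3 k k')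

theorem toTrunc_T3 (t : ℕ+ → ℂ) (κ κ' κ'' : ℕ) : toTrunc N (T3 N t (κ + 1) (κ' + 1) (κ'' + 1)) =
    (fun a : Idx N => psiEntry (yT N) (lamT N) N κ a.1 a.2) ⬝ᵥ
      (((1 - Qsum N t)⁻¹.map (toTrunc N)).mulVec
        fun a => phiEntry (yT N) (lamT N) N κ' κ'' a.1 a.2) := by
  rw [T3, toTrunc_proj]
  simp only [dotProduct, mulVec, map_sum, map_mul, Matrix.map_apply, toTrunc_Psi, toTrunc_Phi]

end Assembly

end ClosedWalk

open ClosedWalk in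
theorem mainTheorem2 (N : ℕ) (Λ : ℕ+ → ℂ) (t : ℕ+ → ℂ)
    (ht : ∀ k, t k = Complex.exp (Λ k) - 1) :
    -- all the sums that occur are finite
    (∀ w ∈ walks N, {k : ℕ+ | w.rangeCount k ≠ 0}.Finite) ∧
    {k : ℕ+ | T1 N k ≠ 0}.Finite ∧
    {k : ℕ+ × ℕ+ | T2 N k.1 k.2 ≠ 0}.Finite ∧
    {k : ℕ+ | Q N k ≠ 0}.Finite ∧
    {k : ℕ+ × ℕ+ × ℕ+ | T3 N t k.1 k.2.1 k.2.2 ≠ 0}.Finite ∧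
    -- the inverse in the resolvent exists and is given by the geometric series
    IsUnit (1 - Qsum N t) ∧
    (∀ a b : Idx N, (1 - Qsum N t)⁻¹ a b = formalSum fun m => (Qsum N t ^ m) a b) ∧
    -- the joint generating function
    ∑ᶠ w ∈ walks N,
        Complex.exp (∑ᶠ k : ℕ+, Λ k * (w.rangeCount k : ℂ)) • (PowerSeries.X : ℂ⟦X⟧) ^ w.length =
      PowerSeries.X * PowerSeries.derivative ℂ
        (T0 N + ∑ᶠ k : ℕ+, t k • T1 N k
          + ∑ᶠ k : ℕ+ × ℕ+, (t k.1 * t k.2) • T2 N k.1 k.2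
          + ∑ᶠ k : ℕ+ × ℕ+ × ℕ+, (t k.1 * t k.2.1 * t k.2.2) • T3 N t k.1 k.2.1 k.2.2) := by
  have hunit := isUnit_one_sub_of_constantCoeff (constantCoeff_Qsum N t)
  refine ⟨fun w hw => finite_rangeCount_ne_zero hw,
    finite_pnat (F := fun k : ℕ+ => T1 N k) fun κ hκ => T1_eq_zero N hκ, finite_T2 N,
    finite_pnat (F := fun k : ℕ+ => Q N k) fun κ hκ => Q_eq_zero N hκ, finite_T3 N t, hunit,
    inv_one_sub_apply (constantCoeff_Qsum N t), ?_⟩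
  set L := 4 * N + 1 with hL
  -- all terms with `4 N < κ` vanish, and no walk visits a site more than `2 N` times
  set u : ℕ → ℂ := fun κ => if κ < L then t κ.succPNat else 0 with hu
  have hu0 : ∀ κ, L ≤ κ → u κ = 0 := fun κ hκ => if_neg (not_lt.mpr hκ)
  have hu1 : ∀ κ ∈ Finset.range L, u κ = t κ.succPNat := fun κ hκ =>
    if_pos (Finset.mem_range.mp hκ)
  have hK : (1 - Qsum N t)⁻¹.map (toTrunc N) * (1 - Matrix.of fun a b : Idx N =>
      ∑ κ ∈ Finset.range L, u κ • qEntry (yT N) (lamT N) N κ a.1 a.2 b.1 b.2) = 1 := by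
    have h1 := congrArg (toTrunc N).mapMatrix (Matrix.nonsing_inv_mul _
      ((Matrix.isUnit_iff_isUnit_det _).mp hunit))
    rw [map_mul, map_one, map_sub, map_one] at h1
    rw [← h1]
    congr 2
    ext a b
    rw [Matrix.of_apply, AlgHom.mapMatrix_apply, Matrix.map_apply, Qsum_eq_sum, Matrix.sum_apply,
      map_sum]
    refine Finset.sum_congr rfl fun κ hκ => ?_
    rw [Matrix.smul_apply, map_smul, toTrunc_Q, hu1 κ hκ]
  obtain ⟨F, hF1, hF2⟩ := exists_profileSum N (show 2 * N + 1 ≤ L by omega) hu0 hK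
  rw [← toTrunc_finsum_walks N (Λ := Λ) (fun κ hκ => (if_pos hκ).trans (ht _))
    (show 2 * N ≤ L by omega)] at hF1
  rw [finsum_T1, finsum_T2, finsum_T3]
  set W := T0 N + ∑ κ ∈ Finset.range (4 * N + 1), t κ.succPNat • T1 N (κ + 1) +
    ∑ κ ∈ Finset.range (4 * N + 1), ∑ κ' ∈ Finset.range (4 * N + 1),
      (t κ.succPNat * t κ'.succPNat) • T2 N (κ + 1) (κ' + 1) +
    ∑ κ ∈ Finset.range (4 * N + 1), ∑ κ' ∈ Finset.range (4 * N + 1),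
      ∑ κ'' ∈ Finset.range (4 * N + 1), (t κ.succPNat * t κ'.succPNat * t κ''.succPNat) •
        T3 N t (κ + 1) (κ' + 1) (κ'' + 1) with hW
  have hFW : toTrunc N F = toTrunc N W := by
    rw [hF2, hW, map_add, map_add, map_add, toTrunc_T0 N (show N ≤ L by omega), map_sum, map_sum,
      map_sum]
    congr 1
    · congr 1
      · congr 1
        refine Finset.sum_congr rfl fun κ hκ => ?_
        rw [map_smul, toTrunc_T1, hu1 κ hκ]
      · refine Finset.sum_congr rfl fun κ hκ => ?_
        rw [map_sum]
        refine Finset.sum_congr rfl fun κ' hκ' => ?_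
        rw [map_smul, toTrunc_T2, hu1 κ hκ, hu1 κ' hκ']
    · refine Finset.sum_congr rfl fun κ hκ => ?_
      rw [map_sum]
      refine Finset.sum_congr rfl fun κ' hκ' => ?_
      rw [map_sum]
      refine Finset.sum_congr rfl fun κ'' hκ'' => ?_
      rw [map_smul, toTrunc_T3, hu1 κ hκ, hu1 κ' hκ', hu1 κ'' hκ'']
  have hθ : ∀ (g : ℂ⟦X⟧) (n : ℕ),
      PowerSeries.coeff n (PowerSeries.X * PowerSeries.derivative ℂ g) =
        n * PowerSeries.coeff n g := by
    intro g n
    cases n with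
    | zero => simp
    | succ n =>
      rw [PowerSeries.coeff_succ_X_mul, PowerSeries.coeff_derivative, mul_comm]
      push_cast
      rfl
  have hT : ∀ (g : ℂ⟦X⟧) {n : ℕ}, 2 * N < n → PowerSeries.coeff n (proj (2 * N) g) = 0 :=
    fun g n hn => by rw [coeff_proj, if_neg (not_le.mpr hn)]
  ext n
  -- beyond degree `2 N` both sides vanish by definition
  rcases le_or_gt n (2 * N) with hn | hn
  · rw [← toTrunc_eq_iff.mp hF1 n hn, hθ, hθ, toTrunc_eq_iff.mp hFW n hn]
  · rw [coeff_finsum_walks N _ hn, hθ, hW]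
    simp only [map_add, map_sum, PowerSeries.coeff_smul, T0, T1, T2, T3, hT _ hn, smul_zero,
      Finset.sum_const_zero, add_zero, mul_zero]
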